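/- Let $k$ be a global function field, and let $L=\prod_{i=1}^r K_i$ be an étale $k$-algebra, where each $K_i/k$ is a finite separable field extension. Write $\mathbb F_q$ and $\mathbb F_{q_i}$ for the constant fields of $k$ and $K_i$. For a global function field $K$ and a place $w$ of $K$ let $\mathrm{ord}_w$ be the normalized valuation and $\deg w$ the degree of the residue field over the constant field of $K$; let $U_K=\prod_w O_w^\times$, and let $\mathbb A_K^{\times,0}$ be the kernel of the degree map $\mathbb A_K^\times\to\mathbb Z$, $(x_w)\mapsto\sum_w \deg(w)\,\mathrm{ord}_w(x_w)$. Put $\mathbb A_L^\times=\prod_i\mathbb A_{K_i}^\times$, $\mathbb A_L^{\times,0}=\prod_i\mathbb A_{K_i}^{\times,0}$ and $U_L=\prod_i U_{K_i}$, and let $N=N_{L/k}=\prod_i N_{K_i/k}$ denote the norm maps $L^\times\to k^\times$ and $\mathbb A_L^\times\to\mathbb A_k^\times$. Let $I_L^0=\prod_i \mathrm{Div}^0(K_i)$ be the group of tuples of divisors of degree zero and $P_L=\prod_i\{\mathrm{div}(f): f\in K_i^\times\}$ the group of tuples of principal divisors. Let $I_L^{(1)}$ be the kernel of the norm $N:I_L^0\to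 \mathrm{Div}^0(k)$, which maps a place $w$ of $K_i$ over the place $v$ of $k$ to $f(w/v)\,v$ with $f(w/v)$ the residue degree, and let $P_L^{(1)}=P_L\cap I_L^{(1)}$. Let $T=T_{L/k}=\ker(N_{L/k}:R_{L/k}\mathbb G_{m,L}\to\mathbb G_{m,k})$ be the multinorm-one torus. Let $T(\mathbb A_k)^0$ be the group of all $x\in T(\mathbb A_k)$ such that $\chi(x)\in\mathbb A_k^{\times,0}$ for every character $\chi:T\to\mathbb G_m$ defined over $k$, let $U_T=\prod_v T(O_v)=T(\mathbb A_k)\cap U_L$ be the maximal compact subgroup of $T(\mathbb A_k)$, and let $h^0(T)$ be the order of $\mathrm{Cl}^0(T)=T(\mathbb A_k)^0/(T(k)\,U_T)$. Then $\mathrm{Cl}^0(T_{L/k})$ is finite, the three indices below are finite, and $$h^0(T_{L/k})=\frac{[I_L^{(1)}:P_L^{(1)}]\cdot\bigl[\mathbb F_q^\times\cap N(L^\times):N\bigl(\prod_{i=1}^r\mathbb F_{q_i}^\times\bigr)\bigr]}{[U_k\cap N(\mathbb A_L^{\times,0}):N(U_L)]}.$$ -/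

import Mathlib

open scoped WithZero TensorProduct

universe u

noncomputable section

namespace MultinormTorus

/-! ### Places of a field, completions, degrees -/

section Places

/-- A place of `K`: a normalized discrete valuation of `K`, i.e. a valuation with value group
exactly `ℤ` (written multiplicatively, together with `0`). Every place of a global function field
is of this form, for exactly one such valuation. -/
def Place (K : Type u) [Field K] : Type u :=
  {v : Valuation K ℤᵐ⁰ // Function.Surjective v}

variable {k K : Type u} [Field k] [Field K] [Algebra k K]

namespace Place

/-- The normalized valuation of a place. -/
abbrev val (v : Place K) : Valuation K ℤᵐ⁰ := v.1

/-- The completion `K_v`. -/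
abbrev Completion (v : Place K) : Type u := v.val.Completion

end Place

/-- Scalar multiplications are uniformly continuous for the topology of a valuation; this makes
the completion an algebra over the base. -/
instance instUniformContinuousConstSMulWithVal (w : Valuation K ℤᵐ⁰) :
    UniformContinuousConstSMul k (WithVal w) where
  uniformContinuous_const_smul c := by
    have h : (fun x : WithVal w => c • x) =
        AddMonoidHom.mulLeft (algebraMap k (WithVal w) c) := by
      funext x
      simp [Algebra.smul_def]
    rw [h]
    exact uniformContinuous_addMonoidHom_of_continuous (continuous_const_mul _)

namespace Place

/-- The normalized additive valuation `ord_v` on `K_v^×`. -/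
def ord (v : Place K) (x : (v.Completion)ˣ) : ℤ :=
  -WithZero.log (Valued.v (x : v.Completion))

lemma ord_one (v : Place K) : v.ord 1 = 0 := by
  simp [ord]

lemma ord_mul (v : Place K) (x y : (v.Completion)ˣ) : v.ord (x * y) = v.ord x + v.ord y := by
  have hx : Valued.v (x : v.Completion) ≠ 0 := (Valuation.ne_zero_iff _).2 x.ne_zero
  have hy : Valued.v (y : v.Completion) ≠ 0 := (Valuation.ne_zero_iff _).2 y.ne_zero
  simp only [ord, Units.val_mul, map_mul, WithZero.log_mul hx hy]
  ring

lemma ord_inv (v : Place K) (x : (v.Completion)ˣ) : v.ord x⁻¹ = -v.ord x := by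
  have h := v.ord_mul x x⁻¹
  rw [mul_inv_cancel, ord_one] at h
  linarith

/-- The order of vanishing `ord_v (f)` of a nonzero element `f` of `K`. -/
def ordField (v : Place K) (f : Kˣ) : ℤ := -WithZero.log (v.val (f : K))

lemma ordField_mul (v : Place K) (f g : Kˣ) : v.ordField (f * g) = v.ordField f + v.ordField g := by
  have hf : v.val (f : K) ≠ 0 := (Valuation.ne_zero_iff _).2 f.ne_zero
  have hg : v.val (g : K) ≠ 0 := (Valuation.ne_zero_iff _).2 g.ne_zero
  simp only [ordField, Units.val_mul, map_mul, WithZero.log_mul hf hg]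
  ring

lemma ordField_inv (v : Place K) (f : Kˣ) : v.ordField f⁻¹ = -v.ordField f := by
  simp [ordField, WithZero.log_inv]

end Place

variable (K) in
/-- The constant field of `K`: the elements of `K` that are regular at every place, i.e. the
global sections of the structure sheaf of the complete regular curve with function field `K`. -/
def constants : Subring K := ⨅ v : Place K, v.val.valuationSubring.toSubring

/-- The inclusion of the constant field in the valuation ring of a place. -/
instance instAlgebraConstants (v : Place K) : Algebra (constants K) v.val.valuationSubring :=
  (Subring.inclusion (iInf_le (fun v : Place K => v.val.valuationSubring.toSubring) v) :
    constants K →+* v.val.valuationSubring.toSubring).toAlgebra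

namespace Place

/-- The residue field `κ(v)`. -/
abbrev residueField (v : Place K) : Type u := IsLocalRing.ResidueField v.val.valuationSubring

/-- The degree of a place: the degree of its residue field over the constant field of `K`. -/
def deg (v : Place K) : ℤ := (Module.finrank (constants K) v.residueField : ℤ)

end Place

end Places

/-! ### Ideles of a field -/

section Ideles

variable (K : Type u) [Field K]

/-- The product `∏_v K_v^×` over all places of `K`, in which the idele group lives. -/
abbrev LocalUnits : Type u := ∀ v : Place K, (v.Completion)ˣ

/-- The idele group `𝔸_K^×`: the families in `∏_v K_v^×` that are units at almost all places. -/
def ideles : Subgroup (LocalUnits K) where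
  carrier := {x | {v : Place K | v.ord (x v) ≠ 0}.Finite}
  one_mem' := by simp [Place.ord_one]
  mul_mem' {x y} hx hy := by
    refine (Set.Finite.union hx hy).subset fun v hv => ?_
    by_contra h
    simp only [Set.mem_union, Set.mem_ofPred_eq, not_or, not_not] at h
    exact hv (by rw [Pi.mul_apply, Place.ord_mul, h.1, h.2, add_zero])
  inv_mem' {x} hx := by
    refine hx.subset fun v hv h => hv ?_
    rw [Pi.inv_apply, Place.ord_inv, h, neg_zero]

/-- The group of unit ideles `U_K = ∏_v O_v^×`. -/
def unitIdeles : Subgroup (LocalUnits K) where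
  carrier := {x | ∀ v : Place K, v.ord (x v) = 0}
  one_mem' := by simp [Place.ord_one]
  mul_mem' {x y} hx hy := fun v => by rw [Pi.mul_apply, Place.ord_mul, hx v, hy v, add_zero]
  inv_mem' {x} hx := fun v => by rw [Pi.inv_apply, Place.ord_inv, hx v, neg_zero]

variable {K} in
/-- The degree `∑_v deg(v) ord_v(x_v)` of an idele (a finite sum for ideles). -/
def degree (x : LocalUnits K) : ℤ := ∑ᶠ v : Place K, v.deg * v.ord (x v)

variable {K} in
lemma degree_mul {x y : LocalUnits K} (hx : x ∈ ideles K) (hy : y ∈ ideles K) :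
    degree (x * y) = degree x + degree y := by
  unfold degree
  rw [← finsum_add_distrib]
  · exact finsum_congr fun v => by rw [Pi.mul_apply, Place.ord_mul, mul_add]
  · exact Set.Finite.subset hx fun v hv h => hv (by simp [h])
  · exact Set.Finite.subset hy fun v hv h => hv (by simp [h])

/-- The group `𝔸_K^{×,0}` of ideles of degree zero, the kernel of the degree map on ideles. -/
def idelesZero : Subgroup (LocalUnits K) where
  carrier := {x | x ∈ ideles K ∧ degree x = 0}
  one_mem' := ⟨one_mem _, by simp [degree, Place.ord_one]⟩
  mul_mem' {x y} hx hy := ⟨mul_mem hx.1 hy.1, by rw [degree_mul hx.1 hy.1, hx.2, hy.2, add_zero]⟩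
  inv_mem' {x} hx := by
    refine ⟨inv_mem hx.1, ?_⟩
    have h := degree_mul hx.1 (inv_mem hx.1)
    rw [mul_inv_cancel, hx.2, zero_add] at h
    rw [← h]
    simp [degree, Place.ord_one]

end Ideles

/-! ### Places in a finite extension -/

section Extension

variable (k : Type u) {K : Type u} [Field k] [Field K] [Algebra k K]

/-- The restriction of a discrete valuation along an algebraic extension is nontrivial. -/
lemma exists_val_lt_one [Algebra.IsAlgebraic k K] (w : Place K) :
    ∃ a : k, a ≠ 0 ∧ w.val (algebraMap k K a) < 1 := by
  by_contra! hcon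
  have hle : ∀ a : k, w.val (algebraMap k K a) ≤ 1 := by
    intro a
    rcases eq_or_ne a 0 with rfl | ha
    · simp
    · have := hcon a⁻¹ (inv_ne_zero ha)
      rw [map_inv₀, map_inv₀] at this
      exact (one_le_inv₀ (by
        rw [zero_lt_iff, Valuation.ne_zero_iff]
        exact (map_ne_zero _).2 ha)).1 this
  obtain ⟨y, hy⟩ := w.2 (WithZero.exp 1)
  have hint : IsIntegral k y := Algebra.IsIntegral.isIntegral y
  have h2 : IsIntegral w.val.integer y := by
    obtain ⟨p, hp, hpy⟩ := hint
    let f : k →+* w.val.integer := (algebraMap k K).codRestrict _ hle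
    refine ⟨p.map f, hp.map f, ?_⟩
    rw [Polynomial.eval₂_map]
    exact hpy
  have h3 : y ∈ w.val.integer := (Valuation.integer.integers w.val).mem_of_integral h2
  rw [Valuation.mem_integer_iff] at h3
  change w.1 y ≤ 1 at h3
  rw [hy, ← WithZero.exp_zero, WithZero.exp_le_exp] at h3
  omega

/-- Below every place of an algebraic extension there is a place of the base field. -/
lemma exists_place_under [Algebra.IsAlgebraic k K] (w : Place K) :
    ∃ v : Place k, v.val.HasExtension w.val := by
  let u : Valuation k ℤᵐ⁰ := w.val.comap (algebraMap k K)
  have hu0 : ∀ {a : k}, a ≠ 0 → u a ≠ 0 := fun ha => (Valuation.ne_zero_iff _).2 ha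
  let φ : Additive kˣ →+ ℤ :=
    { toFun := fun a => WithZero.log (u (a.toMul : k))
      map_zero' := by simp
      map_add' := fun a b => by
        simp only [toMul_add, Units.val_mul, map_mul]
        exact WithZero.log_mul (hu0 a.toMul.ne_zero) (hu0 b.toMul.ne_zero) }
  have hφ : ∀ {a : k} (ha : a ≠ 0),
      φ (Additive.ofMul (Units.mk0 a ha)) = WithZero.log (u a) := fun _ => rfl
  obtain ⟨e₀, he₀⟩ := Int.subgroup_cyclic φ.range
  rw [← AddSubgroup.zmultiples_eq_closure] at he₀
  obtain ⟨e, he, hepos⟩ : ∃ e : ℤ, φ.range = AddSubgroup.zmultiples e ∧ 0 < e := by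
    obtain ⟨a, ha, hlt⟩ := exists_val_lt_one k w
    have hne : WithZero.log (u a) ≠ 0 := by
      have : u a < 1 := hlt
      have h1 := WithZero.exp_log (hu0 ha)
      rw [← h1, ← WithZero.exp_zero, WithZero.exp_lt_exp] at this
      exact this.ne
    have h0 : e₀ ≠ 0 := by
      rintro rfl
      have hm : φ (Additive.ofMul (Units.mk0 a ha)) ∈ φ.range := ⟨_, rfl⟩
      rw [he₀, AddSubgroup.zmultiples_zero_eq_bot, AddSubgroup.mem_bot, hφ] at hm
      exact hne hm
    rcases lt_or_gt_of_ne h0 with h | h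
    · exact ⟨-e₀, by rw [he₀, AddSubgroup.zmultiples_neg], by omega⟩
    · exact ⟨e₀, he₀, h⟩
  have hdvd : ∀ {a : k}, a ≠ 0 → ∃ n : ℤ, u a = WithZero.exp (n * e) := by
    intro a ha
    have hm : φ (Additive.ofMul (Units.mk0 a ha)) ∈ φ.range := ⟨_, rfl⟩
    rw [he, AddSubgroup.mem_zmultiples_iff, hφ] at hm
    obtain ⟨n, hn⟩ := hm
    exact ⟨n, by rw [← WithZero.exp_log (hu0 ha), ← hn, smul_eq_mul]⟩
  classical
  let g : k → ℤᵐ⁰ := fun a => if a = 0 then 0 else WithZero.exp (WithZero.log (u a) / e)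
  have hg : ∀ {a : k} (_ : a ≠ 0) {n : ℤ} (_ : u a = WithZero.exp (n * e)),
      g a = WithZero.exp n := by
    intro a ha n hn
    simp only [g, if_neg ha, hn, WithZero.log_exp]
    rw [Int.mul_ediv_cancel _ hepos.ne']
  have hle : ∀ a b : k, g a ≤ g b ↔ u a ≤ u b := by
    intro a b
    rcases eq_or_ne a 0 with rfl | ha
    · simp [g]
    rcases eq_or_ne b 0 with rfl | hb
    · obtain ⟨n, hn⟩ := hdvd ha
      rw [hg ha hn, hn]
      simp [g]
    obtain ⟨n, hn⟩ := hdvd ha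
    obtain ⟨m, hm⟩ := hdvd hb
    rw [hg ha hn, hg hb hm, hn, hm, WithZero.exp_le_exp, WithZero.exp_le_exp]
    exact (mul_le_mul_iff_left₀ hepos).symm
  let v : Valuation k ℤᵐ⁰ :=
    { toFun := g
      map_zero' := by simp [g]
      map_one' := by simp [g]
      map_mul' := fun a b => by
        rcases eq_or_ne a 0 with rfl | ha
        · simp [g]
        rcases eq_or_ne b 0 with rfl | hb
        · simp [g]
        obtain ⟨n, hn⟩ := hdvd ha
        obtain ⟨m, hm⟩ := hdvd hb
        have : u (a * b) = WithZero.exp ((n + m) * e) := by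
          rw [map_mul, hn, hm, add_mul, WithZero.exp_add]
        rw [hg ha hn, hg hb hm, hg (mul_ne_zero ha hb) this, WithZero.exp_add]
      map_add_le_max' := fun a b => by
        rcases le_total (u a) (u b) with h | h
        · rw [max_eq_right ((hle a b).2 h)]
          exact (hle _ _).2 ((u.map_add a b).trans (max_le h le_rfl))
        · rw [max_eq_left ((hle b a).2 h)]
          exact (hle _ _).2 ((u.map_add a b).trans (max_le le_rfl h)) }
  have hv : Function.Surjective v := by
    intro γ
    rcases eq_or_ne γ 0 with rfl | hγ
    · exact ⟨0, map_zero v⟩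
    have hm : (WithZero.log γ) * e ∈ φ.range := by
      rw [he, AddSubgroup.mem_zmultiples_iff]
      exact ⟨_, smul_eq_mul _ _⟩
    obtain ⟨a, ha⟩ := hm
    refine ⟨(a.toMul : k), ?_⟩
    have hua : u (a.toMul : k) = WithZero.exp (WithZero.log γ * e) := by
      rw [← ha]
      exact (WithZero.exp_log (hu0 a.toMul.ne_zero)).symm
    exact (hg a.toMul.ne_zero hua).trans (WithZero.exp_log hγ)
  exact ⟨⟨v, hv⟩, ⟨fun a b => hle a b⟩⟩

variable [Algebra.IsAlgebraic k K]

/-- The place of `k` below the place `w` of `K`: the normalized valuation of `k` that is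
equivalent to the restriction of `w`. -/
def Place.under (w : Place K) : Place k := (exists_place_under k w).choose

instance instHasExtension (w : Place K) : (w.under k).val.HasExtension w.val :=
  (exists_place_under k w).choose_spec

lemma continuous_map_under (w : Place K) :
    Continuous (WithVal.map (w.under k).val w.val (algebraMap k K)) := by
  refine continuous_of_continuousAt_zero _ ?_
  simp_rw [ContinuousAt, map_zero, (Valued.hasBasis_nhds_zero _ _).tendsto_iff
    (Valued.hasBasis_nhds_zero _ _), true_and, forall_const]
  intro γ
  obtain ⟨r, s, hr, hs, hrs⟩ := Valuation.exists_div_eq_of_unit Valued.v γ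
  obtain ⟨a, ha, hlt⟩ := exists_val_lt_one k w
  have hr' : 0 < w.val r.ofVal := hr
  have hs' : 0 < w.val s.ofVal := hs
  have hq : 0 < w.val r.ofVal / w.val s.ofVal := div_pos hr' hs'
  obtain ⟨n, hn⟩ : ∃ n : ℕ, w.val (algebraMap k K a) ^ n < w.val r.ofVal / w.val s.ofVal := by
    have h0 : w.val (algebraMap k K a) ≠ 0 :=
      (Valuation.ne_zero_iff _).2 ((map_ne_zero _).2 ha)
    rw [← WithZero.exp_log h0, ← WithZero.exp_zero, WithZero.exp_lt_exp] at hlt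
    rw [← WithZero.exp_log h0, ← WithZero.exp_log hq.ne']
    refine ⟨(1 - WithZero.log (w.val r.ofVal / w.val s.ofVal)).toNat, ?_⟩
    rw [← WithZero.exp_nsmul, WithZero.exp_lt_exp, nsmul_eq_mul]
    have := Int.self_le_toNat (1 - WithZero.log (w.val r.ofVal / w.val s.ofVal))
    nlinarith
  have han : WithVal.toVal (w.under k).val (a ^ n) ≠ 0 := by
    simpa using fun h => absurd h ha
  refine ⟨Units.mk0 (Valued.v.restrict (WithVal.toVal (w.under k).val (a ^ n))) ?_, ?_⟩
  · exact ((Valuation.restrict_pos_iff _ _).2 (zero_lt_iff.2 ((Valuation.ne_zero_iff _).2 han))).ne'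
  · intro x hx
    simp only [Units.val_mk0, Set.mem_ofPred_eq, Valuation.restrict_lt_iff] at hx
    have hx' : (w.under k).val x.ofVal < (w.under k).val (a ^ n) := hx
    rw [← Valuation.HasExtension.val_map_lt_iff (w.under k).val w.val, map_pow, map_pow] at hx'
    have h2 := hx'.trans hn
    rw [Set.mem_ofPred_eq, ← hrs, lt_div_iff₀ ((Valuation.restrict_pos_iff _ _).2 hs), ← map_mul,
      Valuation.restrict_lt_iff, map_mul]
    exact (lt_div_iff₀ hs').1 h2

/-- The canonical embedding `k_v → K_w` for a place `w` of `K` above `v`. -/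
def completionMap (w : Place K) : (w.under k).Completion →ₐ[k] w.Completion where
  __ := UniformSpace.Completion.mapRingHom _ (continuous_map_under k w)
  commutes' _ := UniformSpace.Completion.mapRingHom_coe (continuous_map_under k w) _

/-- The residue degree `f(w/v) = [κ(w) : κ(v)]`, where `v` is the place of `k` below `w`. -/
def residueDegree (w : Place K) : ℤ :=
  (Module.finrank (w.under k).residueField w.residueField : ℤ)

end Extension

/-! ### The multinorm-one torus and its characters -/

section Torus

variable (k L : Type u) [Field k] [CommRing L] [Algebra k L]

/-- The `R`-points `ker (N : (R ⊗_k L)^× → R^×)` of the multinorm-one torus `T_{L/k}`, for a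
`k`-algebra `R`. -/
def torusPoints (R : Type u) [CommRing R] [Algebra k R] : Subgroup (R ⊗[k] L)ˣ :=
  (Units.map (Algebra.norm R : R ⊗[k] L →* R)).ker

/-- The norm of a finite-dimensional algebra is compatible with base change. -/
lemma norm_map [FiniteDimensional k L] {R S : Type u} [CommRing R] [Algebra k R] [CommRing S]
    [Algebra k S] (f : R →ₐ[k] S) (x : R ⊗[k] L) :
    Algebra.norm S (Algebra.TensorProduct.map f (AlgHom.id k L) x) = f (Algebra.norm R x) := by
  classical
  let b := Module.finBasis k L
  have key : ∀ (y : R ⊗[k] L) i, (b.baseChange S).repr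
      (Algebra.TensorProduct.map f (AlgHom.id k L) y) i = f ((b.baseChange R).repr y i) := by
    intro y i
    induction y using TensorProduct.induction_on with
    | zero => simp
    | tmul a l => simp [Module.Basis.baseChange_repr_tmul, Algebra.smul_def]
    | add y z hy hz => simp [hy, hz]
  rw [Algebra.norm_eq_matrix_det (b.baseChange S), Algebra.norm_eq_matrix_det (b.baseChange R),
    AlgHom.map_det]
  congr 1
  ext i j
  rw [AlgHom.mapMatrix_apply, Matrix.map_apply, Algebra.leftMulMatrix_eq_repr_mul,
    Algebra.leftMulMatrix_eq_repr_mul, ← key,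
    map_mul (Algebra.TensorProduct.map f (AlgHom.id k L))]
  simp only [Module.Basis.baseChange_apply, Algebra.TensorProduct.map_tmul, map_one,
    AlgHom.id_apply]

/-- Functoriality of the points of the multinorm-one torus. -/
def torusMap [FiniteDimensional k L] {R S : Type u} [CommRing R] [Algebra k R] [CommRing S]
    [Algebra k S] (f : R →ₐ[k] S) : torusPoints k L R →* torusPoints k L S :=
  ((Units.map (Algebra.TensorProduct.map f (AlgHom.id k L) : R ⊗[k] L →* S ⊗[k] L)).comp
    (torusPoints k L R).subtype).codRestrict _ fun x => by
      have hx : Algebra.norm R ((x : (R ⊗[k] L)ˣ) : R ⊗[k] L) = 1 :=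
        congrArg Units.val (MonoidHom.mem_ker.1 x.2)
      refine MonoidHom.mem_ker.2 (Units.ext ?_)
      change Algebra.norm S (Algebra.TensorProduct.map f (AlgHom.id k L) _) = 1
      rw [norm_map]
      exact (congrArg f hx).trans (map_one f)

/-- A character of `T_{L/k}` defined over `k`, i.e. an element of the group of Galois invariants
of the character module of `T_{L/k}`: a homomorphism of group functors `T_{L/k} → 𝔾_m` on
`k`-algebras. -/
structure TorusCharacter [FiniteDimensional k L] where
  /-- The homomorphism on `R`-points. -/
  app : ∀ (R : Type u) [CommRing R] [Algebra k R], torusPoints k L R →* Rˣ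
  naturality : ∀ {R S : Type u} [CommRing R] [Algebra k R] [CommRing S] [Algebra k S]
    (f : R →ₐ[k] S) (x : torusPoints k L R),
    app S (torusMap k L f x) = Units.map (f : R →* S) (app R x)

end Torus

/-! ### Ideles, units and divisors of the étale algebra `L = ∏ K_i` -/

section Etale

variable (k : Type u) [Field k] {r : ℕ} (K : Fin r → Type u) [∀ i, Field (K i)]
  [∀ i, Algebra k (K i)]

/-- The product `∏_v L_v^×` over all places `v` of `k`, where `L_v = k_v ⊗_k L`. -/
abbrev LocalUnitsEtale : Type u := ∀ v : Place k, (v.Completion ⊗[k] (∀ i, K i))ˣ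

/-- The norm map `∏_v L_v^× → ∏_v k_v^×`. -/
def localNorm : LocalUnitsEtale k K →* LocalUnits k :=
  MonoidHom.pi fun v =>
    (Units.map (Algebra.norm v.Completion : v.Completion ⊗[k] (∀ i, K i) →* v.Completion)).comp
      (Pi.evalMonoidHom _ v)

/-- The norm map `L^× → k^×`. -/
def fieldNorm : (∀ i, K i)ˣ →* kˣ := Units.map (Algebra.norm k : (∀ i, K i) →* k)

/-- The group `∏_i 𝔽_{q_i}^×` of constants of `L`, where `𝔽_{q_i}` is the constant field
of `K_i`. -/
def constantUnitsEtale : Subgroup (∀ i, K i)ˣ :=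
  ⨅ i, (constants (K i)).toSubmonoid.units.comap
    (Units.map (Pi.evalMonoidHom (fun i => K i) i))

variable [∀ i, FiniteDimensional k (K i)]

variable {K} in
/-- For a place `w` of `K_i` above the place `v` of `k`, the projection `L_v → K_{i,w}` of
`L_v = ∏_{w ∣ v} L_w` to the factor with index `w`. -/
def projection (i : Fin r) (w : Place (K i)) :
    (w.under k).Completion ⊗[k] (∀ i, K i) →ₐ[k] w.Completion :=
  Algebra.TensorProduct.lift (completionMap k w)
    ((IsScalarTower.toAlgHom k (K i) w.Completion).comp (Pi.evalAlgHom k K i))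
    fun _ _ => Commute.all _ _

/-- The identification of `∏_v L_v^×` with `∏_i ∏_w K_{i,w}^×`, followed by the `i`-th
projection. -/
def component (i : Fin r) : LocalUnitsEtale k K →* LocalUnits (K i) :=
  MonoidHom.pi fun w =>
    (Units.map (projection k i w : (w.under k).Completion ⊗[k] (∀ i, K i) →* w.Completion)).comp
      (Pi.evalMonoidHom _ (w.under k))

/-- The idele group `𝔸_L^× = ∏_i 𝔸_{K_i}^×`. -/
def idelesEtale : Subgroup (LocalUnitsEtale k K) :=
  ⨅ i, (ideles (K i)).comap (component k K i)

/-- The group of unit ideles `U_L = ∏_i U_{K_i}`. -/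
def unitIdelesEtale : Subgroup (LocalUnitsEtale k K) :=
  ⨅ i, (unitIdeles (K i)).comap (component k K i)

/-- The group `𝔸_L^{×,0} = ∏_i 𝔸_{K_i}^{×,0}`. -/
def idelesZeroEtale : Subgroup (LocalUnitsEtale k K) :=
  ⨅ i, (idelesZero (K i)).comap (component k K i)

/-- The group of divisors `∏_i Div(Y_i)` of `L`, where `Y_i` is the complete regular curve with
function field `K_i`. -/
abbrev Divisors : Type u := ∀ i, (Place (K i) →₀ ℤ)

/-- The norm of divisors, which sends a place `w` of `K_i` to `f(w/v) v`, with `v` the place of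
`k` below `w`. -/
def divisorNorm : Divisors K →+ (Place k →₀ ℤ) :=
  ∑ i, (Finsupp.liftAddHom fun w : Place (K i) =>
    (Finsupp.singleAddHom (w.under k)).comp (AddMonoidHom.mulRight (residueDegree k w))).comp
      (Pi.evalAddMonoidHom _ i)

/-- The group `I_L^0 = ∏_i Div^0(Y_i)` of divisors all of whose components have degree zero. -/
def divisorsZero : AddSubgroup (Divisors K) :=
  ⨅ i, (((Finsupp.liftAddHom fun w : Place (K i) => AddMonoidHom.mulRight w.deg).comp
      (Pi.evalAddMonoidHom _ i) : Divisors K →+ ℤ)).ker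

/-- The group `P_L = ∏_i P_{K_i}` of principal divisors of `L`. -/
def principalDivisors : AddSubgroup (Divisors K) where
  carrier := {D | ∀ i, ∃ f : (K i)ˣ, ∀ w : Place (K i), D i w = w.ordField f}
  zero_mem' := fun _ => ⟨1, fun w => by simp [Place.ordField]⟩
  add_mem' {D E} hD hE := fun i => by
    obtain ⟨f, hf⟩ := hD i
    obtain ⟨g, hg⟩ := hE i
    exact ⟨f * g, fun w => by rw [Pi.add_apply, Finsupp.add_apply, hf, hg, Place.ordField_mul]⟩
  neg_mem' {D} hD := fun i => by
    obtain ⟨f, hf⟩ := hD i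
    exact ⟨f⁻¹, fun w => by rw [Pi.neg_apply, Finsupp.neg_apply, hf, Place.ordField_inv]⟩

/-- The group `I_L^{(1)}`: the kernel of the norm on `I_L^0`. -/
def divisorsNormOne : AddSubgroup (Divisors K) := divisorsZero K ⊓ (divisorNorm k K).ker

/-- The group `P_L^{(1)} = P_L ∩ I_L^{(1)}`. -/
def principalDivisorsNormOne : AddSubgroup (Divisors K) :=
  principalDivisors K ⊓ divisorsNormOne k K

/-! ### The class group of degree zero of the multinorm-one torus -/

/-- The product `∏_v T(k_v)` over all places of `k`, for `T = T_{L/k}`. -/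
abbrev LocalTorus : Type u := ∀ v : Place k, torusPoints k (∀ i, K i) v.Completion

/-- The inclusion `∏_v T(k_v) → ∏_v L_v^×`. -/
def localTorusInclusion : LocalTorus k K →* LocalUnitsEtale k K :=
  MonoidHom.pi fun v => (torusPoints k (∀ i, K i) v.Completion).subtype.comp
    (Pi.evalMonoidHom _ v)

/-- The group `T(𝔸_k)` of adelic points: the norm-one ideles of `L`. -/
def torusAdelic : Subgroup (LocalTorus k K) :=
  (idelesEtale k K).comap (localTorusInclusion k K)

/-- The maximal compact subgroup `U_T = ∏_v T(O_v)`: the norm-one unit ideles of `L`. -/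
def torusUnits : Subgroup (LocalTorus k K) :=
  (unitIdelesEtale k K).comap (localTorusInclusion k K)

/-- The diagonal image of `T(k)`. -/
def torusRational : Subgroup (LocalTorus k K) :=
  (MonoidHom.pi fun v : Place k =>
    torusMap k (∀ i, K i) (Algebra.ofId k v.Completion)).range

variable {k K} in
/-- The map induced by a character on `∏_v T(k_v)`. -/
def TorusCharacter.local (χ : TorusCharacter k (∀ i, K i)) : LocalTorus k K →* LocalUnits k :=
  MonoidHom.pi fun v => (χ.app v.Completion).comp (Pi.evalMonoidHom _ v)

/-- The group `T(𝔸_k)^0` of adelic points `x` such that, for every character `χ` of `T` defined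
over `k`, the idele `χ(x)` has degree zero. -/
def torusAdelicZero : Subgroup (LocalTorus k K) :=
  torusAdelic k K ⊓ ⨅ χ : TorusCharacter k (∀ i, K i), (idelesZero k).comap χ.local

/-- The class group of degree zero `Cl^0(T) = T(𝔸_k)^0 / (T(k) U_T)` of `T = T_{L/k}`. -/
abbrev TorusClassGroupZero : Type u :=
  torusAdelicZero k K ⧸ (torusRational k K ⊔ torusUnits k K).subgroupOf (torusAdelicZero k K)

/-- The class number of degree zero `h^0(T_{L/k})`. -/
def torusClassNumberZero : ℕ := Nat.card (TorusClassGroupZero k K)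

end Etale

end MultinormTorus

end

open MultinormTorus

/-!
# The class number formula for the multinorm-one torus over a global function field

All the groups in the formula are compared inside `M = ∏_v L_v^×`. Put
`A = 𝔸_L^{×,0}`, `U = U_L`, `J = {x ∈ A | N(x) ∈ U_k}` and `T₁ = {x ∈ A | N(x) = 1}`. The subgroup
`(T₁ ∩ L^×) U` of `J` is contained in both `T₁ U` and `(L^× ∩ J) U`, and its index in `J` can be
computed through either of them (`relIndex_mul_relIndex_eq`):

* `[J : T₁ U] = [U_k ∩ N(A) : N(U)]`, because `N` maps `J` onto `U_k ∩ N(A)`;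
* `[T₁ U : (T₁ ∩ L^×) U] = [T₁ : T(k) U_T]`;
* `[J : (L^× ∩ J) U] = [I_L^{(1)} : P_L^{(1)}]`, because the divisor map sends `J` onto `I_L^{(1)}`
  with kernel `U` (`relIndex_principalDivisorsNormOne`);
* `[(L^× ∩ J) U : (T₁ ∩ L^×) U] = [𝔽_q^× ∩ N(L^×) : N(∏ 𝔽_{q_i}^×)]`, because an element of `L^×`
  lies in `J` if and only if its norm is constant, and in `U` if and only if its components are
  constant.

The last index is finite because `𝔽_q^×` is, and `[I_L^{(1)} : P_L^{(1)}]` is finite because there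
are finitely many divisor classes of degree zero (`exists_finite_representatives`). Hence all four
indices are finite.

It remains to see that `T₁ = T(𝔸_k)^0` (`torusAdelicZero_eq`). For one inclusion, the norms
`N_{K_i/k}` are characters of `T`, and by the local norm formula (`ord_factorNorm`) the degree of
`N_{K_i/k}(x)` vanishes if and only if the degree of the component of `x` at `K_i` does. For the
other one, a power of `x ∈ T₁` lies in `T(k) U_T`, since the index of this group in `T₁` is finite,
so that it suffices to consider the values of characters on `T(k)` and on `U_T`. The former lie
in `k^×` and have degree zero by the product formula. The latter are units: a character is a
polynomial in the coordinates on `T` (`TorusCharacter.exists_polynomial`), hence bounded on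
the bounded subgroup `U_T`, and so are all powers of its values (`ord_local_of_mem_torusUnits`).

The arithmetic of function fields that is used consists of the norm formula `Place.ordField_norm`,
the product formula and the finiteness of residue fields and of the sets of zeros and poles. They
are collected in the class `IsGlobal`, verified for `F(t)`, and inherited by finite separable
extensions (`IsGlobal.of_extension`); every global function field is such an extension of a field
of rational functions (`exists_separable_ratFunc`).
-/

noncomputable section

namespace MultinormTorus

open IsDedekindDomain Filter Topology

/-! ### Places and their order functions -/

section PlaceBasics

variable {K : Type u} [Field K]

lemma Place.exists_val_eq_exp (v : Place K) (n : ℤ) :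
    ∃ x : K, x ≠ 0 ∧ v.val x = WithZero.exp n := by
  obtain ⟨x, hx⟩ := v.2 (WithZero.exp n)
  refine ⟨x, ?_, hx⟩
  rintro rfl
  rw [map_zero] at hx
  exact WithZero.exp_ne_zero hx.symm

lemma Place.val_units_ne_zero (v : Place K) (f : Kˣ) : v.val (f : K) ≠ 0 :=
  (Valuation.ne_zero_iff _).2 f.ne_zero

lemma Place.val_eq_exp_ordField (v : Place K) (f : Kˣ) :
    v.val (f : K) = WithZero.exp (-v.ordField f) := by
  rw [Place.ordField, neg_neg, WithZero.exp_log (v.val_units_ne_zero f)]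

lemma Place.val_le_exp_iff (v : Place K) (f : Kˣ) (n : ℤ) :
    v.val (f : K) ≤ WithZero.exp n ↔ -n ≤ v.ordField f := by
  rw [v.val_eq_exp_ordField, WithZero.exp_le_exp]
  omega

lemma Place.val_eq_exp_iff (v : Place K) (f : Kˣ) (n : ℤ) :
    v.val (f : K) = WithZero.exp n ↔ v.ordField f = -n := by
  rw [v.val_eq_exp_ordField, WithZero.exp_inj]
  omega

lemma Place.val_le_one_iff (v : Place K) (f : Kˣ) : v.val (f : K) ≤ 1 ↔ 0 ≤ v.ordField f := by
  rw [← WithZero.exp_zero, v.val_le_exp_iff, neg_zero]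

lemma Place.val_lt_one_iff (v : Place K) (f : Kˣ) : v.val (f : K) < 1 ↔ 0 < v.ordField f := by
  rw [← WithZero.exp_zero, v.val_eq_exp_ordField, WithZero.exp_lt_exp]
  omega

lemma Place.val_eq_one_iff (v : Place K) (f : Kˣ) : v.val (f : K) = 1 ↔ v.ordField f = 0 := by
  rw [← WithZero.exp_zero, v.val_eq_exp_iff, neg_zero]

lemma Place.ordField_one (v : Place K) : v.ordField 1 = 0 := by
  simp [Place.ordField]

lemma Place.ordField_pow (v : Place K) (f : Kˣ) (n : ℕ) :
    v.ordField (f ^ n) = n * v.ordField f := by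
  induction n with
  | zero => simp [Place.ordField_one]
  | succ n ih => rw [pow_succ, Place.ordField_mul, ih]; push_cast; ring

lemma Place.ordField_zpow (v : Place K) (f : Kˣ) (n : ℤ) :
    v.ordField (f ^ n) = n * v.ordField f := by
  obtain ⟨m, rfl | rfl⟩ := n.eq_nat_or_neg
  · simp [Place.ordField_pow]
  · rw [zpow_neg, Place.ordField_inv, zpow_natCast, Place.ordField_pow]; ring

lemma Place.ordField_prod {ι : Type*} (v : Place K) (s : Finset ι) (f : ι → Kˣ) :
    v.ordField (∏ i ∈ s, f i) = ∑ i ∈ s, v.ordField (f i) := by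
  classical
  induction s using Finset.induction_on with
  | empty => simp [Place.ordField_one]
  | insert a s ha ih => rw [Finset.prod_insert ha, Finset.sum_insert ha, Place.ordField_mul, ih]

/-- A normalized discrete valuation is determined by its valuation ring, and valuation rings of
places are maximal among themselves. -/
theorem Place.eq_of_le {v w : Place K} (h : ∀ x : K, v.val x ≤ 1 → w.val x ≤ 1) : v = w := by
  obtain ⟨ϖ, hϖ0, hϖ⟩ := v.exists_val_eq_exp (-1)
  have hunit : ∀ x : K, v.val x = 1 → w.val x = 1 := by
    intro x hx
    refine le_antisymm (h x hx.le) ?_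
    have h1 := h x⁻¹ (by rw [map_inv₀, hx, inv_one])
    rw [map_inv₀] at h1
    have hx0 : x ≠ 0 := by rintro rfl; simp at hx
    exact (inv_le_one₀ (zero_lt_iff.2 ((Valuation.ne_zero_iff _).2 hx0))).1 h1
  -- as units at `v` are units at `w`, the order at `w` is a multiple of the order at `v`; the
  -- factor is one because both are normalized
  let ϖ' : Kˣ := Units.mk0 ϖ hϖ0
  have hϖv : v.ordField ϖ' = 1 := by
    have := (v.val_eq_exp_iff ϖ' (-1)).1 hϖ
    simpa using this
  have hord : ∀ f : Kˣ, w.ordField f = v.ordField f * w.ordField ϖ' := by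
    intro f
    have h1 : v.ordField (f * (ϖ' ^ v.ordField f)⁻¹) = 0 := by
      rw [Place.ordField_mul, Place.ordField_inv, Place.ordField_zpow, hϖv]
      ring
    have h2 := (w.val_eq_one_iff _).1 (hunit _ ((v.val_eq_one_iff _).2 h1))
    rw [Place.ordField_mul, Place.ordField_inv, Place.ordField_zpow] at h2
    linarith
  have hnonneg : 0 ≤ w.ordField ϖ' :=
    (w.val_le_one_iff ϖ').1 (h _ ((v.val_le_one_iff ϖ').2 (by rw [hϖv]; norm_num)))
  have hone : w.ordField ϖ' = 1 := by
    obtain ⟨y, hy0, hy⟩ := w.exists_val_eq_exp (-1)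
    have h1 := (w.val_eq_exp_iff (Units.mk0 y hy0) (-1)).1 hy
    rw [hord, neg_neg] at h1
    rcases Int.eq_one_or_neg_one_of_mul_eq_one' h1 with h2 | h2
    · exact h2.2
    · omega
  refine Subtype.ext (Valuation.ext fun x => ?_)
  rcases eq_or_ne x 0 with rfl | hx
  · simp
  · have h1 := v.val_eq_exp_ordField (Units.mk0 x hx)
    have h2 := w.val_eq_exp_ordField (Units.mk0 x hx)
    rw [hord, hone, mul_one, ← h1] at h2
    exact h2.symm

variable (K) in
/-- The place of `K` defined by a maximal ideal of a Dedekind domain with fraction field `K`. -/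
def Place.ofPrime {B : Type*} [CommRing B] [IsDedekindDomain B] [Algebra B K] [IsFractionRing B K]
    (P : HeightOneSpectrum B) : Place K :=
  ⟨P.valuation K, P.valuation_surjective K⟩

section Dedekind

variable {B : Type*} [CommRing B] [IsDedekindDomain B] [Algebra B K] [IsFractionRing B K]

lemma Place.ofPrime_le_one (P : HeightOneSpectrum B) (b : B) :
    (Place.ofPrime K P).val (algebraMap B K b) ≤ 1 :=
  P.valuation_le_one b

lemma Place.ofPrime_lt_one_iff (P : HeightOneSpectrum B) (b : B) :
    (Place.ofPrime K P).val (algebraMap B K b) < 1 ↔ b ∈ P.asIdeal :=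
  P.valuation_lt_one_iff_mem b

lemma Place.ofPrime_injective :
    Function.Injective (Place.ofPrime K : HeightOneSpectrum B → Place K) := by
  intro P Q h
  refine HeightOneSpectrum.ext (Ideal.ext fun b => ?_)
  rw [← Place.ofPrime_lt_one_iff (K := K), ← Place.ofPrime_lt_one_iff (K := K), h]

/-- A place whose valuation ring contains a Dedekind domain `B` with fraction field `K` is the
valuation of a maximal ideal of `B`. -/
theorem Place.exists_ofPrime_eq (w : Place K) (h : ∀ b : B, w.val (algebraMap B K b) ≤ 1) :
    ∃ P : HeightOneSpectrum B, Place.ofPrime K P = w := by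
  -- the center of the place on `B`
  let I : Ideal B :=
    { carrier := {b | w.val (algebraMap B K b) < 1}
      zero_mem' := by simp
      add_mem' := fun {a b} ha hb => by
        simp only [Set.mem_ofPred_eq, map_add] at ha hb ⊢
        exact (w.val.map_add _ _).trans_lt (max_lt ha hb)
      smul_mem' := fun c {b} hb => by
        simp only [Set.mem_ofPred_eq, smul_eq_mul, map_mul] at hb ⊢
        exact mul_lt_one_of_nonneg_of_lt_one_right (h c) zero_le hb }
  have hmem : ∀ b, b ∈ I ↔ w.val (algebraMap B K b) < 1 := fun _ => Iff.rfl
  have hprime : I.IsPrime := by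
    refine ⟨fun h1 => ?_, fun {a b} hab => ?_⟩
    · have := (Ideal.eq_top_iff_one I).1 h1
      rw [hmem] at this
      simp at this
    · by_contra! hcon
      rw [hmem, hmem, not_lt, not_lt] at hcon
      rw [hmem, map_mul, map_mul, le_antisymm (h a) hcon.1, le_antisymm (h b) hcon.2] at hab
      simp at hab
  have hne : I ≠ ⊥ := by
    obtain ⟨x, hx0, hx⟩ := w.exists_val_eq_exp (-1)
    obtain ⟨a, b, hb, rfl⟩ := IsFractionRing.div_surjective (A := B) x
    have hb0 : algebraMap B K b ≠ 0 := by
      rintro h0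
      rw [h0, div_zero] at hx0
      exact hx0 rfl
    intro hbot
    have ha : a ∈ I := by
      rw [hmem]
      have : algebraMap B K a = algebraMap B K a / algebraMap B K b * algebraMap B K b := by
        rw [div_mul_cancel₀ _ hb0]
      rw [this, map_mul, hx]
      exact mul_lt_one_of_nonneg_of_lt_one_left zero_le
        (by rw [← WithZero.exp_zero, WithZero.exp_lt_exp]; norm_num) (h b)
    rw [hbot, Ideal.mem_bot] at ha
    rw [ha, map_zero, zero_div] at hx0
    exact hx0 rfl
  refine ⟨⟨I, hprime, hne⟩, Place.eq_of_le fun x hx => ?_⟩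
  obtain ⟨n, d, hnd⟩ := HeightOneSpectrum.exists_primeCompl_mul_eq_of_integer
    (K := K) _ x hx
  have hd : w.val (algebraMap B K d) = 1 := by
    refine le_antisymm (h _) (not_lt.1 fun hlt => ?_)
    exact d.2 ((hmem _).2 hlt)
  have : w.val x = w.val (algebraMap B K n) := by
    rw [← hnd, map_mul, hd]
    simp
  rw [this]
  exact h n

lemma Place.finite_setOf_ofPrime_ne_zero (f : Kˣ) :
    {P : HeightOneSpectrum B | (Place.ofPrime K P).ordField f ≠ 0}.Finite := by
  refine ((HeightOneSpectrum.Support.finite B (f : K)).union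
    (HeightOneSpectrum.Support.finite B ((f⁻¹ : Kˣ) : K))).subset fun P hP => ?_
  have key : ∀ g : Kˣ, P ∈ HeightOneSpectrum.Support B (g : K) ↔
      (Place.ofPrime K P).ordField g < 0 := by
    intro g
    have h1 : P ∈ HeightOneSpectrum.Support B (g : K) ↔
        ¬ ((Place.ofPrime K P).val (g : K) ≤ 1) := by
      simp only [HeightOneSpectrum.Support, Set.mem_ofPred_eq]
      exact not_le.symm
    rw [h1, Place.val_le_one_iff, not_le]
  rw [Set.mem_union, key, key, Place.ordField_inv]
  have : (Place.ofPrime K P).ordField f ≠ 0 := hP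
  omega

end Dedekind

instance Place.instIsDiscreteValuationRing (v : Place K) :
    IsDiscreteValuationRing v.val.valuationSubring := by
  have : v.val.IsNontrivial := by
    obtain ⟨x, hx0, hx⟩ := v.exists_val_eq_exp 1
    exact ⟨x, by rw [hx]; exact WithZero.exp_ne_zero, by
      rw [hx, ← WithZero.exp_zero, Ne, WithZero.exp_inj]; norm_num⟩
  infer_instance

end PlaceBasics

/-! ### Residue fields, places above a place, the norm formula -/

section ResidueFields

variable {K : Type u} [Field K]

lemma Place.mem_maximalIdeal_iff (v : Place K) (x : v.val.valuationSubring) :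
    x ∈ IsLocalRing.maximalIdeal v.val.valuationSubring ↔ v.val (x : K) < 1 := by
  rw [IsLocalRing.mem_maximalIdeal, mem_nonunits_iff]
  constructor
  · intro h
    refine lt_of_le_of_ne x.2 fun h1 => h ?_
    exact (Valuation.integer.integers v.val).isUnit_of_one
      (isUnit_iff_ne_zero.2 (by rintro h0; rw [show ((x : K)) = 0 from h0] at h1; simp at h1)) h1
  · intro h hu
    exact h.ne ((Valuation.integer.integers v.val).one_of_isUnit hu)

section OfPrime

variable {B : Type*} [CommRing B] [IsDedekindDomain B] [Algebra B K] [IsFractionRing B K]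

/-- The residue field of the place defined by a maximal ideal `P` of `B` is `B / P`. -/
theorem Place.nonempty_quotient_equiv_residueField (P : HeightOneSpectrum B) :
    Nonempty ((B ⧸ P.asIdeal) ≃+* (Place.ofPrime K P).residueField) := by
  let w := Place.ofPrime K P
  let φ : B →+* w.val.valuationSubring :=
    (algebraMap B K).codRestrict w.val.valuationSubring.toSubring (Place.ofPrime_le_one P)
  let ψ : B →+* w.residueField := (IsLocalRing.residue w.val.valuationSubring).comp φ
  have hres : ∀ x : w.val.valuationSubring,
      IsLocalRing.residue w.val.valuationSubring x = 0 ↔ w.val (x : K) < 1 := by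
    intro x
    rw [IsLocalRing.residue_eq_zero_iff, w.mem_maximalIdeal_iff]
  have hker : RingHom.ker ψ = P.asIdeal := by
    ext b
    rw [RingHom.mem_ker, ← Place.ofPrime_lt_one_iff (K := K) P b]
    exact hres (φ b)
  have hsurj : Function.Surjective ψ := by
    intro y
    obtain ⟨x, rfl⟩ := IsLocalRing.residue_surjective y
    obtain ⟨n, d, hnd⟩ := HeightOneSpectrum.exists_primeCompl_mul_eq_of_integer
      (K := K) P x x.2
    have : P.asIdeal.IsMaximal := P.isMaximal
    obtain ⟨c, hc⟩ := this.exists_inv d.2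
    have hc' : ψ (c * d) = 1 := by
      obtain ⟨i, hi, h1⟩ := hc
      rw [← hker, RingHom.mem_ker] at hi
      rw [← map_one ψ, ← h1, map_add, hi, add_zero]
    have hd : IsLocalRing.residue w.val.valuationSubring x * ψ d = ψ n := by
      change IsLocalRing.residue _ x * IsLocalRing.residue _ (φ d) = IsLocalRing.residue _ (φ n)
      rw [← map_mul]
      exact congrArg _ (Subtype.ext hnd)
    refine ⟨c * n, ?_⟩
    rw [map_mul, ← hd, mul_left_comm, ← map_mul, hc', mul_one]
  exact ⟨(Ideal.quotEquivOfEq hker.symm).trans (RingHom.quotientKerEquivOfSurjective hsurj)⟩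

end OfPrime

/-- The number `q_v` of elements of the residue field of a place. -/
def Place.residueCard (v : Place K) : ℕ := Nat.card v.residueField

lemma Place.one_lt_residueCard (v : Place K) [Finite v.residueField] : 1 < v.residueCard :=
  Finite.one_lt_card

/-- `|O_v / a| = q_v ^ ord_v(a)`. -/
theorem Place.card_quotient_span (v : Place K) {a : v.val.valuationSubring} {f : Kˣ}
    (ha : (a : K) = f) :
    (Nat.card (v.val.valuationSubring ⧸ Ideal.span {a}) : ℤ) =
      (v.residueCard : ℤ) ^ (v.ordField f).toNat := by
  obtain ⟨ϖ, hϖ0, hϖ⟩ := v.exists_val_eq_exp (-1)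
  have hlt : v.val ϖ < 1 := by
    rw [hϖ, ← WithZero.exp_zero, WithZero.exp_lt_exp]; norm_num
  let t : v.val.valuationSubring := ⟨ϖ, hlt.le⟩
  have hmax : IsLocalRing.maximalIdeal v.val.valuationSubring = Ideal.span {t} := by
    ext x
    rw [v.mem_maximalIdeal_iff, Ideal.mem_span_singleton]
    constructor
    · intro hx
      refine ⟨⟨(x : K) / ϖ, ?_⟩, Subtype.ext (mul_div_cancel₀ _ hϖ0).symm⟩
      rcases eq_or_ne (x : K) 0 with h0 | h0
      · rw [h0, zero_div]
        exact zero_mem _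
      · change v.val _ ≤ 1
        rw [map_div₀, hϖ]
        have h1 : 0 < v.ordField (Units.mk0 (x : K) h0) := (v.val_lt_one_iff (Units.mk0 _ h0)).1 hx
        have h2 : v.val (x : K) ≤ WithZero.exp (-1) :=
          (v.val_le_exp_iff (Units.mk0 (x : K) h0) (-1)).2 (by omega)
        exact (div_le_one₀ (by simp)).2 h2
    · rintro ⟨y, rfl⟩
      change v.val (ϖ * (y : K)) < 1
      rw [map_mul]
      exact mul_lt_one_of_nonneg_of_lt_one_left zero_le hlt y.2
  have hord : 0 ≤ v.ordField f := (v.val_le_one_iff f).1 (ha ▸ a.2)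
  have hspan : Ideal.span {a} = Ideal.span {t} ^ (v.ordField f).toNat := by
    set n := (v.ordField f).toNat with hn
    have hn' : v.ordField f = n := (Int.toNat_of_nonneg hord).symm
    have hϖu : v.ordField (Units.mk0 ϖ hϖ0) = 1 := by
      have := (v.val_eq_exp_iff (Units.mk0 ϖ hϖ0) (-1)).1 hϖ
      simpa using this
    have hu : v.ordField (f * ((Units.mk0 ϖ hϖ0) ^ n)⁻¹) = 0 := by
      rw [Place.ordField_mul, Place.ordField_inv, Place.ordField_pow, hϖu, hn']
      ring
    have hu1 := (v.val_eq_one_iff _).2 hu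
    have hu2 := (v.val_eq_one_iff _).2 (by rw [Place.ordField_inv, hu, neg_zero] :
      v.ordField (f * ((Units.mk0 ϖ hϖ0) ^ n)⁻¹)⁻¹ = 0)
    rw [Ideal.span_singleton_pow]
    refine le_antisymm ?_ ?_
    · rw [Ideal.span_singleton_le_span_singleton]
      refine ⟨⟨_, hu1.le⟩, Subtype.ext ?_⟩
      simp [ha, t, mul_left_comm _ (f : K), hϖ0]
    · rw [Ideal.span_singleton_le_span_singleton]
      refine ⟨⟨_, hu2.le⟩, Subtype.ext ?_⟩
      simp [ha, t, mul_left_comm _ (ϖ ^ n)]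
  have hne : IsLocalRing.maximalIdeal v.val.valuationSubring ≠ ⊥ :=
    IsDiscreteValuationRing.not_a_field _
  rw [hspan, ← hmax, ← Submodule.cardQuot_apply, cardQuot_pow_of_prime hne,
    Submodule.cardQuot_apply, Nat.cast_pow]
  rfl

end ResidueFields

section Above

variable (k : Type u) {K : Type u} [Field k] [Field K] [Algebra k K]

section Algebraic

variable [Algebra.IsAlgebraic k K]

variable {k} in
theorem Place.under_eq_iff (w : Place K) (v : Place k) :
    w.under k = v ↔ ∀ a : k, v.val a ≤ 1 → w.val (algebraMap k K a) ≤ 1 := by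
  constructor
  · rintro rfl a ha
    exact (Valuation.HasExtension.val_map_le_one_iff (w.under k).val w.val a).2 ha
  · intro h
    exact (Place.eq_of_le fun a ha =>
      (Valuation.HasExtension.val_map_le_one_iff (w.under k).val w.val a).1 (h a ha)).symm

lemma Place.under_val_le_one_iff (w : Place K) (a : k) :
    (w.under k).val a ≤ 1 ↔ w.val (algebraMap k K a) ≤ 1 :=
  (Valuation.HasExtension.val_map_le_one_iff (w.under k).val w.val a).symm

lemma Place.under_val_lt_one_iff (w : Place K) (a : k) :
    (w.under k).val a < 1 ↔ w.val (algebraMap k K a) < 1 :=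
  (Valuation.HasExtension.val_map_lt_one_iff (w.under k).val w.val a).symm

end Algebraic

/-- The integral closure in `K` of the valuation ring of a place `v` of `k`: the ring of elements
of `K` that are integral at all places above `v`. -/
abbrev Place.integersAbove {k : Type u} [Field k] (v : Place k) (K : Type u) [Field K]
    [Algebra k K] : Subalgebra v.val.valuationSubring K :=
  integralClosure v.val.valuationSubring K

variable {k}

lemma Place.val_le_one_of_mem_integersAbove [Algebra.IsAlgebraic k K] (w : Place K)
    {x : K} (hx : x ∈ (w.under k).integersAbove K) : w.val x ≤ 1 := by
  obtain ⟨p, hp, hpx⟩ := hx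
  let f : (w.under k).val.valuationSubring →+* w.val.integer :=
    (algebraMap _ K).codRestrict _ fun a => (w.under_val_le_one_iff k a).1 a.2
  have h2 : IsIntegral w.val.integer x := by
    refine ⟨p.map f, hp.map f, ?_⟩
    rw [Polynomial.eval₂_map]
    exact hpx
  exact (Valuation.integer.integers w.val).mem_of_integral h2

variable [FiniteDimensional k K] [Algebra.IsSeparable k K] (v : Place k)

instance : IsDedekindDomain (v.integersAbove K) := integralClosure.isDedekindDomain _ k K

instance : IsFractionRing (v.integersAbove K) K :=
  integralClosure.isFractionRing_of_finite_extension k K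

instance : Module.Finite v.val.valuationSubring (v.integersAbove K) :=
  IsIntegralClosure.finite _ k K _

instance : Module.Free v.val.valuationSubring (v.integersAbove K) :=
  IsIntegralClosure.module_free _ k K _

lemma Place.under_ofPrime (P : HeightOneSpectrum (v.integersAbove K)) :
    (Place.ofPrime K P).under k = v :=
  (Place.under_eq_iff _ _).2 fun a ha =>
    Place.ofPrime_le_one P (algebraMap v.val.valuationSubring (v.integersAbove K) ⟨a, ha⟩)

variable (K) in
/-- The places above `v` correspond to the maximal ideals of the integral closure of `O_v`. -/
theorem Place.range_ofPrime :
    Set.range (Place.ofPrime K : HeightOneSpectrum (v.integersAbove K) → Place K) =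
      {w | w.under k = v} := by
  ext w
  constructor
  · rintro ⟨P, rfl⟩
    exact Place.under_ofPrime v P
  · rintro rfl
    exact w.exists_ofPrime_eq fun b => w.val_le_one_of_mem_integersAbove b.2

variable {v} in
lemma Place.exists_ofPrime_of_under {w : Place K} (hw : w.under k = v) :
    ∃ P : HeightOneSpectrum (v.integersAbove K), Place.ofPrime K P = w := by
  have h : w ∈ Set.range (Place.ofPrime K : HeightOneSpectrum (v.integersAbove K) → Place K) := by
    rw [v.range_ofPrime K]
    exact hw
  exact h

instance : Finite (HeightOneSpectrum (v.integersAbove K)) := by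
  obtain ⟨ϖ, hϖ0, hϖ⟩ := v.exists_val_eq_exp (-1)
  have hlt : v.val ϖ < 1 := by
    rw [hϖ, ← WithZero.exp_zero, WithZero.exp_lt_exp]; norm_num
  refine Set.finite_univ_iff.1 ((Place.finite_setOf_ofPrime_ne_zero (B := v.integersAbove K)
    (Units.mk0 (algebraMap k K ϖ) ((map_ne_zero _).2 hϖ0))).subset fun P _ => ?_)
  have h1 : (Place.ofPrime K P).val (algebraMap k K ϖ) < 1 := by
    rw [← Place.under_val_lt_one_iff k, Place.under_ofPrime]
    exact hlt
  exact ((Place.val_lt_one_iff _ (Units.mk0 (algebraMap k K ϖ) ((map_ne_zero _).2 hϖ0))).1 h1).ne'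

variable (K) in
theorem Place.finite_setOf_under_eq : {w : Place K | w.under k = v}.Finite := by
  rw [← Place.range_ofPrime]
  exact Set.finite_range _

instance : IsPrincipalIdealRing (v.integersAbove K) := by
  refine IsPrincipalIdealRing.of_finite_primes ?_
  have : {I : Ideal (v.integersAbove K) | I.IsPrime} ⊆
      insert ⊥ (Set.range (HeightOneSpectrum.asIdeal (R := v.integersAbove K))) := by
    intro I hI
    by_cases h : I = ⊥
    · exact Or.inl h
    · exact Or.inr ⟨⟨I, hI, h⟩, rfl⟩
  exact ((Set.finite_range _).insert _).subset this

/-- The elements of `K` that are integral at all places above `v` are integral over `O_v`. -/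
theorem Place.mem_integersAbove {x : K} (h : ∀ w : Place K, w.under k = v → w.val x ≤ 1) :
    x ∈ v.integersAbove K := by
  obtain ⟨y, rfl⟩ := HeightOneSpectrum.mem_integers_of_valuation_le_one (R := v.integersAbove K)
    K x fun P => h _ (Place.under_ofPrime v P)
  exact y.2

variable (K) in
/-- Sums over the places above `v`. -/
theorem Place.finsum_under_eq {M : Type*} [AddCommMonoid M] (F : Place K → M) :
    ∑ᶠ (w : Place K) (_ : w.under k = v), F w =
      ∑ᶠ P : HeightOneSpectrum (v.integersAbove K), F (Place.ofPrime K P) := by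
  have := finsum_mem_range (f := F) (Place.ofPrime_injective (K := K) (B := v.integersAbove K))
  rw [Place.range_ofPrime] at this
  exact this

/-- There are elements with a simple zero at a given place above `v` and no zeros or poles at
the other places above `v`. -/
theorem Place.exists_uniformizer_integersAbove (P : HeightOneSpectrum (v.integersAbove K)) :
    ∃ b : v.integersAbove K, b ≠ 0 ∧ P.asIdeal = Ideal.span {b} := by
  obtain ⟨b, hb⟩ := (IsPrincipalIdealRing.principal P.asIdeal)
  refine ⟨b, ?_, hb⟩
  rintro rfl
  exact P.ne_bot (by rw [hb]; simp)

lemma Place.ordField_of_span [DecidableEq (HeightOneSpectrum (v.integersAbove K))]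
    (P : HeightOneSpectrum (v.integersAbove K)) {b : v.integersAbove K} {f : Kˣ}
    (hb : P.asIdeal = Ideal.span {b}) (hf : (f : K) = b)
    (Q : HeightOneSpectrum (v.integersAbove K)) :
    (Place.ofPrime K Q).ordField f = if P = Q then 1 else 0 := by
  have hb0 : b ≠ 0 := by rintro rfl; exact f.ne_zero hf
  split_ifs with h
  · subst h
    have h1 := P.intValuation_singleton hb0 hb
    have h2 : (Place.ofPrime K P).val (f : K) = WithZero.exp (-1) := by
      rw [hf, ← h1]
      exact P.valuation_of_algebraMap b
    rw [Place.val_eq_exp_iff] at h2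
    simpa using h2
  · rw [← Place.val_eq_one_iff, hf]
    refine le_antisymm (Place.ofPrime_le_one Q b) (not_lt.1 fun hlt => h ?_)
    have hlt' := (Place.ofPrime_lt_one_iff (K := K) Q b).1 hlt
    have hle : P.asIdeal ≤ Q.asIdeal := by
      rw [hb, Ideal.span_singleton_le_iff_mem]
      exact hlt'
    exact HeightOneSpectrum.ext (P.isMaximal.eq_of_le Q.isPrime.ne_top hle)

variable (K) in
/-- Weak approximation at the places above `v`: arbitrary orders can be prescribed there. -/
theorem Place.exists_ordField_eq (n : Place K → ℤ) :
    ∃ f : Kˣ, ∀ w : Place K, w.under k = v → w.ordField f = n w := by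
  classical
  have := Fintype.ofFinite (HeightOneSpectrum (v.integersAbove K))
  choose b hb0 hb using v.exists_uniformizer_integersAbove (K := K)
  let g : HeightOneSpectrum (v.integersAbove K) → Kˣ := fun P =>
    Units.mk0 (b P : K) fun h => hb0 P (Subtype.ext h)
  refine ⟨∏ P, g P ^ n (Place.ofPrime K P), fun w hw => ?_⟩
  obtain ⟨Q, rfl⟩ := Place.exists_ofPrime_of_under hw
  rw [Place.ordField_prod, Finset.sum_eq_single Q]
  · rw [Place.ordField_zpow, Place.ordField_of_span v Q (hb Q) (f := g Q) rfl, if_pos rfl, mul_one]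
  · intro P _ hPQ
    rw [Place.ordField_zpow, Place.ordField_of_span v P (hb P) (f := g P) rfl, if_neg hPQ, mul_zero]
  · simp

lemma Place.coe_norm_integersAbove (b : v.integersAbove K) :
    ((Algebra.norm v.val.valuationSubring b : v.val.valuationSubring) : k) =
      Algebra.norm k (b : K) := by
  rw [← Algebra.intNorm_eq_norm v.val.valuationSubring (v.integersAbove K)]
  exact Algebra.algebraMap_intNorm (A := v.val.valuationSubring) (B := v.integersAbove K)
    (K := k) (L := K) b

lemma Place.ordField_norm_nonneg {b : v.integersAbove K} {f : Kˣ} (hf : (f : K) = b) :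
    0 ≤ v.ordField (Units.map (Algebra.norm k) f) := by
  rw [← v.val_le_one_iff]
  change v.val (Algebra.norm k (f : K)) ≤ 1
  rw [hf, ← v.coe_norm_integersAbove]
  exact (Algebra.norm v.val.valuationSubring b).2

/-- `|B / b| = q_v ^ ord_v(N(b))` for the integral closure `B` of `O_v`. -/
theorem Place.card_quotient_integersAbove {b : v.integersAbove K} {f : Kˣ} (hf : (f : K) = b) :
    (Nat.card (v.integersAbove K ⧸ Ideal.span {b}) : ℤ) =
      (v.residueCard : ℤ) ^ (v.ordField (Units.map (Algebra.norm k) f)).toNat := by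
  have hb0 : b ≠ 0 := by rintro rfl; exact f.ne_zero hf
  have hI := Ideal.span_singleton_eq_bot.not.2 hb0
  -- the Smith normal form of multiplication by `b`
  let β := Module.Free.chooseBasis v.val.valuationSubring (v.integersAbove K)
  let e := Ideal.quotientEquivPiSpan (Ideal.span {b}) β hI
  have ha0 : ∀ i, ((Ideal.smithCoeffs β (Ideal.span {b}) hI i : v.val.valuationSubring) : k) ≠ 0 :=
    fun i h => Ideal.smithCoeffs_ne_zero β _ hI i (Subtype.ext h)
  have hcard : (Nat.card (v.integersAbove K ⧸ Ideal.span {b}) : ℤ) =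
      (v.residueCard : ℤ) ^ (∑ i, v.ordField (Units.mk0 _ (ha0 i))).toNat := by
    rw [Nat.card_congr e.toEquiv, Nat.card_pi, Nat.cast_prod]
    rw [Finset.prod_congr rfl fun i _ => v.card_quotient_span (f := Units.mk0 _ (ha0 i)) rfl,
      Finset.prod_pow_eq_pow_sum]
    congr 1
    have hnn : ∀ i, 0 ≤ v.ordField (Units.mk0 _ (ha0 i)) := fun i =>
      (v.val_le_one_iff (Units.mk0 _ (ha0 i))).1
        (Ideal.smithCoeffs β (Ideal.span {b}) hI i).2
    zify
    rw [Int.toNat_of_nonneg (Finset.sum_nonneg fun i _ => hnn i)]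
    exact Finset.sum_congr rfl fun i _ => Int.toNat_of_nonneg (hnn i)
  rw [hcard]
  congr 2
  obtain ⟨u, hu⟩ := associated_norm_prod_smith β hb0
  have hu0 : v.val (u : v.val.valuationSubring) = 1 :=
    (Valuation.integer.integers v.val).one_of_isUnit u.isUnit
  have hval : v.val (Algebra.norm k (f : K)) = v.val ((∏ i, Units.mk0 _ (ha0 i) : kˣ) : k) := by
    have := congrArg (fun x : v.val.valuationSubring => v.val (x : k)) hu
    simp only [MulMemClass.coe_mul, map_mul, hu0, mul_one] at this
    rw [hf, ← v.coe_norm_integersAbove]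
    refine this.trans ?_
    simp
  rw [← Place.ordField_prod]
  simp only [Place.ordField]
  exact congrArg _ (congrArg _ hval.symm)

variable [Finite v.residueField]

theorem Place.finite_residueField_ofPrime (P : HeightOneSpectrum (v.integersAbove K)) :
    Finite (Place.ofPrime K P).residueField := by
  obtain ⟨b, hb0, hb⟩ := v.exists_uniformizer_integersAbove P
  obtain ⟨e⟩ := Place.nonempty_quotient_equiv_residueField (K := K) P
  have h := v.card_quotient_integersAbove (b := b)
    (f := Units.mk0 (b : K) fun h => hb0 (Subtype.ext h)) rfl
  have hq := v.one_lt_residueCard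
  have : Finite (v.integersAbove K ⧸ P.asIdeal) := by
    refine (Nat.card_pos_iff.1 ?_).2
    rw [hb]
    zify
    rw [h]
    positivity
  exact Finite.of_equiv _ e.toEquiv

theorem Place.finite_residueField_of_under (w : Place K) [Finite (w.under k).residueField] :
    Finite w.residueField := by
  obtain ⟨P, hP⟩ := Place.exists_ofPrime_of_under (K := K) (w := w) (k := k) rfl
  rw [← hP]
  exact Place.finite_residueField_ofPrime _ P

theorem Place.residueCard_eq_pow (w : Place K) [Finite (w.under k).residueField] :
    (w.residueCard : ℤ) = ((w.under k).residueCard : ℤ) ^ (residueDegree k w).toNat := by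
  have := w.finite_residueField_of_under (k := k)
  have : Module.Finite (w.under k).residueField w.residueField := Module.Finite.of_finite
  rw [residueDegree, Int.toNat_natCast]
  exact_mod_cast Module.natCard_eq_pow_finrank (K := (w.under k).residueField)
    (V := w.residueField)

/-- The norm formula for a uniformizer: both sides are computed by counting `B / P`. -/
theorem Place.residueDegree_eq_ordField_norm (P : HeightOneSpectrum (v.integersAbove K))
    {b : v.integersAbove K} {f : Kˣ}
    (hb : P.asIdeal = Ideal.span {b}) (hf : (f : K) = b) :
    residueDegree k (Place.ofPrime K P) = v.ordField (Units.map (Algebra.norm k) f) := by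
  have hv : (Place.ofPrime K P).under k = v := Place.under_ofPrime v P
  have : Finite ((Place.ofPrime K P).under k).residueField := by rw [hv]; infer_instance
  have h1 := (Place.ofPrime K P).residueCard_eq_pow (k := k)
  obtain ⟨e⟩ := Place.nonempty_quotient_equiv_residueField (K := K) P
  rw [Place.residueCard, ← Nat.card_congr e.toEquiv, hb, v.card_quotient_integersAbove hf, hv] at h1
  have hq := v.one_lt_residueCard
  have h2 := Nat.pow_right_injective (Nat.succ_le_of_lt hq) (by exact_mod_cast h1)
  have h3 : 0 ≤ residueDegree k (Place.ofPrime K P) := Int.natCast_nonneg _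
  have h4 : 0 ≤ v.ordField (Units.map (Algebra.norm k) f) :=
    v.ordField_norm_nonneg hf
  omega

/-- The norm formula: `ord_v(N(f))` is the sum of the numbers `f(w/v) ord_w(f)` for `w ∣ v`. -/
theorem Place.ordField_norm (f : Kˣ) :
    v.ordField (Units.map (Algebra.norm k) f) =
      ∑ᶠ (w : Place K) (_ : w.under k = v), residueDegree k w * w.ordField f := by
  classical
  have := Fintype.ofFinite (HeightOneSpectrum (v.integersAbove K))
  choose b hb0 hb using v.exists_uniformizer_integersAbove (K := K)
  let g : HeightOneSpectrum (v.integersAbove K) → Kˣ := fun P =>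
    Units.mk0 (b P : K) fun h => hb0 P (Subtype.ext h)
  have hunit : ∀ u : Kˣ, (∀ w : Place K, w.under k = v → w.ordField u = 0) →
      0 ≤ v.ordField (Units.map (Algebra.norm k) u) := fun u hu =>
    v.ordField_norm_nonneg (b := ⟨(u : K), v.mem_integersAbove fun w hw =>
      ((w.val_eq_one_iff u).2 (hu w hw)).le⟩) rfl
  have hunit' : ∀ u : Kˣ, (∀ w : Place K, w.under k = v → w.ordField u = 0) →
      v.ordField (Units.map (Algebra.norm k) u) = 0 := by
    intro u hu
    refine le_antisymm ?_ (hunit u hu)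
    have := hunit u⁻¹ fun w hw => by rw [Place.ordField_inv, hu w hw, neg_zero]
    rw [map_inv, Place.ordField_inv] at this
    linarith
  rw [Place.finsum_under_eq, finsum_eq_sum_of_fintype]
  -- up to an element without zeros and poles above `v`, `f` is a product of uniformizers
  let h : Kˣ := ∏ P, g P ^ (Place.ofPrime K P).ordField f
  have hh : ∀ Q : HeightOneSpectrum (v.integersAbove K),
      (Place.ofPrime K Q).ordField h = (Place.ofPrime K Q).ordField f := by
    intro Q
    rw [Place.ordField_prod, Finset.sum_eq_single Q]
    · rw [Place.ordField_zpow, Place.ordField_of_span v Q (hb Q) (f := g Q) rfl, if_pos rfl,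
        mul_one]
    · intro P _ hPQ
      rw [Place.ordField_zpow, Place.ordField_of_span v P (hb P) (f := g P) rfl, if_neg hPQ,
        mul_zero]
    · simp
  have h1 : v.ordField (Units.map (Algebra.norm k) (f * h⁻¹)) = 0 := by
    refine hunit' _ fun w hw => ?_
    obtain ⟨Q, rfl⟩ := Place.exists_ofPrime_of_under hw
    rw [Place.ordField_mul, Place.ordField_inv, hh, add_neg_cancel]
  rw [map_mul, map_inv, Place.ordField_mul, Place.ordField_inv, add_neg_eq_zero] at h1
  rw [h1, map_prod, Place.ordField_prod]
  refine Finset.sum_congr rfl fun P _ => ?_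
  rw [map_zpow, Place.ordField_zpow, mul_comm,
    Place.residueDegree_eq_ordField_norm v P (hb P) (f := g P) rfl]

end Above

/-! ### Approximation in completions, norms on `k_v ⊗ L`, the local norm formula -/

section Completion

variable {k : Type u} [Field k]

lemma Place.valued_algebraMap (v : Place k) (a : k) :
    Valued.v (algebraMap k v.Completion a) = v.val a :=
  Valued.valuedCompletion_apply (WithVal.toVal v.val a : WithVal v.val)

lemma Place.denseRange_algebraMap (v : Place k) : DenseRange (algebraMap k v.Completion) :=
  (UniformSpace.Completion.denseRange_coe (α := WithVal v.val)).comp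
    (WithVal.toVal_surjective v.val).denseRange (UniformSpace.Completion.continuous_coe _)

lemma Place.ord_map_algebraMap (v : Place k) (a : kˣ) :
    v.ord (Units.map (algebraMap k v.Completion) a) = v.ordField a := by
  rw [Place.ord, Place.ordField]
  exact congrArg _ (congrArg _ (v.valued_algebraMap a))

lemma Place.valued_eq_exp_ord (v : Place k) (x : v.Completionˣ) :
    Valued.v (x : v.Completion) = WithZero.exp (-v.ord x) := by
  rw [Place.ord, neg_neg, WithZero.exp_log ((Valuation.ne_zero_iff _).2 x.ne_zero)]

lemma Place.ordField_eq_ord {K : Type u} [Field K] (v : Place k) (w : Place K) {f : Kˣ}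
    {x : v.Completionˣ}
    (h : w.val (f : K) = Valued.v (x : v.Completion)) : w.ordField f = v.ord x := by
  rw [Place.ord, Place.ordField, h]

lemma eventually_valued_eq {C : Type*} [Field C] [Valued C ℤᵐ⁰] {x : C} (hx : x ≠ 0) :
    ∀ᶠ y in 𝓝 x, Valued.v y = Valued.v x := by
  have h := Valued.isOpen_sphere C (r := Valued.v.restrict x) (by simpa using hx)
  filter_upwards [h.mem_nhds rfl] with y hy
  simpa using hy

lemma eventually_valued_sub_le_one {C : Type*} [Field C] [Valued C ℤᵐ⁰] (x : C) :
    ∀ᶠ y in 𝓝 x, Valued.v (y - x) ≤ 1 := by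
  have h := Valued.isOpen_closedBall C (r := 1) one_ne_zero
  have h0 : (0 : C) ∈ {y : C | Valued.v.restrict y ≤ 1} := by simp
  have hc : ContinuousAt (fun y : C => y - x) x := by fun_prop
  have := hc.preimage_mem_nhds (t := {y : C | Valued.v.restrict y ≤ 1})
    (by simpa using h.mem_nhds h0)
  filter_upwards [this] with y hy
  simpa using hy

variable (L : Type u) [CommRing L] [Algebra k L] [FiniteDimensional k L] (v : Place k)

/-- Coordinates on `k_v ⊗_k L`, with respect to a basis of `L` over `k`. -/
def Place.coords :
    (v.Completion ⊗[k] L) ≃ₗ[v.Completion] (Fin (Module.finrank k L) → v.Completion) :=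
  ((Module.finBasis k L).baseChange v.Completion).equivFun

variable {L}

lemma Place.coords_one_tmul (f : L) (j : Fin (Module.finrank k L)) :
    v.coords L (1 ⊗ₜ f) j = algebraMap k v.Completion ((Module.finBasis k L).repr f j) := by
  simp [Place.coords, Module.Basis.baseChange_repr_tmul, Algebra.smul_def]

/-- The filter of elements of `L` that tend to a given element of `k_v ⊗_k L`. -/
def Place.approx (y : v.Completion ⊗[k] L) : Filter L :=
  comap (fun f => v.coords L (1 ⊗ₜ f)) (𝓝 (v.coords L y))

instance (y : v.Completion ⊗[k] L) : (v.approx y).NeBot := by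
  refine comap_neBot fun s hs => ?_
  have hd : DenseRange (Pi.map fun _ : Fin (Module.finrank k L) => algebraMap k v.Completion) :=
    DenseRange.piMap fun _ => v.denseRange_algebraMap
  obtain ⟨_, hc, a, rfl⟩ := mem_closure_iff_nhds.1 (hd (v.coords L y)) s hs
  refine ⟨(Module.finBasis k L).equivFun.symm a, ?_⟩
  convert hc using 1
  funext j
  rw [v.coords_one_tmul, ← Module.Basis.equivFun_apply, LinearEquiv.apply_symm_apply]
  rfl

/-- A function on `k_v ⊗_k L` that is continuous in the coordinates can be approximated, in
valuation, by its values on `L`. -/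
lemma Place.eventually_approx {C : Type*} [Field C] [Valued C ℤᵐ⁰] {g : v.Completion ⊗[k] L → C}
    (hg : Continuous fun c => g ((v.coords L).symm c)) {y : v.Completion ⊗[k] L} (hy : g y ≠ 0) :
    ∀ᶠ f in v.approx y, Valued.v (g (1 ⊗ₜ f)) = Valued.v (g y) := by
  have h1 : Tendsto (fun c => g ((v.coords L).symm c)) (𝓝 (v.coords L y)) (𝓝 (g y)) := by
    simpa using hg.tendsto (v.coords L y)
  have h2 := (h1.eventually (eventually_valued_eq hy)).comap
    (fun f : L => v.coords L (1 ⊗ₜ f))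
  filter_upwards [h2] with f hf
  simpa using hf

lemma Place.eventually_approx_coords (y : v.Completion ⊗[k] L) :
    ∀ᶠ f in v.approx y, ∀ j, Valued.v
      (algebraMap k v.Completion ((Module.finBasis k L).repr f j) - v.coords L y j) ≤ 1 := by
  rw [eventually_all]
  intro j
  have h1 : Tendsto (fun c : Fin (Module.finrank k L) → v.Completion => c j)
      (𝓝 (v.coords L y)) (𝓝 (v.coords L y j)) := (continuous_apply j).tendsto _
  have h2 := (h1.eventually (eventually_valued_sub_le_one _)).comap
    (fun f : L => v.coords L (1 ⊗ₜ f))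
  filter_upwards [h2] with f hf
  rw [← v.coords_one_tmul]
  exact hf

/-- The norm of a finite algebra is continuous in the coordinates. -/
lemma Place.continuous_norm_comp {E : Type*} [CommRing E] [Algebra v.Completion E]
    [Module.Finite v.Completion E] (ψ : (v.Completion ⊗[k] L) →ₗ[v.Completion] E) :
    Continuous fun c => Algebra.norm v.Completion (ψ ((v.coords L).symm c)) := by
  classical
  let b := Module.finBasis v.Completion E
  simp_rw [Algebra.norm_eq_matrix_det b]
  refine Continuous.matrix_det (continuous_matrix fun i j => ?_)
  let l : (Fin (Module.finrank k L) → v.Completion) →ₗ[v.Completion] v.Completion :=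
    (Matrix.entryLinearMap v.Completion v.Completion i j) ∘ₗ (Algebra.leftMulMatrix b).toLinearMap
      ∘ₗ ψ ∘ₗ (v.coords L).symm.toLinearMap
  exact l.continuous_on_pi

end Completion

section Norm

/-- The norm of a finite product of algebras is the product of the norms. -/
theorem norm_pi {R ι : Type*} [CommRing R] [Fintype ι] [LinearOrder ι] {S : ι → Type*}
    [∀ i, CommRing (S i)] [∀ i, Algebra R (S i)] [∀ i, Module.Free R (S i)]
    [∀ i, Module.Finite R (S i)] (x : ∀ i, S i) :
    Algebra.norm R x = ∏ i, Algebra.norm R (x i) := by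
  classical
  let b := fun i => Module.Free.chooseBasis R (S i)
  let B := Pi.basis b
  have hM : ∀ p q, Algebra.leftMulMatrix B x p q =
      if h : p.1 = q.1 then Algebra.leftMulMatrix (b p.1) (x p.1) p.2 (h ▸ q.2) else 0 := by
    rintro ⟨i, p⟩ ⟨j, q⟩
    rw [Algebra.leftMulMatrix_eq_repr_mul]
    simp only [B, Pi.basis_repr, Pi.basis_apply]
    split_ifs with h
    · obtain rfl : i = j := h
      rw [Algebra.leftMulMatrix_eq_repr_mul]
      simp
    · have h' : i ≠ j := h
      simp [Pi.single_eq_of_ne h']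
  -- with respect to the product basis, multiplication by `x` is block diagonal
  have htri : (Algebra.leftMulMatrix B x).BlockTriangular Sigma.fst := by
    intro p q hpq
    rw [hM, dif_neg hpq.ne']
  rw [Algebra.norm_eq_matrix_det B, htri.det_fintype]
  refine Finset.prod_congr rfl fun i _ => ?_
  rw [Algebra.norm_eq_matrix_det (b i)]
  let e : Module.Free.ChooseBasisIndex R (S i) ≃
      {p : Σ i, Module.Free.ChooseBasisIndex R (S i) // p.1 = i} :=
    { toFun := fun p => ⟨⟨i, p⟩, rfl⟩
      invFun := fun p => p.2 ▸ p.1.2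
      left_inv := fun _ => rfl
      right_inv := by rintro ⟨⟨j, p⟩, rfl⟩; rfl }
  rw [← Matrix.det_submatrix_equiv_self e]
  congr 1
  ext p q
  simp only [Matrix.submatrix_apply, Matrix.toSquareBlock_def, Matrix.of_apply]
  rw [hM]
  simp [e]

variable {k : Type u} [Field k] {r : ℕ} (K : Fin r → Type u) [∀ i, Field (K i)]
  [∀ i, Algebra k (K i)] (R : Type u) [CommRing R] [Algebra k R]

/-- The map `R ⊗ ∏ K_j → R ⊗ K_i`. -/
def factorMap (i : Fin r) : R ⊗[k] (∀ i, K i) →ₐ[R] R ⊗[k] K i :=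
  Algebra.TensorProduct.map (AlgHom.id R R) (Pi.evalAlgHom k K i)

/-- The norm `N_{K_i/k}`, as a map `R ⊗ ∏ K_j → R` for a `k`-algebra `R`. -/
def factorNorm (i : Fin r) : R ⊗[k] (∀ i, K i) →* R :=
  (Algebra.norm R).comp (factorMap (k := k) K R i : R ⊗[k] (∀ i, K i) →* R ⊗[k] K i)

variable [∀ i, FiniteDimensional k (K i)]

lemma norm_eq_prod_factorNorm (y : R ⊗[k] (∀ i, K i)) :
    Algebra.norm R y = ∏ i, factorNorm K R i y := by
  let e := Algebra.TensorProduct.piRight k R R K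
  have he : ∀ i, e y i = factorMap K R i y := by
    intro i
    induction y using TensorProduct.induction_on with
    | zero => simp
    | tmul a f => simp [e, factorMap]
    | add y z hy hz => rw [map_add, map_add, Pi.add_apply, hy, hz]
  rw [← Algebra.norm_eq_of_algEquiv e y, norm_pi]
  exact Finset.prod_congr rfl fun i _ => congrArg _ (he i)

lemma norm_one_tmul {L : Type u} [CommRing L] [Algebra k L] [FiniteDimensional k L] (f : L) :
    Algebra.norm R ((1 : R) ⊗ₜ[k] f) = algebraMap k R (Algebra.norm k f) := by
  classical
  let b := Module.finBasis k L
  rw [Algebra.norm_eq_matrix_det (b.baseChange R), Algebra.norm_eq_matrix_det b, RingHom.map_det]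
  congr 1
  ext i j
  rw [RingHom.mapMatrix_apply, Matrix.map_apply, Algebra.leftMulMatrix_eq_repr_mul,
    Algebra.leftMulMatrix_eq_repr_mul, Module.Basis.baseChange_apply,
    Algebra.TensorProduct.tmul_mul_tmul, mul_one, Module.Basis.baseChange_repr_tmul,
    Algebra.smul_def, mul_one]

lemma factorNorm_one_tmul (i : Fin r) (f : ∀ i, K i) :
    factorNorm K R i ((1 : R) ⊗ₜ[k] f) = algebraMap k R (Algebra.norm k (f i)) := by
  rw [← norm_one_tmul]
  simp [factorNorm, factorMap]

end Norm

section Etale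

variable {k : Type u} [Field k] {r : ℕ} {K : Fin r → Type u} [∀ i, Field (K i)]
  [∀ i, Algebra k (K i)] [∀ i, FiniteDimensional k (K i)]

lemma projection_one_tmul (i : Fin r) (w : Place (K i)) (f : ∀ i, K i) :
    projection k i w (1 ⊗ₜ f) = algebraMap (K i) w.Completion (f i) := by
  simp [projection]

lemma continuous_projection (i : Fin r) (w : Place (K i)) :
    Continuous fun c => projection k i w (((w.under k).coords (∀ i, K i)).symm c) := by
  have hc : Continuous (completionMap k w) := UniformSpace.Completion.continuous_map
  have : ∀ c, projection k i w (((w.under k).coords (∀ i, K i)).symm c) =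
      ∑ j, completionMap k w (c j) *
        algebraMap (K i) w.Completion (Module.finBasis k (∀ i, K i) j i) := by
    intro c
    simp [Place.coords, Module.Basis.equivFun_symm_apply, projection, TensorProduct.smul_tmul']
  simp_rw [this]
  fun_prop

lemma eventually_approx_component (x : LocalUnitsEtale k K) (v : Place k) (i : Fin r)
    (w : Place (K i)) (hw : w.under k = v) :
    ∀ᶠ f in v.approx (x v : v.Completion ⊗[k] ∀ i, K i),
      w.val (f i) = Valued.v (component k K i x w : w.Completion) := by
  subst hw
  have := (w.under k).eventually_approx (continuous_projection i w)
    (y := x (w.under k)) (component k K i x w).ne_zero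
  filter_upwards [this] with f hf
  rw [projection_one_tmul, Place.valued_algebraMap] at hf
  exact hf

variable (k K) in
/-- The diagonal embedding of `L^×` in `∏_v L_v^×`. -/
def diagonal : (∀ i, K i)ˣ →* LocalUnitsEtale k K :=
  MonoidHom.pi fun v => Units.map
    (Algebra.TensorProduct.includeRight : (∀ i, K i) →ₐ[k] v.Completion ⊗[k] (∀ i, K i))

variable (k) in
/-- The diagonal embedding of `k^×` in `∏_v k_v^×`. -/
def baseDiagonal : kˣ →* LocalUnits k :=
  MonoidHom.pi fun v => Units.map (algebraMap k v.Completion)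

lemma ord_baseDiagonal (v : Place k) (a : kˣ) : v.ord (baseDiagonal k a v) = v.ordField a :=
  v.ord_map_algebraMap a

lemma localNorm_diagonal (f : (∀ i, K i)ˣ) :
    localNorm k K (diagonal k K f) = baseDiagonal k (fieldNorm k K f) := by
  funext v
  exact Units.ext (norm_one_tmul v.Completion (f : ∀ i, K i))

lemma ord_component_diagonal (f : (∀ i, K i)ˣ) (i : Fin r) (w : Place (K i)) :
    w.ord (component k K i (diagonal k K f) w) =
      w.ordField (Units.map (Pi.evalMonoidHom (fun i => K i) i) f) := by
  refine (w.ordField_eq_ord w ?_).symm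
  have : ((component k K i (diagonal k K f) w : w.Completionˣ) : w.Completion) =
      algebraMap (K i) w.Completion ((f : ∀ i, K i) i) := projection_one_tmul i w f
  rw [this, Place.valued_algebraMap]
  rfl

lemma ord_localNorm (x : LocalUnitsEtale k K) (v : Place k) :
    v.ord (localNorm k K x v) =
      ∑ i, v.ord (Units.map (factorNorm K v.Completion i) (x v)) := by
  have h : localNorm k K x v = ∏ i, Units.map (factorNorm K v.Completion i) (x v) := by
    refine Units.ext ?_
    rw [Units.coe_prod]
    exact norm_eq_prod_factorNorm K v.Completion (x v : v.Completion ⊗[k] ∀ i, K i)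
  rw [h]
  generalize (Finset.univ : Finset (Fin r)) = s
  classical
  induction s using Finset.induction_on with
  | empty => simp [Place.ord_one]
  | insert a s ha ih => rw [Finset.prod_insert ha, Finset.sum_insert ha, Place.ord_mul, ih]

variable [∀ i, Algebra.IsSeparable k (K i)]

lemma eventually_approx_forall_component (x : LocalUnitsEtale k K) (v : Place k) (i : Fin r) :
    ∀ᶠ f in v.approx (x v : v.Completion ⊗[k] ∀ i, K i), ∀ w : Place (K i), w.under k = v →
      w.val (f i) = Valued.v (component k K i x w : w.Completion) :=
  (eventually_all_finite (v.finite_setOf_under_eq (K i))).2 fun w hw =>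
    eventually_approx_component x v i w hw

/-- The local norm formula: `ord_v(N_{K_i/k}(x)) = ∑ f(w/v) ord_w(x_w)`, where `w` runs through
the places of `K_i` above `v`. -/
theorem ord_factorNorm (x : LocalUnitsEtale k K) (v : Place k) [Finite v.residueField]
    (i : Fin r) :
    v.ord (Units.map (factorNorm K v.Completion i) (x v)) =
      ∑ᶠ (w : Place (K i)) (_ : w.under k = v),
        residueDegree k w * w.ord (component k K i x w) := by
  -- both sides are locally constant in the coordinates of `x v`, so that `x v` can be replaced by
  -- an element of `L`
  have h1 : Continuous fun c => factorNorm K v.Completion i ((v.coords (∀ i, K i)).symm c) :=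
    v.continuous_norm_comp (factorMap K v.Completion i).toLinearMap
  have h2 := v.eventually_approx h1 (y := x v)
    (Units.map (factorNorm K v.Completion i) (x v)).ne_zero
  obtain ⟨f, hf, hfw⟩ := (h2.and (eventually_approx_forall_component x v i)).exists
  rw [factorNorm_one_tmul, Place.valued_algebraMap] at hf
  have hf0 : f i ≠ 0 := by
    intro h0
    rw [h0, Algebra.norm_zero, map_zero] at hf
    exact (Valuation.ne_zero_iff _).2 (Units.map (factorNorm K v.Completion i) (x v)).ne_zero
      hf.symm
  let g : (K i)ˣ := Units.mk0 (f i) hf0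
  have hv : v.ordField (Units.map (Algebra.norm k) g) =
      v.ord (Units.map (factorNorm K v.Completion i) (x v)) := v.ordField_eq_ord v hf
  rw [← hv, v.ordField_norm]
  refine finsum_congr fun w => finsum_congr fun hw => ?_
  rw [w.ordField_eq_ord w (f := g) (hfw w hw)]

variable (k K) in
/-- Weak approximation: there are elements of `∏_v L_v^×` with arbitrary prescribed orders. -/
theorem exists_ord_component_eq (n : ∀ i, Place (K i) → ℤ) :
    ∃ x : LocalUnitsEtale k K, ∀ i (w : Place (K i)), w.ord (component k K i x w) = n i w := by
  choose f hf using fun (v : Place k) i => v.exists_ordField_eq (K i) (n i)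
  refine ⟨fun v => diagonal k K (MulEquiv.piUnits.symm (f v)) v, fun i w => ?_⟩
  rw [← hf (w.under k) i w rfl]
  exact ord_component_diagonal (MulEquiv.piUnits.symm (f (w.under k))) i w

/-- The elements of `L` that are integral at all places above `v` have bounded coordinates. -/
theorem exists_coords_bound (v : Place k) :
    ∃ M : ℤᵐ⁰, ∀ f : ∀ i, K i, (∀ i (w : Place (K i)), w.under k = v → w.val (f i) ≤ 1) →
      ∀ j, v.val ((Module.finBasis k (∀ i, K i)).repr f j) ≤ M := by
  classical
  let b := Module.finBasis k (∀ i, K i)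
  have hfg : ∀ i, ∃ s : Finset (v.integersAbove (K i)),
      Submodule.span v.val.valuationSubring (s : Set (v.integersAbove (K i))) = ⊤ :=
    fun i => Module.Finite.fg_top
  choose s hs using hfg
  have hbound : ∀ i, ∃ M : ℤᵐ⁰, ∀ a ∈ s i, ∀ j, v.val (b.repr (Pi.single i (a : K i)) j) ≤ M := by
    intro i
    obtain ⟨M, hM⟩ := ((s i ×ˢ Finset.univ).image fun p : (v.integersAbove (K i)) × _ =>
      v.val (b.repr (Pi.single i (p.1 : K i)) p.2)).exists_le
    exact ⟨M, fun a ha j => hM _ (Finset.mem_image.2 ⟨(a, j), by simp [ha], rfl⟩)⟩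
  choose M hM using hbound
  obtain ⟨M', hM'⟩ := (Finset.univ.image M).exists_le
  refine ⟨M', fun f hf j => ?_⟩
  have hsum : f = ∑ i, Pi.single i (f i) := (Finset.univ_sum_single f).symm
  rw [hsum, map_sum, Finsupp.finsetSum_apply]
  refine Valuation.map_sum_le _ fun i _ => le_trans ?_ 
    (hM' (M i) (Finset.mem_image_of_mem _ (Finset.mem_univ i)))
  have hmem : ∀ y : v.integersAbove (K i), v.val (b.repr (Pi.single i (y : K i)) j) ≤ M i := by
    intro y
    have hy : y ∈ Submodule.span v.val.valuationSubring (s i : Set (v.integersAbove (K i))) := by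
      rw [hs]; trivial
    induction hy using Submodule.span_induction with
    | mem y hy => exact hM i y hy j
    | zero => simp
    | add y z _ _ hy hz =>
      rw [AddMemClass.coe_add, Pi.single_add, map_add, Finsupp.add_apply]
      exact (v.val.map_add _ _).trans (max_le hy hz)
    | smul a y _ hy =>
      have : (Pi.single i ((a • y : v.integersAbove (K i)) : K i) : ∀ i, K i) =
          (a : k) • Pi.single i (y : K i) := by
        rw [← Pi.single_smul]; rfl
      rw [this, map_smul, Finsupp.smul_apply, smul_eq_mul, map_mul]
      exact (mul_le_of_le_one_left zero_le a.2).trans hy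
  exact hmem ⟨f i, v.mem_integersAbove (hf i)⟩

/-- Simultaneous approximation of the coordinates and of the orders at all places above `v`. -/
lemma exists_approx_coords (v : Place k) (x : LocalUnitsEtale k K) : ∃ f : ∀ i, K i,
    (∀ j, Valued.v (algebraMap k v.Completion ((Module.finBasis k (∀ i, K i)).repr f j) -
      v.coords (∀ i, K i) (x v) j) ≤ 1) ∧
    ∀ i, ∀ w : Place (K i), w.under k = v →
      w.val (f i) = Valued.v (component k K i x w : w.Completion) := by
  obtain ⟨f, hf, hfw⟩ := ((v.eventually_approx_coords (L := ∀ i, K i) (x v)).and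
    (eventually_all.2 fun i => eventually_approx_forall_component x v i)).exists
  exact ⟨f, hf, hfw⟩

lemma valued_le_max_of_sub_le_one {C : Type*} [Field C] [Valued C ℤᵐ⁰] {a c : C} {M : ℤᵐ⁰}
    (h1 : Valued.v a ≤ M) (h2 : Valued.v (a - c) ≤ 1) : Valued.v c ≤ max M 1 := by
  rw [← sub_sub_cancel a c]
  exact (Valuation.map_sub _ _ _).trans (max_le_max h1 h2)

/-- The elements of `L_v^×` that are integral at all places above `v` have bounded
coordinates. -/
theorem exists_coords_bound_completion (v : Place k) :
    ∃ M : ℤᵐ⁰, ∀ x : LocalUnitsEtale k K,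
      (∀ i (w : Place (K i)), w.under k = v → 0 ≤ w.ord (component k K i x w)) →
      ∀ j, Valued.v (v.coords (∀ i, K i) (x v) j) ≤ M := by
  obtain ⟨M, hM⟩ := exists_coords_bound (K := K) v
  refine ⟨max M 1, fun x hx j => ?_⟩
  obtain ⟨f, hf, hfw⟩ := exists_approx_coords v x
  have h1 : v.val ((Module.finBasis k (∀ i, K i)).repr f j) ≤ M := hM f (fun i w hw => by
    rw [hfw i w hw, Place.valued_eq_exp_ord, ← WithZero.exp_zero, WithZero.exp_le_exp]
    have := hx i w hw
    omega) j
  rw [← v.valued_algebraMap] at h1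
  exact valued_le_max_of_sub_le_one h1 (hf j)

end Etale

/-! ### Weighted degrees and the product formula for `F(t)` -/

/-- Finite sums can be computed along the fibres of a map. -/
theorem finsum_fiberwise {α β M : Type*} [AddCommMonoid M] (π : α → β) {h : α → M}
    (hf : h.support.Finite) : ∑ᶠ a, h a = ∑ᶠ b, ∑ᶠ (a) (_ : π a = b), h a := by
  classical
  have h1 : ∀ b, ∑ᶠ (a) (_ : π a = b), h a = ∑ a ∈ hf.toFinset with π a = b, h a := by
    intro b
    refine finsum_mem_eq_sum_of_inter_support_eq (s := {a | π a = b}) h ?_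
    ext a
    simp only [Set.mem_inter_iff, Set.mem_ofPred_eq, Function.mem_support, Finset.coe_filter,
      Set.Finite.mem_toFinset]
    tauto
  simp_rw [h1]
  rw [finsum_eq_sum_of_support_subset h (s := hf.toFinset) (by simp),
    finsum_eq_sum_of_support_subset _ (s := hf.toFinset.image π) ?_]
  · rw [Finset.sum_fiberwise_of_maps_to fun a ha => Finset.mem_image_of_mem π ha]
  · intro b hb
    obtain ⟨a, ha, -⟩ := Finset.exists_ne_zero_of_sum_ne_zero hb
    rw [Finset.mem_filter] at ha
    exact Finset.mem_coe.2 (Finset.mem_image.2 ⟨a, ha⟩)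

section Weight

variable {K : Type u} [Field K]

/-- The logarithm of the number of elements of the residue field of a place, a multiple of the
degree of the place. -/
def Place.weight (v : Place K) : ℝ := Real.log v.residueCard

lemma Place.weight_pos (v : Place K) [Finite v.residueField] : 0 < v.weight :=
  Real.log_pos (by exact_mod_cast v.one_lt_residueCard)

end Weight

/-- The properties of a global function field on which the argument relies: finite residue fields,
finiteness of the set of zeros and poles, the product formula. -/
class IsGlobal (K : Type u) [Field K] : Prop where
  finite_residueField : ∀ v : Place K, Finite v.residueField
  finite_support : ∀ f : Kˣ, {v : Place K | v.ordField f ≠ 0}.Finite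
  product_formula : ∀ f : Kˣ, ∑ᶠ v : Place K, v.weight * (v.ordField f : ℝ) = 0
  nonempty_place : Nonempty (Place K)

attribute [instance] IsGlobal.finite_residueField IsGlobal.nonempty_place

section RationalFunctions

open Polynomial

variable (F : Type u) [Field F]

/-- The place at infinity of `F(t)`. -/
def Place.infinity : Place (RatFunc F) :=
  letI := Classical.decEq (RatFunc F)
  ⟨RatFunc.inftyValuation F, fun x => by
    rcases eq_or_ne x 0 with rfl | hx
    · exact ⟨0, map_zero _⟩
    · exact ⟨RatFunc.X ^ (WithZero.log x), by
        rw [RatFunc.inftyValuation.X_zpow, WithZero.exp_log hx]⟩⟩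

lemma Place.infinity_val [inst : DecidableEq (RatFunc F)] :
    (Place.infinity F).val = RatFunc.inftyValuation F := by
  rw [Subsingleton.elim inst (Classical.decEq _)]
  rfl

lemma Place.infinity_val_polynomial {p : F[X]} (hp : p ≠ 0) :
    (Place.infinity F).val (algebraMap F[X] (RatFunc F) p) = WithZero.exp (p.natDegree : ℤ) := by
  classical
  rw [Place.infinity_val]
  exact RatFunc.inftyValuation.polynomial F hp

lemma Place.infinity_ordField_polynomial {p : F[X]} {f : (RatFunc F)ˣ}
    (hf : (f : RatFunc F) = algebraMap F[X] (RatFunc F) p) :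
    (Place.infinity F).ordField f = -p.natDegree := by
  have hp : p ≠ 0 := by rintro rfl; exact f.ne_zero (by rw [hf, map_zero])
  rw [← Place.val_eq_exp_iff, hf, Place.infinity_val_polynomial F hp]

variable [Finite F]

instance Place.instIsTrivialOn (v : Place (RatFunc F)) : v.val.IsTrivialOn F where
  eq_one c hc := by
    have := Fintype.ofFinite F
    have h1 : v.val (algebraMap F (RatFunc F) c) ^ (Fintype.card F - 1) = 1 := by
      rw [← map_pow, ← map_pow, FiniteField.pow_card_sub_one_eq_one c hc, map_one, map_one]
    exact (pow_eq_one_iff_of_nonneg zero_le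
      (Nat.sub_ne_zero_of_lt Fintype.one_lt_card)).1 h1

/-- The places of `F(t)` are the place at infinity and the places defined by the prime
polynomials. -/
theorem Place.ratFunc_cases (v : Place (RatFunc F)) :
    v = Place.infinity F ∨ ∃ P : HeightOneSpectrum F[X], Place.ofPrime (RatFunc F) P = v := by
  classical
  rcases lt_or_ge 1 (v.val RatFunc.X) with h | h
  · left
    have h1 := RatFunc.valuation_isEquiv_inftyValuation_of_one_lt_valuation_X h
    refine Place.eq_of_le fun x hx => ?_
    rw [Place.infinity_val]
    exact (Valuation.isEquiv_iff_val_le_one.1 h1).1 hx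
  · right
    exact v.exists_ofPrime_eq fun p =>
      Polynomial.valuation_le_one_of_valuation_X_le_one _ h p

/-- The residue field at infinity is `F`. -/
theorem Place.infinity_bijective_residue :
    Nonempty (F ≃ (Place.infinity F).residueField) := by
  let w := Place.infinity F
  let φ : F →+* w.val.valuationSubring :=
    (algebraMap F (RatFunc F)).codRestrict w.val.valuationSubring.toSubring fun c => by
      change w.val _ ≤ 1
      rcases eq_or_ne c 0 with rfl | hc
      · simp
      · exact (Valuation.IsTrivialOn.eq_one (v := w.val) c hc).le
  let ψ : F →+* w.residueField := (IsLocalRing.residue w.val.valuationSubring).comp φ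
  refine ⟨Equiv.ofBijective ψ ⟨ψ.injective, fun y => ?_⟩⟩
  obtain ⟨x, rfl⟩ := IsLocalRing.residue_surjective y
  obtain ⟨a, b, hb, hab⟩ := IsFractionRing.div_surjective (A := F[X]) (x : RatFunc F)
  have hb0 : b ≠ 0 := nonZeroDivisors.ne_zero hb
  have hb0' : algebraMap F[X] (RatFunc F) b ≠ 0 := by simpa using hb0
  -- the value at infinity of `a / b` is the ratio of the coefficients of degree `deg b`
  let c : F := a.coeff b.natDegree / b.leadingCoeff
  refine ⟨c, ?_⟩
  rw [← sub_eq_zero]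
  change IsLocalRing.residue _ (φ c) - _ = 0
  rw [← map_sub, IsLocalRing.residue_eq_zero_iff, w.mem_maximalIdeal_iff]
  change w.val (algebraMap F (RatFunc F) c - (x : RatFunc F)) < 1
  have hx : w.val (x : RatFunc F) ≤ 1 := x.2
  have heq : algebraMap F (RatFunc F) c - (x : RatFunc F) =
      algebraMap F[X] (RatFunc F) (C c * b - a) / algebraMap F[X] (RatFunc F) b := by
    rw [← hab, map_sub, map_mul, sub_div, mul_div_cancel_right₀ _ hb0']
    rfl
  have hdeg : a ≠ 0 → a.natDegree ≤ b.natDegree := by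
    intro ha
    rw [← hab, map_div₀, Place.infinity_val_polynomial F ha, Place.infinity_val_polynomial F hb0,
      div_le_one₀ (by simp), WithZero.exp_le_exp] at hx
    exact_mod_cast hx
  have hdeg' : a.natDegree ≤ b.natDegree := by
    rcases eq_or_ne a 0 with rfl | ha
    · simp
    · exact hdeg ha
  rw [heq]
  rcases eq_or_ne (C c * b - a) 0 with h0 | h0
  · rw [h0, map_zero, zero_div, map_zero]
    exact zero_lt_one
  · rw [map_div₀, Place.infinity_val_polynomial F h0, Place.infinity_val_polynomial F hb0,
      div_lt_one₀ (by simp), WithZero.exp_lt_exp, Nat.cast_lt]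
    have hle : (C c * b - a).natDegree ≤ b.natDegree :=
      (natDegree_sub_le _ _).trans (max_le (natDegree_C_mul_le _ _) hdeg')
    refine lt_of_le_of_ne hle fun h => h0 ?_
    have hlc : (C c * b - a).leadingCoeff = 0 := by
      rw [leadingCoeff, h, coeff_sub, coeff_C_mul]
      change a.coeff b.natDegree / b.leadingCoeff * b.leadingCoeff - _ = 0
      rw [div_mul_cancel₀ _ (leadingCoeff_ne_zero.2 hb0), sub_self]
    exact leadingCoeff_eq_zero.1 hlc

/-- The residue field of `F(t)` at a prime polynomial `π` has `|F| ^ deg π` elements. -/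
theorem Place.ofPrime_residueCard (P : HeightOneSpectrum F[X]) {p : F[X]}
    (hp : P.asIdeal = Ideal.span {p}) :
    Finite (Place.ofPrime (RatFunc F) P).residueField ∧
    (Place.ofPrime (RatFunc F) P).residueCard = Nat.card F ^ p.natDegree := by
  obtain ⟨e⟩ := Place.nonempty_quotient_equiv_residueField (K := RatFunc F) P
  have hp0 : p ≠ 0 := by
    rintro rfl
    exact P.ne_bot (by rw [hp]; simp)
  have h1 : Module.Finite F (F[X] ⧸ P.asIdeal) := by
    rw [hp]
    exact (AdjoinRoot.powerBasis hp0).finite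
  have h2 : Finite (F[X] ⧸ P.asIdeal) := Module.finite_of_finite F
  refine ⟨Finite.of_equiv _ e.toEquiv, ?_⟩
  rw [Place.residueCard, ← Nat.card_congr e.toEquiv, Module.natCard_eq_pow_finrank (K := F)]
  congr 1
  rw [hp]
  exact (AdjoinRoot.powerBasis hp0).finrank.trans (AdjoinRoot.powerBasis_dim hp0)

instance instFiniteResidueFieldRatFunc (v : Place (RatFunc F)) : Finite v.residueField := by
  rcases v.ratFunc_cases F with rfl | ⟨P, rfl⟩
  · exact Finite.of_equiv _ (Place.infinity_bijective_residue F).some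
  · obtain ⟨p, hp⟩ := IsPrincipalIdealRing.principal P.asIdeal
    exact (Place.ofPrime_residueCard F P hp).1

theorem Place.finite_support_ratFunc (f : (RatFunc F)ˣ) :
    {v : Place (RatFunc F) | v.ordField f ≠ 0}.Finite := by
  refine (((Place.finite_setOf_ofPrime_ne_zero (B := F[X]) f).image
    (Place.ofPrime (RatFunc F))).insert (Place.infinity F)).subset fun v hv => ?_
  rcases v.ratFunc_cases F with rfl | ⟨P, rfl⟩
  · exact Set.mem_insert _ _
  · exact Set.mem_insert_of_mem _ ⟨P, hv, rfl⟩

lemma Place.finsum_weight_ordField_mul {K : Type u} [Field K]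
    (h : ∀ f : Kˣ, {v : Place K | v.ordField f ≠ 0}.Finite) (f g : Kˣ) :
    ∑ᶠ v : Place K, v.weight * (v.ordField (f * g) : ℝ) =
      ∑ᶠ v : Place K, v.weight * (v.ordField f : ℝ) +
        ∑ᶠ v : Place K, v.weight * (v.ordField g : ℝ) := by
  rw [← finsum_add_distrib]
  · exact finsum_congr fun v => by rw [Place.ordField_mul]; push_cast; ring
  · exact (h f).subset fun v hv h0 => hv (by simp [h0])
  · exact (h g).subset fun v hv h0 => hv (by simp [h0])

/-- The product formula for `F(t)`. -/
theorem Place.product_formula_ratFunc (f : (RatFunc F)ˣ) :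
    ∑ᶠ v : Place (RatFunc F), v.weight * (v.ordField f : ℝ) = 0 := by
  classical
  have hmul := Place.finsum_weight_ordField_mul (Place.finite_support_ratFunc F)
  -- for a prime polynomial only its own place and the place at infinity contribute
  have hpoly : ∀ p : F[X], p ≠ 0 → ∀ g : (RatFunc F)ˣ, (g : RatFunc F) = algebraMap _ _ p →
      ∑ᶠ v : Place (RatFunc F), v.weight * (v.ordField g : ℝ) = 0 := by
    intro p
    induction p using UniqueFactorizationMonoid.induction_on_prime with
    | h₁ => simp
    | h₂ x hx =>
      intro _ g hg
      obtain ⟨c, hc, rfl⟩ := Polynomial.isUnit_iff.1 hx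
      have : ∀ v : Place (RatFunc F), v.ordField g = 0 := fun v => by
        rw [← Place.val_eq_one_iff, hg]
        exact Valuation.IsTrivialOn.eq_one (v := v.val) c hc.ne_zero
      simp [this]
    | h₃ a π ha hπ ih =>
      intro _ g hg
      have hπ0 : algebraMap F[X] (RatFunc F) π ≠ 0 := by
        simpa using hπ.ne_zero
      have ha0 : algebraMap F[X] (RatFunc F) a ≠ 0 := by
        simpa using ha
      have hgm : g = Units.mk0 _ hπ0 * Units.mk0 _ ha0 := Units.ext (by simp [hg])
      rw [hgm, hmul, ih ha (Units.mk0 _ ha0) rfl, add_zero]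
      let P : HeightOneSpectrum F[X] :=
        ⟨Ideal.span {π}, (Ideal.span_singleton_prime hπ.ne_zero).2 hπ, by
          simpa using hπ.ne_zero⟩
      set u : (RatFunc F)ˣ := Units.mk0 _ hπ0 with hu
      have hord : ∀ Q : HeightOneSpectrum F[X],
          (Place.ofPrime (RatFunc F) Q).ordField u = if P = Q then 1 else 0 := by
        intro Q
        split_ifs with h
        · subst h
          have h1 := P.intValuation_singleton hπ.ne_zero rfl
          have h2 : (Place.ofPrime (RatFunc F) P).val (u : RatFunc F) = WithZero.exp (-1) := by
            rw [← h1]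
            exact P.valuation_of_algebraMap π
          rw [Place.val_eq_exp_iff] at h2
          simpa using h2
        · rw [← Place.val_eq_one_iff]
          refine le_antisymm (Place.ofPrime_le_one Q π) (not_lt.1 fun hlt => h ?_)
          have hlt' := (Place.ofPrime_lt_one_iff (K := RatFunc F) Q π).1 hlt
          have hle : P.asIdeal ≤ Q.asIdeal := (Ideal.span_singleton_le_iff_mem _).2 hlt'
          exact HeightOneSpectrum.ext (P.isMaximal.eq_of_le Q.isPrime.ne_top hle)
      have hinf : (Place.infinity F).ordField u = -π.natDegree :=
        Place.infinity_ordField_polynomial F rfl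
      have hne : Place.infinity F ≠ Place.ofPrime (RatFunc F) P := by
        intro h
        have h1 := hord P
        rw [← h, hinf, if_pos rfl] at h1
        omega
      rw [finsum_eq_sum_of_support_subset _
        (s := {Place.infinity F, Place.ofPrime (RatFunc F) P}) ?_, Finset.sum_pair hne]
      · rw [hinf, hord, if_pos rfl, Place.weight, Place.weight,
          (Place.ofPrime_residueCard F P rfl).2, Place.residueCard,
          ← Nat.card_congr (Place.infinity_bijective_residue F).some]
        push_cast
        rw [Real.log_pow]
        ring
      · intro v hv
        rcases v.ratFunc_cases F with rfl | ⟨Q, rfl⟩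
        · simp
        · rw [Function.mem_support, hord] at hv
          have : P = Q := by
            by_contra h
            simp [h] at hv
          simp [this]
  obtain ⟨a, b, hb, hab⟩ := IsFractionRing.div_surjective (A := F[X]) (f : RatFunc F)
  have hb0 : algebraMap F[X] (RatFunc F) b ≠ 0 := by
    simpa using nonZeroDivisors.ne_zero hb
  have ha0 : algebraMap F[X] (RatFunc F) a ≠ 0 := by
    intro h0
    rw [h0, zero_div] at hab
    exact f.ne_zero hab.symm
  have h1 := hmul f (Units.mk0 _ hb0)
  have hfb : f * Units.mk0 _ hb0 = Units.mk0 _ ha0 := by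
    refine Units.ext ?_
    rw [Units.val_mul, ← hab]
    exact div_mul_cancel₀ _ hb0
  rw [hfb, hpoly a (by rintro rfl; simp at ha0) (Units.mk0 _ ha0) rfl,
    hpoly b (nonZeroDivisors.ne_zero hb) (Units.mk0 _ hb0) rfl, add_zero] at h1
  exact h1.symm

instance : IsGlobal (RatFunc F) where
  finite_residueField := inferInstance
  finite_support := Place.finite_support_ratFunc F
  product_formula := Place.product_formula_ratFunc F
  nonempty_place := ⟨Place.infinity F⟩

end RationalFunctions

/-! ### Extensions of global function fields and their constants -/

section Extension

variable (k : Type u) {K : Type u} [Field k] [Field K] [Algebra k K] [FiniteDimensional k K]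

lemma Place.val_le_one_of_coeff_minpoly (w : Place K) (x : K)
    (h : ∀ n, (w.under k).val ((minpoly k x).coeff n) ≤ 1) : w.val x ≤ 1 := by
  refine w.val_le_one_of_mem_integersAbove (k := k) ?_
  have hsub : ((minpoly k x).coeffs : Set k) ⊆ (w.under k).val.valuationSubring.toSubring := by
    intro c hc
    obtain ⟨n, -, rfl⟩ := Polynomial.mem_coeffs_iff.1 (Finset.mem_coe.1 hc)
    exact h n
  refine ⟨(minpoly k x).toSubring _ hsub, (Polynomial.monic_toSubring _ _ hsub).2
    (minpoly.monic (Algebra.IsIntegral.isIntegral x)), ?_⟩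
  have h1 : ((minpoly k x).toSubring _ hsub).map
      (w.under k).val.valuationSubring.toSubring.subtype = minpoly k x :=
    Polynomial.map_toSubring _ _ hsub
  have h2 := minpoly.aeval k x
  rw [← h1, Polynomial.aeval_def, Polynomial.eval₂_map] at h2
  exact h2

lemma Place.ordField_eq_zero_of_minpoly (w : Place K) (f : Kˣ)
    (h : ∀ n, (w.under k).val ((minpoly k (f : K)).coeff n) ≤ 1)
    (h' : ∀ n, (w.under k).val ((minpoly k ((f⁻¹ : Kˣ) : K)).coeff n) ≤ 1) :
    w.ordField f = 0 := by
  have h1 := (w.val_le_one_iff f).1 (w.val_le_one_of_coeff_minpoly k _ h)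
  have h2 := (w.val_le_one_iff f⁻¹).1 (w.val_le_one_of_coeff_minpoly k _ h')
  rw [Place.ordField_inv] at h2
  omega

variable [IsGlobal k]

lemma IsGlobal.finite_one_lt (a : k) : {v : Place k | 1 < v.val a}.Finite := by
  rcases eq_or_ne a 0 with rfl | ha
  · simp
  · refine (IsGlobal.finite_support (Units.mk0 a ha)).subset fun v hv h0 => ?_
    have := (v.val_eq_one_iff (Units.mk0 a ha)).2 h0
    exact (ne_of_gt hv) this

lemma IsGlobal.finite_one_lt_coeff (p : Polynomial k) :
    {v : Place k | ∃ n, 1 < v.val (p.coeff n)}.Finite := by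
  refine (Set.Finite.biUnion p.coeffs.finite_toSet fun a _ => IsGlobal.finite_one_lt k a).subset
    fun v hv => ?_
  obtain ⟨n, hn⟩ := hv
  refine Set.mem_biUnion (x := p.coeff n) (Polynomial.coeff_mem_coeffs ?_) hn
  intro h0
  rw [h0, map_zero] at hn
  exact not_lt_zero hn

variable [Algebra.IsSeparable k K]

/-- A function and its inverse are integral at all places where the coefficients of their minimal
polynomials are. -/
theorem IsGlobal.finite_support_extension (k : Type u) [Field k] [Algebra k K]
    [FiniteDimensional k K] [IsGlobal k] [Algebra.IsSeparable k K] (f : Kˣ) :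
    {w : Place K | w.ordField f ≠ 0}.Finite := by
  refine (Set.Finite.biUnion ((IsGlobal.finite_one_lt_coeff k (minpoly k (f : K))).union
    (IsGlobal.finite_one_lt_coeff k (minpoly k ((f⁻¹ : Kˣ) : K))))
    fun v _ => v.finite_setOf_under_eq K).subset fun w hw => ?_
  refine Set.mem_biUnion (x := w.under k) ?_ (rfl : w.under k = w.under k)
  by_contra hcon
  simp only [Set.mem_union, Set.mem_ofPred_eq, not_or, not_exists, not_lt] at hcon
  exact hw (w.ordField_eq_zero_of_minpoly k f hcon.1 hcon.2)

/-- Weights in an extension are multiplied by the residue degree. -/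
lemma Place.weight_eq (w : Place K) :
    w.weight = (w.under k).weight * (residueDegree k w : ℝ) := by
  have h1 := w.residueCard_eq_pow (k := k)
  have h2 : (w.residueCard : ℝ) = ((w.under k).residueCard : ℝ) ^ (residueDegree k w).toNat := by
    exact_mod_cast h1
  rw [Place.weight, h2, Real.log_pow, mul_comm, Place.weight]
  congr 1

/-- A weighted sum over the places of `K` is a weighted sum over the places of `k` of the norms,
here computed as in the local norm formula. -/
theorem finsum_weight_mul_eq {n : Place K → ℤ} (hn : n.support.Finite) :
    ∑ᶠ w : Place K, w.weight * (n w : ℝ) =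
      ∑ᶠ v : Place k, v.weight *
        ((∑ᶠ (w : Place K) (_ : w.under k = v), residueDegree k w * n w : ℤ) : ℝ) := by
  rw [finsum_fiberwise (fun w : Place K => w.under k)]
  · refine finsum_congr fun v => ?_
    have hfin := v.finite_setOf_under_eq K
    have h1 : ∀ {M : Type} [AddCommMonoid M] (g : Place K → M),
        ∑ᶠ (w : Place K) (_ : w.under k = v), g w = ∑ w ∈ hfin.toFinset, g w := fun g =>
      finsum_mem_eq_finite_toFinset_sum g hfin
    rw [h1, h1, Int.cast_sum, Finset.mul_sum]
    refine Finset.sum_congr rfl fun w hw => ?_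
    have hw' : w.under k = v := by simpa using hw
    rw [w.weight_eq k, hw']
    push_cast
    ring
  · exact hn.subset fun w hw h0 => hw (by simp [h0])

variable (K) in
/-- A finite separable extension of a global function field is a global function field. -/
theorem IsGlobal.of_extension (k : Type u) [Field k] [Algebra k K]
    [FiniteDimensional k K] [IsGlobal k] [Algebra.IsSeparable k K] :
    IsGlobal K where
  finite_residueField w := w.finite_residueField_of_under (k := k)
  finite_support := IsGlobal.finite_support_extension k
  product_formula f := by
    rw [finsum_weight_mul_eq k (n := fun w => w.ordField f)
      (IsGlobal.finite_support_extension k f),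
      ← IsGlobal.product_formula (Units.map (Algebra.norm k) f)]
    exact finsum_congr fun v => by rw [v.ordField_norm]
  nonempty_place := by
    obtain ⟨v⟩ := IsGlobal.nonempty_place (K := k)
    -- if `v` had no extension, all elements of `k` would be integral over the valuation ring of `v`
    by_contra hemp
    rw [not_nonempty_iff] at hemp
    obtain ⟨a, -, ha⟩ := v.exists_val_eq_exp 1
    have h1 : algebraMap k K a ∈ v.integersAbove K :=
      v.mem_integersAbove fun w => (hemp.false w).elim
    have h2 : IsIntegral v.val.valuationSubring a :=
      (isIntegral_algebraMap_iff (algebraMap k K).injective).1 h1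
    obtain ⟨b, hb⟩ := (IsIntegrallyClosed.isIntegral_iff (K := k)).1 h2
    have h3 : v.val a ≤ 1 := hb ▸ b.2
    rw [ha, ← WithZero.exp_zero, WithZero.exp_le_exp] at h3
    omega

end Extension

section Constants

variable (K : Type u) [Field K]

lemma mem_constants_iff (x : K) : x ∈ constants K ↔ ∀ v : Place K, v.val x ≤ 1 := by
  rw [constants, Subring.mem_iInf]
  rfl

variable [IsGlobal K]

variable {K} in
/-- An element without poles has no zeros, by the product formula. -/
theorem IsGlobal.ordField_eq_zero_of_nonneg {f : Kˣ} (h : ∀ v : Place K, 0 ≤ v.ordField f)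
    (v : Place K) : v.ordField f = 0 := by
  have hsum := IsGlobal.product_formula f
  have hfin : (Function.support fun v : Place K => v.weight * (v.ordField f : ℝ)).Finite :=
    (IsGlobal.finite_support f).subset fun v hv h0 => hv (by simp [h0])
  have hnn : ∀ v : Place K, 0 ≤ v.weight * (v.ordField f : ℝ) := fun v =>
    mul_nonneg v.weight_pos.le (by exact_mod_cast h v)
  have h1 : v.weight * (v.ordField f : ℝ) ≤ 0 := by
    rw [← hsum]
    exact single_le_finsum v hfin hnn
  have h2 : (v.ordField f : ℝ) = 0 := by
    have := le_antisymm h1 (hnn v)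
    exact (mul_eq_zero.1 this).resolve_left v.weight_pos.ne'
  exact_mod_cast h2

variable {K} in
theorem mem_units_constants_iff (f : Kˣ) :
    f ∈ (constants K).toSubmonoid.units ↔ ∀ v : Place K, v.ordField f = 0 := by
  rw [Submonoid.mem_units_iff]
  constructor
  · rintro ⟨h, -⟩
    exact IsGlobal.ordField_eq_zero_of_nonneg fun v =>
      (v.val_le_one_iff f).1 ((mem_constants_iff K _).1 h v)
  · intro h
    refine ⟨(mem_constants_iff K _).2 fun v => ?_, (mem_constants_iff K _).2 fun v => ?_⟩
    · rw [v.val_le_one_iff, h]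
    · rw [v.val_le_one_iff, Place.ordField_inv, h, neg_zero]

theorem isField_constants : IsField (constants K) where
  exists_pair_ne := ⟨0, 1, zero_ne_one⟩
  mul_comm := mul_comm
  mul_inv_cancel := by
    intro a ha
    have ha0 : (a : K) ≠ 0 := fun h => ha (Subtype.ext h)
    have h1 := (mem_units_constants_iff (Units.mk0 (a : K) ha0)).2
      (IsGlobal.ordField_eq_zero_of_nonneg fun v =>
        (v.val_le_one_iff (Units.mk0 (a : K) ha0)).1 ((mem_constants_iff K _).1 a.2 v))
    rw [Submonoid.mem_units_iff] at h1
    exact ⟨⟨_, h1.2⟩, Subtype.ext (mul_inv_cancel₀ ha0)⟩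

instance instFieldConstants : Field (constants K) := (isField_constants K).toField

instance instFiniteConstants : Finite (constants K) := by
  obtain ⟨v⟩ := IsGlobal.nonempty_place (K := K)
  let φ : constants K →+* v.residueField :=
    (IsLocalRing.residue v.val.valuationSubring).comp
      (algebraMap (constants K) v.val.valuationSubring)
  exact Finite.of_injective φ φ.injective

instance : Finite ((constants K).toSubmonoid.units) := by
  refine Finite.of_injective (β := constants K)
    (fun f => ⟨((f : Kˣ) : K), ((Submonoid.mem_units_iff _ _).1 f.2).1⟩) fun f g h => ?_
  exact Subtype.ext (Units.ext (congrArg Subtype.val h))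

/-- The degree of a place is proportional to its weight. -/
theorem Place.weight_eq_deg_mul (v : Place K) :
    v.weight = v.deg * Real.log (Nat.card (constants K)) := by
  have : Module.Finite (constants K) v.residueField := Module.Finite.of_finite
  have h : v.residueCard = Nat.card (constants K) ^ Module.finrank (constants K) v.residueField :=
    Module.natCard_eq_pow_finrank (K := constants K) (V := v.residueField)
  rw [Place.weight, h, Nat.cast_pow, Real.log_pow, Place.deg]
  push_cast
  rfl

lemma log_card_constants_pos : 0 < Real.log (Nat.card (constants K)) :=
  Real.log_pos (by exact_mod_cast Finite.one_lt_card)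

variable {K}

lemma finsum_weight_eq {n : Place K → ℤ} (hn : n.support.Finite) :
    ∑ᶠ v : Place K, v.weight * (n v : ℝ) =
      ((∑ᶠ v : Place K, v.deg * n v : ℤ) : ℝ) * Real.log (Nat.card (constants K)) := by
  have hfin : (Function.support fun v : Place K => v.deg * n v) ⊆ hn.toFinset := by
    intro v hv
    simp only [Set.Finite.coe_toFinset, Function.mem_support]
    intro h0
    exact hv (by simp [h0])
  rw [finsum_eq_sum_of_support_subset _ hfin, finsum_eq_sum_of_support_subset (s := hn.toFinset)]
  · rw [Int.cast_sum, Finset.sum_mul]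
    refine Finset.sum_congr rfl fun v _ => ?_
    rw [v.weight_eq_deg_mul]
    push_cast
    ring
  · intro v hv
    simp only [Set.Finite.coe_toFinset, Function.mem_support]
    intro h0
    exact hv (by simp [h0])

/-- A degree vanishes if and only if the corresponding weighted sum does. -/
lemma finsum_deg_eq_zero_iff {n : Place K → ℤ} (hn : n.support.Finite) :
    ∑ᶠ v : Place K, v.deg * n v = 0 ↔ ∑ᶠ v : Place K, v.weight * (n v : ℝ) = 0 := by
  rw [finsum_weight_eq hn, mul_eq_zero, or_iff_left (log_card_constants_pos K).ne',
    Int.cast_eq_zero]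

/-- Principal divisors have degree zero. -/
theorem finsum_deg_ordField (f : Kˣ) : ∑ᶠ v : Place K, v.deg * v.ordField f = 0 :=
  (finsum_deg_eq_zero_iff (n := fun v => v.ordField f) (IsGlobal.finite_support f)).2
    (IsGlobal.product_formula f)

end Constants

/-! ### Finiteness of the group of divisor classes of degree zero -/

section Counting

variable {K : Type u} [Field K]

/-- The elements of `K` of order at least `m` at a place. -/
def Place.orderGE (w : Place K) (m : ℤ) : AddSubgroup K where
  carrier := {x | w.val x ≤ WithZero.exp (-m)}
  zero_mem' := by simp
  add_mem' {x y} hx hy := (w.val.map_add x y).trans (max_le hx hy)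
  neg_mem' {x} hx := by simpa [Valuation.map_neg] using hx

lemma Place.mem_orderGE {w : Place K} {m : ℤ} {x : K} :
    x ∈ w.orderGE m ↔ w.val x ≤ WithZero.exp (-m) := Iff.rfl

lemma Place.orderGE_units {w : Place K} {m : ℤ} {x : Kˣ} :
    (x : K) ∈ w.orderGE m ↔ m ≤ w.ordField x := by
  rw [Place.mem_orderGE, Place.val_le_exp_iff]
  omega

/-- The quotient of `{ord_w ≥ m}` by `{ord_w ≥ m + 1}` embeds in the residue field. -/
theorem Place.card_le_residueCard_mul (w : Place K) [Finite w.residueField] (V : AddSubgroup K)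
    [Finite V] {m : ℤ} (hV : V ≤ w.orderGE m) :
    Nat.card V ≤ w.residueCard * Nat.card (V ⊓ w.orderGE (m + 1) : AddSubgroup K) := by
  obtain ⟨π, hπ0, hπ⟩ := w.exists_val_eq_exp m
  have hmem : ∀ s : V, (s : K) * π ∈ w.val.valuationSubring := fun s => by
    change w.val _ ≤ 1
    rw [map_mul, hπ]
    calc w.val (s : K) * WithZero.exp m ≤ WithZero.exp (-m) * WithZero.exp m :=
          mul_le_mul_left (hV s.2) _
      _ = 1 := by rw [← WithZero.exp_add]; simp
  let φ : V →+ w.residueField :=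
    { toFun := fun s => IsLocalRing.residue w.val.valuationSubring ⟨_, hmem s⟩
      map_zero' := by
        rw [← map_zero (IsLocalRing.residue w.val.valuationSubring)]
        congr 1
        exact Subtype.ext (by simp)
      map_add' := fun s t => by
        rw [← map_add]
        congr 1
        exact Subtype.ext (by simp [add_mul]) }
  have hker : φ.ker.map V.subtype = V ⊓ w.orderGE (m + 1) := by
    ext x
    constructor
    · rintro ⟨s, hs, rfl⟩
      refine ⟨s.2, ?_⟩
      have h1 := (IsLocalRing.residue_eq_zero_iff _).1 (AddMonoidHom.mem_ker.1 hs)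
      rw [w.mem_maximalIdeal_iff] at h1
      change w.val ((s : K) * π) < 1 at h1
      rw [map_mul, hπ] at h1
      change w.val (s : K) ≤ _
      rcases eq_or_ne (s : K) 0 with h0 | h0
      · simp [h0]
      · obtain ⟨u, hu⟩ : ∃ u : Kˣ, (u : K) = s := ⟨Units.mk0 _ h0, rfl⟩
        rw [← hu, w.val_eq_exp_ordField, ← WithZero.exp_add, ← WithZero.exp_zero,
          WithZero.exp_lt_exp] at h1
        rw [← hu, w.val_le_exp_iff]
        omega
    · rintro ⟨hxV, hx⟩
      refine ⟨⟨x, hxV⟩, ?_, rfl⟩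
      refine AddMonoidHom.mem_ker.2 ((IsLocalRing.residue_eq_zero_iff _).2 ?_)
      rw [w.mem_maximalIdeal_iff]
      change w.val (x * π) < 1
      rw [map_mul, hπ]
      calc w.val x * WithZero.exp m ≤ WithZero.exp (-(m + 1)) * WithZero.exp m :=
            mul_le_mul_left hx _
        _ < 1 := by
          rw [← WithZero.exp_add, ← WithZero.exp_zero, WithZero.exp_lt_exp]
          omega
  have hcard : Nat.card φ.ker = Nat.card (V ⊓ w.orderGE (m + 1) : AddSubgroup K) := by
    rw [← hker]
    exact Nat.card_congr (φ.ker.equivMapOfInjective _ V.subtype_injective).toEquiv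
  rw [← hcard, ← φ.ker.index_mul_card, AddSubgroup.index_ker]
  exact Nat.mul_le_mul_right _ (Nat.card_le_card_of_injective _ Subtype.val_injective)

/-- At most `q_w ^ j` conditions have to be imposed in order to raise the order at `w` by `j`. -/
lemma Place.card_le_residueCard_pow_mul (w : Place K) [Finite w.residueField] (V : AddSubgroup K)
    [Finite V] {m : ℤ} (hV : V ≤ w.orderGE m) (j : ℕ) :
    Nat.card V ≤ w.residueCard ^ j * Nat.card (V ⊓ w.orderGE (m + j) : AddSubgroup K) := by
  induction j with
  | zero => simp [inf_eq_left.2 hV]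
  | succ j ih =>
    have hfin : Finite (V ⊓ w.orderGE (m + j) : AddSubgroup K) :=
      Set.Finite.subset (s := (V : Set K)) (Set.toFinite _) fun x hx => hx.1
    have h1 := w.card_le_residueCard_mul (V ⊓ w.orderGE (m + j)) (m := m + j) inf_le_right
    have h2 : V ⊓ w.orderGE (m + j) ⊓ w.orderGE (m + j + 1) = V ⊓ w.orderGE (m + (j + 1 : ℕ)) := by
      ext x
      simp only [AddSubgroup.mem_inf, Place.mem_orderGE, Nat.cast_add, Nat.cast_one, ← add_assoc]
      refine ⟨fun h => ⟨h.1.1, h.2⟩, fun h => ⟨⟨h.1, h.2.trans ?_⟩, h.2⟩⟩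
      rw [WithZero.exp_le_exp]
      omega
    rw [h2] at h1
    calc _ ≤ _ := ih
      _ ≤ _ := Nat.mul_le_mul_left _ h1
      _ = _ := by ring

lemma Place.card_le_prod_mul (V : AddSubgroup K) [Finite V] (S : Finset (Place K))
    [∀ w : Place K, Finite w.residueField] {a : Place K → ℤ}
    (hV : ∀ w : Place K, V ≤ w.orderGE (a w))
    (j : Place K → ℕ) :
    Nat.card V ≤ (∏ w ∈ S, w.residueCard ^ j w) *
      Nat.card (V ⊓ ⨅ w ∈ S, w.orderGE (a w + j w) : AddSubgroup K) := by
  classical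
  induction S using Finset.induction_on with
  | empty => simp
  | insert w S hw ih =>
    have hfin : Finite (V ⊓ ⨅ w ∈ S, w.orderGE (a w + j w) : AddSubgroup K) :=
      Set.Finite.subset (s := (V : Set K)) (Set.toFinite _) fun x hx => hx.1
    have h1 := w.card_le_residueCard_pow_mul (V ⊓ ⨅ w ∈ S, w.orderGE (a w + j w))
      (inf_le_left.trans (hV w)) (j w)
    rw [inf_assoc, inf_comm (⨅ w ∈ S, w.orderGE (a w + j w))] at h1
    rw [Finset.prod_insert hw, Finset.iInf_insert w S fun w => w.orderGE (a w + j w)]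
    calc _ ≤ _ := ih
      _ ≤ _ := Nat.mul_le_mul_left _ h1
      _ = _ := by ring

/-- A finite group of functions with more elements than the number of conditions to be imposed
contains a nonzero function that satisfies these conditions. -/
theorem Place.exists_forall_mem_orderGE [∀ w : Place K, Finite w.residueField] (V : AddSubgroup K)
    [Finite V] {a b : Place K → ℤ} (hab : ∀ w, a w ≤ b w)
    (hV : ∀ w : Place K, V ≤ w.orderGE (a w))
    (hfin : {w | a w ≠ b w}.Finite)
    (hcard : ∑ᶠ w : Place K, w.weight * ((b w - a w : ℤ) : ℝ) < Real.log (Nat.card V)) :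
    ∃ s ∈ V, s ≠ 0 ∧ ∀ w : Place K, s ∈ w.orderGE (b w) := by
  by_contra hcon
  have h := Place.card_le_prod_mul V hfin.toFinset hV (fun w => (b w - a w).toNat)
  have hcast : ∀ w : Place K, ((b w - a w).toNat : ℤ) = b w - a w := fun w =>
    Int.toNat_of_nonneg (by have := hab w; omega)
  have hbot : V ⊓ ⨅ w ∈ hfin.toFinset, w.orderGE (a w + (b w - a w).toNat) = ⊥ := by
    rw [eq_bot_iff]
    rintro s ⟨hsV, hs⟩
    by_contra hs0
    refine hcon ⟨s, hsV, hs0, fun w => ?_⟩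
    by_cases hw : a w = b w
    · exact hw ▸ hV w hsV
    · have h2 : s ∈ w.orderGE (a w + (b w - a w).toNat) := by
        have h3 := (AddSubgroup.mem_iInf.1 hs) w
        exact (AddSubgroup.mem_iInf.1 h3) (by simpa using hw)
      rwa [hcast, add_sub_cancel] at h2
  rw [hbot, AddSubgroup.card_bot, mul_one] at h
  have h0 : (0 : ℝ) < Nat.card V := by exact_mod_cast Nat.card_pos
  have hlog : Real.log (Nat.card V) ≤
      Real.log ((∏ w ∈ hfin.toFinset, w.residueCard ^ (b w - a w).toNat : ℕ) : ℝ) :=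
    Real.log_le_log h0 (by exact_mod_cast h)
  refine absurd hcard (not_lt.2 (hlog.trans (le_of_eq ?_)))
  rw [finsum_eq_sum_of_support_subset _ (s := hfin.toFinset), Nat.cast_prod, Real.log_prod]
  · refine Finset.sum_congr rfl fun w _ => ?_
    rw [Nat.cast_pow, Real.log_pow, Place.weight, mul_comm]
    congr 1
    exact_mod_cast hcast w
  · intro w _
    have := w.one_lt_residueCard
    positivity
  · intro w hw
    simp only [Set.Finite.coe_toFinset, Set.mem_ofPred_eq]
    intro h0
    exact hw (by simp [h0])

end Counting


section ClassNumber

variable (F : Type u) [Field F] (K : Type u) [Field K] [Algebra (RatFunc F) K]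

lemma algebraMap_X_ne_zero : algebraMap (RatFunc F) K RatFunc.X ≠ 0 :=
  (map_ne_zero _).2 RatFunc.X_ne_zero

/-- The variable `t`, as a nonzero element of an extension of `F(t)`. -/
def transcendental : Kˣ := Units.mk0 _ (algebraMap_X_ne_zero F K)

lemma transcendental_pow_ne {a b : ℕ} (h : a ≠ b) :
    (transcendental F K : K) ^ a ≠ (transcendental F K : K) ^ b := by
  intro heq
  change algebraMap (RatFunc F) K RatFunc.X ^ a = algebraMap (RatFunc F) K RatFunc.X ^ b at heq
  rw [← map_pow, ← map_pow, (algebraMap (RatFunc F) K).injective.eq_iff, ← RatFunc.algebraMap_X,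
    ← map_pow, ← map_pow, (RatFunc.algebraMap_injective F).eq_iff] at heq
  have := congrArg Polynomial.natDegree heq
  simp only [Polynomial.natDegree_X_pow] at this
  exact h this

variable {K}

/-- A place at which `t` is regular is a zero of some `t ^ b - t ^ a`, with a bound on the
exponents in terms of the residue field. -/
theorem Place.exists_transcendental_pow_sub (w : Place K) [Finite w.residueField]
    (hw : w.val (transcendental F K : K) ≤ 1) :
    ∃ a b : ℕ, a < b ∧ b ≤ w.residueCard ∧
      w.val ((transcendental F K : K) ^ b - (transcendental F K : K) ^ a) < 1 := by
  let t : w.val.valuationSubring := ⟨transcendental F K, hw⟩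
  let φ : Fin (w.residueCard + 1) → w.residueField := fun n => IsLocalRing.residue _ t ^ (n : ℕ)
  have hφ : ¬ Function.Injective φ := fun h => by
    have := Nat.card_le_card_of_injective φ h
    rw [Nat.card_fin] at this
    exact absurd this (by rw [not_le]; exact Nat.lt_succ_self _)
  have key : ∀ a b : Fin (w.residueCard + 1), a < b → φ a = φ b →
      ∃ a b : ℕ, a < b ∧ b ≤ w.residueCard ∧
        w.val ((transcendental F K : K) ^ b - (transcendental F K : K) ^ a) < 1 := by
    intro a b hab h
    refine ⟨a, b, hab, Nat.lt_succ_iff.1 b.2, ?_⟩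
    have h1 : IsLocalRing.residue w.val.valuationSubring (t ^ (b : ℕ) - t ^ (a : ℕ)) = 0 := by
      rw [map_sub, map_pow, map_pow, sub_eq_zero]
      exact h.symm
    exact (w.mem_maximalIdeal_iff _).1 ((IsLocalRing.residue_eq_zero_iff _).1 h1)
  simp only [Function.Injective, not_forall] at hφ
  obtain ⟨a, b, h, hab⟩ := hφ
  rcases lt_or_gt_of_ne hab with h' | h'
  · exact key a b h' h
  · exact key b a h' h.symm

variable (K) in
/-- There are only finitely many places with a residue field of bounded cardinality. -/
theorem Place.finite_residueCard_le (F : Type u) [Field F] [Algebra (RatFunc F) K] [IsGlobal K]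
    (B : ℕ) :
    {w : Place K | w.residueCard ≤ B}.Finite := by
  have h0 : ∀ a b : ℕ, a ≠ b → {w : Place K |
      w.val ((transcendental F K : K) ^ b - (transcendental F K : K) ^ a) < 1}.Finite := by
    intro a b hab
    have hne : (transcendental F K : K) ^ b - (transcendental F K : K) ^ a ≠ 0 :=
      sub_ne_zero.2 (transcendental_pow_ne F K hab.symm)
    refine (IsGlobal.finite_support (Units.mk0 _ hne)).subset fun w hw => ?_
    exact ((w.val_lt_one_iff (Units.mk0 _ hne)).1 hw).ne'
  refine ((IsGlobal.finite_support (transcendental F K)).union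
    (Set.Finite.biUnion (Set.finite_Iic B) fun a _ => Set.Finite.biUnion
      ((Set.finite_Iic B).inter_of_left {b | a ≠ b}) fun b hb => h0 a b hb.2)).subset fun w hw => ?_
  by_cases hwt : w.val (transcendental F K : K) ≤ 1
  · right
    obtain ⟨a, b, hab, hb, h⟩ := w.exists_transcendental_pow_sub F hwt
    have hbB : b ≤ B := hb.trans hw
    exact Set.mem_biUnion (x := a) (hab.le.trans hbB)
      (Set.mem_biUnion (x := b) ⟨hbB, hab.ne⟩ h)
  · left
    rw [w.val_le_one_iff] at hwt
    simp only [Set.mem_ofPred_eq]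
    omega

/-- The divisor of a nonzero function. -/
def divisor [IsGlobal K] (f : Kˣ) : Place K →₀ ℤ :=
  Finsupp.ofSupportFinite (fun w => w.ordField f) (IsGlobal.finite_support f)

lemma divisor_apply [IsGlobal K] (f : Kˣ) (w : Place K) : divisor f w = w.ordField f := rfl

variable (K) in
/-- The sum of the coefficients of a divisor, weighted by the logarithms of the cardinalities of
the residue fields. -/
def weightedDegree : (Place K →₀ ℤ) →+ ℝ :=
  Finsupp.liftAddHom fun w => (AddMonoidHom.mulLeft w.weight).comp (Int.castAddHom ℝ)

lemma weightedDegree_eq (D : Place K →₀ ℤ) :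
    weightedDegree K D = ∑ᶠ w : Place K, w.weight * (D w : ℝ) := by
  rw [finsum_eq_sum_of_support_subset _ (s := D.support)]
  · rfl
  · intro w hw
    simp only [Finset.mem_coe, Finsupp.mem_support_iff]
    intro h0
    exact hw (by simp [h0])

lemma weightedDegree_divisor [IsGlobal K] (f : Kˣ) : weightedDegree K (divisor f) = 0 := by
  rw [weightedDegree_eq]
  exact IsGlobal.product_formula f

variable (K) in
/-- Effective divisors of bounded degree are finite in number. -/
theorem finite_effective (F : Type u) [Field F] [Algebra (RatFunc F) K] [IsGlobal K] (B : ℝ) :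
    {E : Place K →₀ ℤ | (∀ w, 0 ≤ E w) ∧ weightedDegree K E ≤ B}.Finite := by
  classical
  have hfin := Place.finite_residueCard_le K F ⌊Real.exp B⌋₊
  refine (Set.finite_Icc 0
    (Finsupp.indicator hfin.toFinset fun _ _ => ⌊B / Real.log 2⌋)).subset ?_
  rintro E ⟨hE0, hE⟩
  rw [weightedDegree_eq] at hE
  refine ⟨fun w => hE0 w, fun w => ?_⟩
  have hsupp : (Function.support fun w : Place K => w.weight * (E w : ℝ)).Finite :=
    E.hasFiniteSupport.subset fun w hw h0 => hw (by simp [h0])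
  have hw : w.weight * (E w : ℝ) ≤ B := (single_le_finsum w hsupp fun w =>
    mul_nonneg w.weight_pos.le (by exact_mod_cast hE0 w)).trans hE
  rw [Finsupp.indicator_apply]
  have hcard : (2 : ℝ) ≤ w.residueCard := by exact_mod_cast w.one_lt_residueCard
  have h2 : Real.log 2 ≤ w.weight := Real.log_le_log two_pos hcard
  have hE0' : (0 : ℝ) ≤ E w := by exact_mod_cast hE0 w
  split_ifs with h
  · rw [Int.le_floor, le_div_iff₀ (Real.log_pos one_lt_two), mul_comm]
    exact (mul_le_mul_of_nonneg_right h2 hE0').trans hw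
  · by_contra hpos
    have h1 : (1 : ℝ) ≤ E w := by
      have : 1 ≤ E w := by omega
      exact_mod_cast this
    refine h ?_
    simp only [Set.Finite.mem_toFinset, Set.mem_ofPred_eq]
    refine Nat.le_floor ?_
    rw [← Real.log_le_iff_le_exp (by linarith)]
    exact (le_mul_of_one_le_right w.weight_pos.le h1).trans hw

/-- For a given divisor there is a function whose order at the places where `t` is regular is
at least that prescribed by the divisor. -/
lemma exists_le_ordField [IsGlobal K] (D : Place K →₀ ℤ) :
    ∃ p : Kˣ, ∀ w : Place K, w.val (transcendental F K : K) ≤ 1 → D w ≤ w.ordField p := by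
  have h1 : ∀ w : Place K, ∃ f : Kˣ,
      (w.val (transcendental F K : K) ≤ 1 → 1 ≤ w.ordField f) ∧
      ∀ w' : Place K, w'.val (transcendental F K : K) ≤ 1 → 0 ≤ w'.ordField f := by
    intro w
    by_cases hw : w.val (transcendental F K : K) ≤ 1
    · obtain ⟨a, b, hab, -, h⟩ := w.exists_transcendental_pow_sub F hw
      have hne : (transcendental F K : K) ^ b - (transcendental F K : K) ^ a ≠ 0 :=
        sub_ne_zero.2 (transcendental_pow_ne F K hab.ne')
      refine ⟨Units.mk0 _ hne, fun _ => (w.val_lt_one_iff (Units.mk0 _ hne)).1 h, fun w' hw' => ?_⟩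
      refine (w'.val_le_one_iff (Units.mk0 _ hne)).1 ?_
      refine (w'.val.map_sub _ _).trans (max_le ?_ ?_)
      · rw [map_pow]
        exact pow_le_one' hw' _
      · rw [map_pow]
        exact pow_le_one' hw' _
    · exact ⟨1, fun h => absurd h hw, fun w' _ => w'.ordField_one.ge⟩
  choose f hf hf' using h1
  refine ⟨∏ w ∈ D.support, f w ^ (D w).toNat, fun w hw => ?_⟩
  rw [Place.ordField_prod]
  have hnn : ∀ w' ∈ D.support, 0 ≤ w.ordField (f w' ^ (D w').toNat) := fun w' _ => by
    rw [Place.ordField_pow]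
    exact mul_nonneg (Nat.cast_nonneg _) (hf' w' w hw)
  by_cases hD : w ∈ D.support
  · refine le_trans ?_ (Finset.single_le_sum hnn hD)
    rw [Place.ordField_pow]
    have := hf w hw
    have h3 := Int.self_le_toNat (D w)
    nlinarith [Nat.cast_nonneg (α := ℤ) (D w).toNat]
  · rw [Finsupp.notMem_support_iff.1 hD]
    exact Finset.sum_nonneg hnn

variable [FiniteDimensional (RatFunc F) K] [Finite F]

lemma Place.transcendental_le_one_iff (w : Place K) :
    w.val (transcendental F K : K) ≤ 1 ↔ w.under (RatFunc F) ≠ Place.infinity F := by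
  have h1 := w.under_val_le_one_iff (k := RatFunc F) RatFunc.X
  have h2 : (Place.infinity F).val (RatFunc.X : RatFunc F) = WithZero.exp 1 := by
    rw [← RatFunc.algebraMap_X, Place.infinity_val_polynomial F Polynomial.X_ne_zero,
      Polynomial.natDegree_X, Nat.cast_one]
  change w.val (algebraMap (RatFunc F) K RatFunc.X) ≤ 1 ↔ _
  rw [← h1]
  constructor
  · intro h heq
    rw [heq, h2, ← WithZero.exp_zero, WithZero.exp_le_exp] at h
    omega
  · intro h
    obtain ⟨P, hP⟩ := ((w.under (RatFunc F)).ratFunc_cases F).resolve_left h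
    rw [← hP, ← RatFunc.algebraMap_X]
    exact Place.ofPrime_le_one P _

/-- The polar divisor of `t` has degree `[K : F(t)]`. -/
theorem finsum_weight_transcendental [Algebra.IsSeparable (RatFunc F) K] :
    ∑ᶠ w : Place K, w.weight * ((min 0 (w.ordField (transcendental F K)) : ℤ) : ℝ) =
      -(Module.finrank (RatFunc F) K * Real.log (Nat.card F)) := by
  have hG : IsGlobal K := IsGlobal.of_extension K (RatFunc F)
  have hsupp : (Function.support fun w : Place K =>
      min 0 (w.ordField (transcendental F K))).Finite :=
    (IsGlobal.finite_support (transcendental F K)).subset fun w hw h0 => hw (by simp [h0])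
  have hX : (RatFunc.X : RatFunc F) ≠ 0 := RatFunc.X_ne_zero
  rw [finsum_weight_mul_eq (RatFunc F) hsupp, finsum_eq_single _ (Place.infinity F)]
  · have h1 : ∑ᶠ (w : Place K) (_ : w.under (RatFunc F) = Place.infinity F),
        residueDegree (RatFunc F) w * min 0 (w.ordField (transcendental F K)) =
        (Place.infinity F).ordField
          (Units.map (Algebra.norm (RatFunc F)) (transcendental F K)) := by
      rw [Place.ordField_norm]
      refine finsum_mem_congr rfl fun w hw => ?_
      have h2 := (w.transcendental_le_one_iff F).not.2 (not_not.2 hw)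
      rw [w.val_le_one_iff] at h2
      rw [min_eq_right (by omega)]
    have h2 : Units.map (Algebra.norm (RatFunc F)) (transcendental F K) =
        Units.mk0 RatFunc.X hX ^ Module.finrank (RatFunc F) K :=
      Units.ext (Algebra.norm_algebraMap _)
    have h3 : (Place.infinity F).ordField (Units.mk0 RatFunc.X hX) = -1 := by
      rw [Place.infinity_ordField_polynomial F (p := Polynomial.X) (by simp),
        Polynomial.natDegree_X, Nat.cast_one]
    rw [h1, h2, Place.ordField_pow, h3, Place.weight, Place.residueCard,
      ← Nat.card_congr (Place.infinity_bijective_residue F).some]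
    push_cast
    ring
  · intro v hv
    have h0 : ∑ᶠ (w : Place K) (_ : w.under (RatFunc F) = v),
        residueDegree (RatFunc F) w * min 0 (w.ordField (transcendental F K)) = 0 := by
      refine (finsum_mem_congr (s := {w : Place K | w.under (RatFunc F) = v}) (g := fun _ => 0)
        rfl fun w hw => ?_).trans (finsum_mem_zero _)
      have h2 := (w.transcendental_le_one_iff F).2 (by
        rw [show w.under (RatFunc F) = v from hw]
        exact hv)
      rw [w.val_le_one_iff] at h2
      rw [min_eq_left h2, mul_zero]
    rw [h0, Int.cast_zero, mul_zero]

/-- A polynomial in `t` of degree at most `N` has poles at most those of `t ^ N`. -/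
lemma Place.polynomial_mem_orderGE (w : Place K) (N : ℕ) {p : Polynomial F}
    (hp : p ∈ Polynomial.degreeLT F (N + 1)) :
    algebraMap (RatFunc F) K (algebraMap (Polynomial F) (RatFunc F) p) ∈
      w.orderGE (N * min 0 (w.ordField (transcendental F K))) := by
  rw [p.as_sum_range' (N + 1) (by
    rw [Polynomial.mem_degreeLT] at hp
    by_cases h0 : p = 0
    · simp [h0]
    · exact (Polynomial.natDegree_lt_iff_degree_lt h0).2 hp), map_sum, map_sum]
  refine sum_mem fun j hj => ?_
  rw [Finset.mem_range] at hj
  rw [← Polynomial.C_mul_X_pow_eq_monomial, map_mul, map_mul, map_pow, map_pow,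
    RatFunc.algebraMap_X, RatFunc.algebraMap_C, Place.mem_orderGE, map_mul]
  have h1 : w.val (algebraMap (RatFunc F) K (RatFunc.C (p.coeff j))) ≤ 1 := by
    rw [← w.under_val_le_one_iff (k := RatFunc F)]
    rcases eq_or_ne (p.coeff j) 0 with h | h
    · simp [h]
    · exact (Valuation.IsTrivialOn.eq_one (v := (w.under (RatFunc F)).val) _ h).le
  have h2 : w.val (algebraMap (RatFunc F) K RatFunc.X ^ j) ≤
      WithZero.exp (-(N * min 0 (w.ordField (transcendental F K)))) := by
    have : ((transcendental F K ^ j : Kˣ) : K) ∈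
        w.orderGE (N * min 0 (w.ordField (transcendental F K))) := by
      rw [Place.orderGE_units, Place.ordField_pow]
      rcases le_total 0 (w.ordField (transcendental F K)) with h | h
      · rw [min_eq_left h, mul_zero]
        positivity
      · rw [min_eq_right h]
        have : (j : ℤ) ≤ N := by omega
        nlinarith
    exact this
  exact (mul_le_of_le_one_left' h1).trans h2

variable (K) in
/-- The spaces of linear combinations of the elements of a basis of `K` over `F(t)` with polynomial
coefficients of bounded degree: they are large, and the poles of their elements are bounded. -/
theorem exists_addSubgroup_card (F : Type u) [Field F] [Algebra (RatFunc F) K]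
    [FiniteDimensional (RatFunc F) K] [Finite F] [IsGlobal K] :
    ∃ e : Place K →₀ ℤ, (∀ w, 0 ≤ e w) ∧ ∀ N : ℕ, ∃ V : AddSubgroup K, Finite V ∧
      Nat.card V = Nat.card F ^ ((N + 1) * Module.finrank (RatFunc F) K) ∧
      ∀ w : Place K, V ≤ w.orderGE (N * min 0 (w.ordField (transcendental F K)) - e w) := by
  classical
  let b := Module.finBasis (RatFunc F) K
  let ω : Fin (Module.finrank (RatFunc F) K) → Kˣ := fun i => Units.mk0 (b i) (b.ne_zero i)
  have hpos : ∀ f : Kˣ, (Function.support fun w : Place K => max 0 (-w.ordField f)).Finite :=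
    fun f => (IsGlobal.finite_support f).subset fun w hw h0 => hw (by simp [h0])
  refine ⟨∑ i, Finsupp.ofSupportFinite _ (hpos (ω i)), fun w => ?_, fun N => ?_⟩
  · rw [Finsupp.finsetSum_apply]
    exact Finset.sum_nonneg fun i _ => le_max_left _ _
  have hF : Finite (Polynomial.degreeLT F (N + 1)) :=
    Finite.of_equiv _ (Polynomial.degreeLTEquiv F (N + 1)).toEquiv.symm
  let Φ : (Fin (Module.finrank (RatFunc F) K) → Polynomial.degreeLT F (N + 1)) →+ K :=
    (b.equivFun.symm : _ →+ K).comp (AddMonoidHom.mk'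
      (fun a i => algebraMap (Polynomial F) (RatFunc F) (a i)) fun a c => by
        funext i
        simp)
  have hΦ : ∀ a, Φ a = ∑ i, algebraMap (RatFunc F) K
      (algebraMap (Polynomial F) (RatFunc F) (a i)) * ω i := fun a => by
    refine (b.equivFun_symm_apply _).trans (Finset.sum_congr rfl fun i _ => ?_)
    rw [Algebra.smul_def]
    rfl
  have hinj : Function.Injective Φ := by
    intro a c h
    have h1 := b.equivFun.symm.injective h
    funext i
    exact Subtype.ext (RatFunc.algebraMap_injective F (congrFun h1 i))
  refine ⟨Φ.range, Set.finite_range Φ, ?_, fun w => ?_⟩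
  · rw [← Nat.card_congr (Φ.ofInjective hinj).toEquiv, Nat.card_fun,
      Nat.card_congr (Polynomial.degreeLTEquiv F (N + 1)).toEquiv, Nat.card_fun, Nat.card_fin,
      Nat.card_fin, pow_mul]
  · rintro _ ⟨a, rfl⟩
    rw [hΦ]
    refine sum_mem fun i _ => ?_
    have h1 := w.polynomial_mem_orderGE F N (a i).2
    have h2 : -w.ordField (ω i) ≤ (∑ i, Finsupp.ofSupportFinite _ (hpos (ω i)) :
        Place K →₀ ℤ) w := by
      rw [Finsupp.finsetSum_apply]
      exact (le_max_right 0 _).trans (Finset.single_le_sum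
        (f := fun i => Finsupp.ofSupportFinite _ (hpos (ω i)) w)
        (fun i _ => le_max_left 0 _) (Finset.mem_univ i))
    rw [Place.mem_orderGE, map_mul, w.val_eq_exp_ordField]
    calc _ ≤ WithZero.exp (-(N * min 0 (w.ordField (transcendental F K)))) *
          WithZero.exp (-w.ordField (ω i)) := mul_le_mul_left h1 _
      _ ≤ _ := by
        rw [← WithZero.exp_add, WithZero.exp_le_exp]
        linarith

variable (K) in
/-- Finiteness of the class number: every divisor of degree zero is linearly equivalent to one of
finitely many divisors. A count of dimensions gives a function with prescribed zeros in one of the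
large spaces of functions with bounded poles, so that the divisor becomes effective of bounded
degree after addition of a fixed divisor. -/
theorem exists_finite_representatives (F : Type u) [Field F] [Algebra (RatFunc F) K]
    [FiniteDimensional (RatFunc F) K] [Finite F] [Algebra.IsSeparable (RatFunc F) K] [IsGlobal K] :
    ∃ S : Set (Place K →₀ ℤ), S.Finite ∧ ∀ D : Place K →₀ ℤ, weightedDegree K D = 0 →
      ∃ E ∈ S, ∃ f : Kˣ, D = E + divisor f := by
  obtain ⟨e, he0, he⟩ := exists_addSubgroup_card K F
  refine ⟨_, (finite_effective K F (weightedDegree K e)).image (· - e), fun D hD => ?_⟩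
  obtain ⟨p, hp⟩ := exists_le_ordField F D
  have hτ : (Function.support fun w : Place K =>
      min 0 (w.ordField (transcendental F K))).Finite :=
    (IsGlobal.finite_support (transcendental F K)).subset fun w hw h0 => hw (by simp [h0])
  let τ : Place K →₀ ℤ := Finsupp.ofSupportFinite _ hτ
  have hτ' : weightedDegree K τ = -(Module.finrank (RatFunc F) K * Real.log (Nat.card F)) := by
    rw [weightedDegree_eq]
    exact finsum_weight_transcendental F
  -- at the poles of `t` the conditions `a ≤ b` below require only that `N` be large
  let N : ℕ := ∑ w ∈ (D - divisor p).support, ((D - divisor p) w).toNat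
  have hN : ∀ w, (D - divisor p) w ≤ N := by
    intro w
    by_cases hw : w ∈ (D - divisor p).support
    · have h1 : ((D - divisor p) w).toNat ≤ N := Finset.single_le_sum
        (f := fun w => ((D - divisor p) w).toNat) (fun _ _ => Nat.zero_le _) hw
      omega
    · rw [Finsupp.notMem_support_iff.1 hw]
      exact Nat.cast_nonneg N
  obtain ⟨V, hVfin, hVcard, hV⟩ := he N
  -- the number of conditions to be imposed is `N` times the degree of the polar divisor of `t`,
  -- whereas the logarithm of the cardinality of `V` is `N + 1` times this degree
  let δ : Place K →₀ ℤ := divisor p - D - N • τ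
  have hδ : ∀ w, δ w = w.ordField p - D w - N * min 0 (w.ordField (transcendental F K)) := by
    intro w
    simp only [δ, Finsupp.sub_apply, Finsupp.smul_apply, nsmul_eq_mul]
    rfl
  have hδ0 : ∀ w, 0 ≤ δ w := by
    intro w
    rw [hδ]
    by_cases hw : w.val (transcendental F K : K) ≤ 1
    · have h1 := hp w hw
      rw [w.val_le_one_iff] at hw
      rw [min_eq_left hw]
      omega
    · rw [w.val_le_one_iff] at hw
      have h1 := hN w
      rw [Finsupp.sub_apply, divisor_apply] at h1
      rw [min_eq_right (by omega)]
      have h2 : w.ordField (transcendental F K) ≤ -1 := by omega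
      nlinarith [Nat.cast_nonneg (α := ℤ) N]
  obtain ⟨s, -, hs0, hs⟩ := Place.exists_forall_mem_orderGE V
    (a := fun w => N * min 0 (w.ordField (transcendental F K)) - e w)
    (b := fun w => w.ordField p - D w - e w)
    (fun w => by have := hδ0 w; rw [hδ] at this; linarith) hV
    (δ.hasFiniteSupport.subset fun w hw h0 => hw (by rw [hδ] at h0; linarith)) (by
      have h1 : ∑ᶠ w : Place K, w.weight * ((w.ordField p - D w - e w -
          (N * min 0 (w.ordField (transcendental F K)) - e w) : ℤ) : ℝ) = weightedDegree K δ := by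
        rw [weightedDegree_eq]
        refine finsum_congr fun w => ?_
        rw [hδ]
        congr 2
        ring
      have hn : 0 < Module.finrank (RatFunc F) K := Module.finrank_pos
      have hq : 0 < Real.log (Nat.card F) := Real.log_pos (by exact_mod_cast Finite.one_lt_card)
      rw [h1, map_sub, map_sub, map_nsmul, hD, weightedDegree_divisor, hτ', hVcard, Nat.cast_pow,
        Real.log_pow, nsmul_eq_mul]
      push_cast
      have : (0 : ℝ) < Module.finrank (RatFunc F) K * Real.log (Nat.card F) := by positivity
      linarith)
  obtain ⟨u, rfl⟩ : ∃ u : Kˣ, (u : K) = s := ⟨Units.mk0 s hs0, rfl⟩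
  refine ⟨_, ⟨D + e + divisor u - divisor p, ⟨fun w => ?_, ?_⟩, rfl⟩, p * u⁻¹, ?_⟩
  · have h1 := Place.orderGE_units.1 (hs w)
    simp only [Finsupp.sub_apply, Finsupp.add_apply, divisor_apply]
    linarith
  · rw [map_sub, map_add, map_add, weightedDegree_divisor, weightedDegree_divisor, hD]
    linarith
  · ext w
    simp only [Finsupp.sub_apply, Finsupp.add_apply, divisor_apply, Place.ordField_mul,
      Place.ordField_inv]
    ring

end ClassNumber

/-! ### Characters of the multinorm-one torus -/

section Characters

variable {k L : Type u} [Field k] [CommRing L] [Algebra k L] [FiniteDimensional k L]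

/-- An element of a finite free algebra is a unit if its norm is a unit. -/
lemma isUnit_of_isUnit_norm {R S : Type*} [CommRing R] [CommRing S] [Algebra R S]
    [Module.Finite R S] [Module.Free R S] {x : S} (hx : IsUnit (Algebra.norm R x)) : IsUnit x := by
  have h := ((Algebra.lmul R S x).isUnit_iff_isUnit_det).2 hx
  obtain ⟨y, hy⟩ := ((Module.End.isUnit_iff _).1 h).2 1
  exact IsUnit.of_mul_eq_one y hy

/-- Coordinates on the points of `T_{L/k}` with respect to a basis of `L` over `k`. -/
def pointCoords (R : Type u) [CommRing R] [Algebra k R] (y : R ⊗[k] L) :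
    Fin (Module.finrank k L) → R :=
  fun j => ((Module.finBasis k L).baseChange R).repr y j

lemma sum_pointCoords (R : Type u) [CommRing R] [Algebra k R] (y : R ⊗[k] L) :
    ∑ j, pointCoords R y j ⊗ₜ[k] Module.finBasis k L j = y := by
  conv_rhs => rw [← ((Module.finBasis k L).baseChange R).sum_repr y]
  refine Finset.sum_congr rfl fun j _ => ?_
  rw [Module.Basis.baseChange_apply, TensorProduct.smul_tmul', smul_eq_mul, mul_one]
  rfl

variable (k L) in
/-- The generic element of `L`, whose coordinates are indeterminates. -/
def genericElement : MvPolynomial (Fin (Module.finrank k L)) k ⊗[k] L :=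
  ∑ j, (MvPolynomial.X j) ⊗ₜ[k] Module.finBasis k L j

lemma map_genericElement {R : Type u} [CommRing R] [Algebra k R]
    (φ : MvPolynomial (Fin (Module.finrank k L)) k →ₐ[k] R) :
    Algebra.TensorProduct.map φ (AlgHom.id k L) (genericElement k L) =
      ∑ j, φ (MvPolynomial.X j) ⊗ₜ[k] Module.finBasis k L j := by
  rw [genericElement, map_sum]
  exact Finset.sum_congr rfl fun j _ => Algebra.TensorProduct.map_tmul _ _ _ _

variable (k L) in
/-- The universal point of the torus: the torus is the affine scheme of finite type defined by the
equation `N(x) = 1` in the coordinates. -/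
lemma exists_universal_point : ∃ (A : Type u) (_ : CommRing A) (_ : Algebra k A)
    (π : MvPolynomial (Fin (Module.finrank k L)) k →ₐ[k] A) (ξ : torusPoints k L A),
    Function.Surjective π ∧ ((ξ : (A ⊗[k] L)ˣ) : A ⊗[k] L) =
      Algebra.TensorProduct.map π (AlgHom.id k L) (genericElement k L) ∧
    ∀ (R : Type u) [CommRing R] [Algebra k R]
      (φ : MvPolynomial (Fin (Module.finrank k L)) k →ₐ[k] R),
      φ (Algebra.norm _ (genericElement k L)) = 1 → ∃ ψ : A →ₐ[k] R, ψ.comp π = φ := by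
  let I : Ideal (MvPolynomial (Fin (Module.finrank k L)) k) :=
    Ideal.span {Algebra.norm _ (genericElement k L) - 1}
  let π := Ideal.Quotient.mkₐ k I
  have h1 : π (Algebra.norm _ (genericElement k L)) = 1 := by
    rw [← sub_eq_zero, ← map_one π, ← map_sub]
    exact Ideal.Quotient.eq_zero_iff_mem.2 (Ideal.mem_span_singleton_self _)
  have h2 := norm_map k L π (genericElement k L)
  rw [h1] at h2
  have hunit := isUnit_of_isUnit_norm (h2 ▸ isUnit_one)
  refine ⟨_, inferInstance, inferInstance, π, ⟨hunit.unit, MonoidHom.mem_ker.2 (Units.ext h2)⟩,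
    Ideal.Quotient.mkₐ_surjective k I, rfl, fun R _ _ φ hφ => ⟨Ideal.Quotient.liftₐ I φ ?_, ?_⟩⟩
  · intro a ha
    obtain ⟨d, rfl⟩ := Ideal.mem_span_singleton'.1 ha
    rw [map_mul, map_sub, map_one, hφ, sub_self, mul_zero]
  · exact Ideal.Quotient.liftₐ_comp I φ _

/-- Every character is given, on the points over every `k`-algebra, by one polynomial in the
coordinates: the value of the character at the universal point. -/
theorem TorusCharacter.exists_polynomial (χ : TorusCharacter k L) :
    ∃ Q : MvPolynomial (Fin (Module.finrank k L)) k, ∀ (R : Type u) [CommRing R] [Algebra k R]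
      (x : torusPoints k L R),
      ((χ.app R x : Rˣ) : R) =
        MvPolynomial.aeval (pointCoords R ((x : (R ⊗[k] L)ˣ) : R ⊗[k] L)) Q := by
  obtain ⟨A, _, _, π, ξ, hπ, hξ, hA⟩ := exists_universal_point k L
  obtain ⟨Q, hQ⟩ := hπ ((χ.app A ξ : Aˣ) : A)
  refine ⟨Q, fun R _ _ x => ?_⟩
  have hmap : Algebra.TensorProduct.map (MvPolynomial.aeval (pointCoords R
      ((x : (R ⊗[k] L)ˣ) : R ⊗[k] L))) (AlgHom.id k L) (genericElement k L) =
      ((x : (R ⊗[k] L)ˣ) : R ⊗[k] L) := by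
    rw [map_genericElement]
    conv_rhs => rw [← sum_pointCoords R ((x : (R ⊗[k] L)ˣ) : R ⊗[k] L)]
    exact Finset.sum_congr rfl fun j _ => by rw [MvPolynomial.aeval_X]
  have hx : Algebra.norm R ((x : (R ⊗[k] L)ˣ) : R ⊗[k] L) = 1 :=
    congrArg Units.val (MonoidHom.mem_ker.1 x.2)
  obtain ⟨ψ, hψ⟩ := hA R (MvPolynomial.aeval (pointCoords R ((x : (R ⊗[k] L)ˣ) : R ⊗[k] L)))
    (by rw [← norm_map, hmap, hx])
  have hψξ : torusMap k L ψ ξ = x := by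
    refine Subtype.ext (Units.ext ?_)
    change Algebra.TensorProduct.map ψ (AlgHom.id k L) ((ξ : (A ⊗[k] L)ˣ) : A ⊗[k] L) = _
    rw [hξ, map_genericElement, map_sum, ← hmap, map_genericElement, ← hψ]
    exact Finset.sum_congr rfl fun j _ => Algebra.TensorProduct.map_tmul _ _ _ _
  have h1 := congrArg Units.val (χ.naturality ψ ξ)
  rw [hψξ] at h1
  rw [h1, ← hψ]
  change ψ ((χ.app A ξ : Aˣ) : A) = ψ (π Q)
  rw [hQ]

/-- A polynomial is bounded on bounded sets. -/
lemma exists_aeval_le {C : Type*} [Field C] [Algebra k C] (v : Valuation C ℤᵐ⁰) {n : ℕ}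
    (Q : MvPolynomial (Fin n) k) (M : ℤᵐ⁰) :
    ∃ M' : ℤᵐ⁰, ∀ c : Fin n → C, (∀ j, v (c j) ≤ M) → v (MvPolynomial.aeval c Q) ≤ M' := by
  induction Q using MvPolynomial.induction_on with
  | C a => exact ⟨v (algebraMap k C a), fun c _ => by simp⟩
  | add p q hp hq =>
    obtain ⟨Mp, hp⟩ := hp
    obtain ⟨Mq, hq⟩ := hq
    exact ⟨max Mp Mq, fun c hc => by
      rw [map_add]
      exact (v.map_add _ _).trans (max_le_max (hp c hc) (hq c hc))⟩
  | mul_X p j hp =>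
    obtain ⟨Mp, hp⟩ := hp
    exact ⟨Mp * M, fun c hc => by
      rw [map_mul, map_mul, MvPolynomial.aeval_X]
      exact mul_le_mul' (hp c hc) (hc j)⟩

end Characters

section Etale

variable {k : Type u} [Field k] {r : ℕ} {K : Fin r → Type u} [∀ i, Field (K i)]
  [∀ i, Algebra k (K i)]

lemma factorMap_map {R S : Type u} [CommRing R] [Algebra k R] [CommRing S] [Algebra k S]
    (f : R →ₐ[k] S) (i : Fin r) (y : R ⊗[k] (∀ i, K i)) :
    factorMap K S i (Algebra.TensorProduct.map f (AlgHom.id k (∀ i, K i)) y) =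
      Algebra.TensorProduct.map f (AlgHom.id k (K i)) (factorMap K R i y) := by
  induction y using TensorProduct.induction_on with
  | zero => simp
  | tmul a l => simp [factorMap]
  | add y z hy hz => simp only [map_add, hy, hz]

variable [∀ i, FiniteDimensional k (K i)]

variable (k K) in
/-- The norm `N_{K_i/k}`, as a character of the multinorm-one torus. -/
def factorCharacter (i : Fin r) : TorusCharacter k (∀ i, K i) where
  app R _ _ := (Units.map (factorNorm K R i)).comp (torusPoints k (∀ i, K i) R).subtype
  naturality {R S} _ _ _ _ f x := by
    refine Units.ext ?_
    change Algebra.norm S (factorMap K S i (Algebra.TensorProduct.map f (AlgHom.id k _) _)) =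
      f (Algebra.norm R (factorMap K R i _))
    rw [← norm_map]
    congr 1
    exact factorMap_map f i _

lemma ord_factorCharacter (i : Fin r) (x : LocalTorus k K) (v : Place k) :
    v.ord ((factorCharacter k K i).local x v) =
      v.ord (Units.map (factorNorm K v.Completion i) (localTorusInclusion k K x v)) := rfl

lemma local_torusRational (χ : TorusCharacter k (∀ i, K i)) {x : LocalTorus k K}
    (hx : x ∈ torusRational k K) : ∃ a : kˣ, χ.local x = baseDiagonal k a := by
  obtain ⟨y, rfl⟩ := hx
  refine ⟨χ.app k y, funext fun v => ?_⟩
  exact χ.naturality (Algebra.ofId k v.Completion) y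

lemma Place.ord_pow (v : Place k) (x : v.Completionˣ) (m : ℕ) : v.ord (x ^ m) = m * v.ord x := by
  induction m with
  | zero => simp [Place.ord_one]
  | succ m ih => rw [pow_succ, Place.ord_mul, ih]; push_cast; ring

variable [∀ i, Algebra.IsSeparable k (K i)]

/-- Characters map the maximal compact subgroup to unit ideles: a character takes bounded values on
the powers of an element of this subgroup. -/
theorem ord_local_of_mem_torusUnits (χ : TorusCharacter k (∀ i, K i)) {x : LocalTorus k K}
    (hx : x ∈ torusUnits k K) (v : Place k) : v.ord (χ.local x v) = 0 := by
  obtain ⟨Q, hQ⟩ := χ.exists_polynomial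
  obtain ⟨M, hM⟩ := exists_coords_bound_completion (K := K) v
  obtain ⟨M', hM'⟩ := exists_aeval_le (Valued.v : Valuation v.Completion ℤᵐ⁰) Q M
  have hbound : ∀ y ∈ torusUnits k K, -v.ord (χ.local y v) ≤ WithZero.log M' := by
    intro y hy
    have h1 : ∀ i (w : Place (K i)), w.ord (component k K i (localTorusInclusion k K y) w) = 0 :=
      fun i w => Subgroup.mem_iInf.1 (Subgroup.mem_comap.1 hy) i w
    have h2 : Valued.v (χ.local y v : v.Completion) ≤ M' := by
      have h3 : (χ.local y v : v.Completion) = _ := hQ v.Completion (y v)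
      rw [h3]
      exact hM' _ (hM (localTorusInclusion k K y) fun i w _ => (h1 i w).ge)
    rw [Place.valued_eq_exp_ord] at h2
    have h0 : M' ≠ 0 := fun h => by
      rw [h] at h2
      exact WithZero.exp_ne_zero (le_zero_iff.1 h2)
    rwa [← WithZero.exp_log h0, WithZero.exp_le_exp] at h2
  have hnn : ∀ y ∈ torusUnits k K, 0 ≤ v.ord (χ.local y v) := by
    intro y hy
    by_contra hneg
    have h1 := hbound (y ^ ((WithZero.log M').toNat + 1)) (pow_mem hy _)
    rw [map_pow, Pi.pow_apply, Place.ord_pow] at h1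
    have h2 := Int.self_le_toNat (WithZero.log M')
    push_cast at h1
    nlinarith
  have h1 := hnn x hx
  have h2 := hnn x⁻¹ (inv_mem hx)
  rw [map_inv, Pi.inv_apply, Place.ord_inv] at h2
  omega

end Etale

/-! ### Separating elements -/

section SeparatingElement

/-- A finitely generated field of transcendence degree one over a finite field has a separating
element. -/
theorem exists_algebra_ratFunc (E : Type u) [Field E] [Finite E] (k : Type u) [Field k]
    [Algebra E k] [Algebra.EssFiniteType E k] (h : Algebra.trdeg E k = 1) :
    ∃ _ : Algebra (RatFunc E) k, FiniteDimensional (RatFunc E) k ∧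
      Algebra.IsSeparable (RatFunc E) k := by
  obtain ⟨s, hs, hsep⟩ :=
    exists_isTranscendenceBasis_and_isSeparable_of_perfectField (k := E) (K := k)
  have hcard : s.card = 1 := by
    have h1 := hs.cardinalMk_eq_trdeg
    rw [h, Cardinal.mk_coe_finset] at h1
    exact_mod_cast h1
  obtain ⟨t, rfl⟩ := Finset.card_eq_one.1 hcard
  have ht : Transcendental E t :=
    hs.1.transcendental (⟨t, Finset.mem_singleton_self t⟩ : ({t} : Finset k))
  rw [Finset.coe_singleton] at hsep
  have hfin : FiniteDimensional (IntermediateField.adjoin E {t}) k := by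
    have : Algebra.EssFiniteType (IntermediateField.adjoin E {t}) k :=
      Algebra.EssFiniteType.of_comp E _ _
    obtain ⟨S, hS⟩ := IntermediateField.fg_top (IntermediateField.adjoin E {t}) k
    have h1 : FiniteDimensional (IntermediateField.adjoin E {t})
        (IntermediateField.adjoin (IntermediateField.adjoin E {t}) (S : Set k)) :=
      IntermediateField.finiteDimensional_adjoin fun x _ => Algebra.IsIntegral.isIntegral x
    rw [hS] at h1
    exact IntermediateField.topEquiv.toLinearEquiv.finiteDimensional
  let e := RatFunc.algEquivOfTranscendental t ht
  let φ : RatFunc E →+* k := (algebraMap (IntermediateField.adjoin E {t}) k).comp e.toRingHom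
  refine ⟨φ.toAlgebra, ?_, ?_⟩
  · let := φ.toAlgebra
    exact Module.Finite.of_equiv_equiv e.symm.toRingEquiv (RingEquiv.refl k) (by
      ext x
      change φ (e.symm x) = algebraMap _ k x
      exact congrArg (algebraMap (IntermediateField.adjoin E {t}) k) (e.apply_symm_apply x))
  · let := φ.toAlgebra
    exact Algebra.IsSeparable.of_equiv_equiv e.symm.toRingEquiv (RingEquiv.refl k) (by
      ext x
      change φ (e.symm x) = algebraMap _ k x
      exact congrArg (algebraMap (IntermediateField.adjoin E {t}) k) (e.apply_symm_apply x))

/-- Every global function field is a finite separable extension of a field of rational functions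
over a finite field. -/
theorem exists_separable_ratFunc (F : Type*) [Field F] [Finite F] (k : Type u) [Field k]
    [Algebra (RatFunc F) k] [FunctionField F k] :
    ∃ (E : Type u) (_ : Field E) (_ : Finite E) (_ : Algebra (RatFunc E) k),
      FiniteDimensional (RatFunc E) k ∧ Algebra.IsSeparable (RatFunc E) k := by
  let : Algebra F k := ((algebraMap (RatFunc F) k).comp (algebraMap F (RatFunc F))).toAlgebra
  have : IsScalarTower F (RatFunc F) k := IsScalarTower.of_algebraMap_eq fun _ => rfl
  have : Module.Finite (RatFunc F) k := ‹FunctionField F k›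
  have h1 : Algebra.EssFiniteType F (RatFunc F) := by
    have := Algebra.EssFiniteType.of_isLocalization (S := RatFunc F)
      (nonZeroDivisors (Polynomial F))
    exact Algebra.EssFiniteType.comp F (Polynomial F) (RatFunc F)
  have h2 : Algebra.EssFiniteType F k := Algebra.EssFiniteType.comp F (RatFunc F) k
  -- the image of `F` in `k` lies in the universe of `k`
  let E := (algebraMap F k).fieldRange
  let φ : F →+* E := (algebraMap F k).rangeRestrictField
  have hφ : Function.Surjective φ := fun ⟨_, x, hx⟩ => ⟨x, Subtype.ext hx⟩
  let : Algebra F E := φ.toAlgebra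
  have : IsScalarTower F E k := IsScalarTower.of_algebraMap_eq fun _ => rfl
  have hE : Finite E := Finite.of_surjective φ hφ
  have h3 : Algebra.EssFiniteType E k := Algebra.EssFiniteType.of_comp F E k
  refine ⟨E, inferInstance, hE, exists_algebra_ratFunc E k ?_⟩
  have : Algebra.IsAlgebraic F E := (Algebra.isIntegral_of_surjective hφ).isAlgebraic
  have h4 := lift_trdeg_add_eq F E k
  have h5 := lift_trdeg_add_eq F (RatFunc F) k
  have h6 := trdeg_add_eq F (Polynomial F) (A := RatFunc F)
  have h7 : Algebra.IsAlgebraic (Polynomial F) (RatFunc F) :=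
    IsLocalization.isAlgebraic _ (nonZeroDivisors (Polynomial F))
  rw [Polynomial.trdeg_of_isDomain, trdeg_eq_zero, add_zero] at h6
  rw [← h6, trdeg_eq_zero (R := RatFunc F)] at h5
  rw [trdeg_eq_zero (R := F) (A := E)] at h4
  simp only [Cardinal.lift_id, zero_add] at h4
  rw [← h4] at h5
  simpa using h5.symm

end SeparatingElement

/-! ### Comparison of indices in commutative groups -/

section Index

variable {G G' M M' : Type*} [CommGroup G] [CommGroup G'] [CommGroup M] [CommGroup M']

/-- The computation of indices behind the class number formula. Both sides are the index of
`δ (ker ν₀) U` in the group `A ∩ ν⁻¹ B`, computed by means of the two intermediate groups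
`(A ∩ ker ν) U` and `(δ G ∩ A ∩ ν⁻¹ B) U`. -/
theorem relIndex_mul_relIndex_eq (δ : G →* M) (δ' : G' →* M') (ν₀ : G →* G') (ν : M →* M')
    (hδ' : Function.Injective δ') (hν : ∀ g, ν (δ g) = δ' (ν₀ g)) {A U : Subgroup M}
    {B : Subgroup M'} (hUA : U ≤ A) (hUB : U ≤ B.comap ν) (hδA : δ.range ≤ A) :
    ((δ.range ⊓ ν.ker) ⊔ (U ⊓ ν.ker)).relIndex (A ⊓ ν.ker) *
        (U.map ν).relIndex (B ⊓ A.map ν) =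
      ((δ.range ⊓ B.comap ν) ⊔ U).relIndex (A ⊓ B.comap ν) *
        ((U.comap δ).map ν₀).relIndex (B.comap δ' ⊓ ν₀.range) := by
  have hker : ν.ker ≤ B.comap ν := by
    intro x hx
    rw [Subgroup.mem_comap, MonoidHom.mem_ker.1 hx]
    exact one_mem B
  -- the first intermediate group
  have hc : (U.map ν).relIndex (B ⊓ A.map ν) =
      ((A ⊓ ν.ker) ⊔ U).relIndex (A ⊓ B.comap ν) := by
    have h1 : B ⊓ A.map ν = (A ⊓ B.comap ν).map ν := by
      ext y
      constructor
      · rintro ⟨hy, x, hx, rfl⟩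
        exact ⟨x, ⟨hx, hy⟩, rfl⟩
      · rintro ⟨x, ⟨hx, hxB⟩, rfl⟩
        exact ⟨hxB, x, hx, rfl⟩
    rw [h1, ← Subgroup.relIndex_comap, Subgroup.comap_map_eq,
      ← Subgroup.inf_relIndex_right (U ⊔ ν.ker)]
    congr 1
    rw [sup_comm (A ⊓ ν.ker), sup_inf_assoc_of_le _ (le_inf hUA hUB)]
    congr 1
    rw [inf_comm, inf_assoc, inf_eq_right.2 hker]
  have hh : ((δ.range ⊓ ν.ker) ⊔ (U ⊓ ν.ker)).relIndex (A ⊓ ν.ker) =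
      ((δ.range ⊓ ν.ker) ⊔ U).relIndex ((A ⊓ ν.ker) ⊔ U) := by
    have h1 : (A ⊓ ν.ker) ⊔ U = (A ⊓ ν.ker) ⊔ ((δ.range ⊓ ν.ker) ⊔ U) := by
      rw [← sup_assoc, sup_eq_left.2 (inf_le_inf_right _ hδA)]
    rw [h1, Subgroup.relIndex_sup_right, ← Subgroup.inf_relIndex_right (_ ⊔ U),
      sup_inf_assoc_of_le _ (inf_le_inf_right _ hδA), ← inf_assoc, inf_eq_left.2 hUA]
  -- the second intermediate group
  have hb : ((U.comap δ).map ν₀).relIndex (B.comap δ' ⊓ ν₀.range) =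
      ((δ.range ⊓ ν.ker) ⊔ U).relIndex ((δ.range ⊓ B.comap ν) ⊔ U) := by
    have h1 : B.comap δ' ⊓ ν₀.range = ((B.comap δ').comap ν₀).map ν₀ := by
      rw [Subgroup.map_comap_eq, inf_comm]
    have h2 : (δ.range ⊓ B.comap ν) ⊔ U =
        (δ.range ⊓ B.comap ν) ⊔ ((δ.range ⊓ ν.ker) ⊔ U) := by
      rw [← sup_assoc, sup_eq_left.2 (inf_le_inf_left _ hker)]
    have h3 : δ.range ⊓ B.comap ν = ((B.comap δ').comap ν₀).map δ := by
      ext x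
      constructor
      · rintro ⟨⟨g, rfl⟩, hg⟩
        refine ⟨g, ?_, rfl⟩
        change δ' (ν₀ g) ∈ B
        rw [← hν]
        exact hg
      · rintro ⟨g, hg, rfl⟩
        refine ⟨⟨g, rfl⟩, ?_⟩
        change ν (δ g) ∈ B
        rw [hν]
        exact hg
    have h4 : ((δ.range ⊓ ν.ker) ⊔ U).comap δ = (U.comap δ) ⊔ ν₀.ker := by
      have hmem : ∀ g, δ g ∈ ν.ker ↔ g ∈ ν₀.ker := fun g => by
        rw [MonoidHom.mem_ker, MonoidHom.mem_ker, hν, ← map_one δ', hδ'.eq_iff]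
      refine le_antisymm (fun g hg => ?_) (sup_le (Subgroup.comap_mono le_sup_right) fun g hg =>
        (le_sup_left : _ ≤ (δ.range ⊓ ν.ker) ⊔ U) ⟨⟨g, rfl⟩, (hmem g).2 hg⟩)
      obtain ⟨_, ⟨⟨g', rfl⟩, hg'⟩, z, hz, h⟩ := Subgroup.mem_sup.1 (Subgroup.mem_comap.1 hg)
      rw [sup_comm]
      refine Subgroup.mem_sup.2 ⟨g', (hmem g').1 hg', g'⁻¹ * g, ?_, mul_inv_cancel_left _ _⟩
      rw [Subgroup.mem_comap, map_mul, ← h, map_inv, inv_mul_cancel_left]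
      exact hz
    rw [h2, Subgroup.relIndex_sup_right, h3, ← Subgroup.relIndex_comap, h4, h1,
      ← Subgroup.relIndex_comap, Subgroup.comap_map_eq]
  rw [hc, hh, hb, mul_comm (((δ.range ⊓ B.comap ν) ⊔ U).relIndex _),
    Subgroup.relIndex_mul_relIndex, Subgroup.relIndex_mul_relIndex]
  · exact sup_le_sup_right (inf_le_inf_left _ hker) _
  · exact sup_le (inf_le_inf_right _ hδA) (le_inf hUA hUB)
  · exact sup_le_sup_right (inf_le_inf_right _ hδA) _
  · exact sup_le (inf_le_inf_left _ hker) (le_inf hUA hUB)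

end Index

/-! ### Ideles, divisors and diagonal embeddings -/

section Ideles

variable {k : Type u} [Field k] {r : ℕ} {K : Fin r → Type u} [∀ i, Field (K i)]
  [∀ i, Algebra k (K i)] [∀ i, FiniteDimensional k (K i)]

/-- The commutative group structure that extends the group structure of the product. -/
instance : CommGroup (LocalUnitsEtale k K) where
  toGroup := Pi.group
  mul_comm x y := funext fun v => Units.ext (mul_comm (x v : v.Completion ⊗[k] ∀ i, K i) (y v))

lemma mem_unitIdelesEtale {x : LocalUnitsEtale k K} :
    x ∈ unitIdelesEtale k K ↔ ∀ i (w : Place (K i)), w.ord (component k K i x w) = 0 := by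
  simp only [unitIdelesEtale, Subgroup.mem_iInf, Subgroup.mem_comap]
  rfl

lemma mem_idelesEtale {x : LocalUnitsEtale k K} :
    x ∈ idelesEtale k K ↔ ∀ i, component k K i x ∈ ideles (K i) := by
  simp only [idelesEtale, Subgroup.mem_iInf, Subgroup.mem_comap]

lemma mem_idelesZeroEtale {x : LocalUnitsEtale k K} :
    x ∈ idelesZeroEtale k K ↔ ∀ i, component k K i x ∈ idelesZero (K i) := by
  simp only [idelesZeroEtale, Subgroup.mem_iInf, Subgroup.mem_comap]

variable (k K) in
lemma unitIdelesEtale_le : unitIdelesEtale k K ≤ idelesZeroEtale k K := by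
  intro x hx
  rw [mem_unitIdelesEtale] at hx
  refine mem_idelesZeroEtale.2 fun i => ⟨?_, ?_⟩
  · change {w : Place (K i) | w.ord (component k K i x w) ≠ 0}.Finite
    simp [hx]
  · simp [degree, hx]

lemma degree_eq_zero_iff {F : Type u} [Field F] [IsGlobal F] {x : LocalUnits F}
    (hx : x ∈ ideles F) : degree x = 0 ↔
      ∑ᶠ w : Place F, w.weight * (w.ord (x w) : ℝ) = 0 :=
  finsum_deg_eq_zero_iff (n := fun w => w.ord (x w)) hx

lemma mem_idelesZero_baseDiagonal [IsGlobal k] (a : kˣ) : baseDiagonal k a ∈ idelesZero k := by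
  constructor
  · change {v : Place k | v.ord (baseDiagonal k a v) ≠ 0}.Finite
    simp_rw [ord_baseDiagonal]
    exact IsGlobal.finite_support a
  · rw [degree]
    simp_rw [ord_baseDiagonal]
    exact finsum_deg_ordField a

variable (k K) in
lemma diagonal_range_le [∀ i, IsGlobal (K i)] : (diagonal k K).range ≤ idelesZeroEtale k K := by
  rintro _ ⟨f, rfl⟩
  refine mem_idelesZeroEtale.2 fun i => ⟨?_, ?_⟩
  · change {w : Place (K i) | w.ord (component k K i (diagonal k K f) w) ≠ 0}.Finite
    simp_rw [ord_component_diagonal]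
    exact IsGlobal.finite_support _
  · rw [degree]
    simp_rw [ord_component_diagonal]
    exact finsum_deg_ordField _

variable (k K) in
lemma comap_diagonal_unitIdelesEtale [∀ i, IsGlobal (K i)] :
    (unitIdelesEtale k K).comap (diagonal k K) = constantUnitsEtale K := by
  ext f
  rw [Subgroup.mem_comap, mem_unitIdelesEtale, constantUnitsEtale, Subgroup.mem_iInf]
  refine forall_congr' fun i => ?_
  rw [Subgroup.mem_comap, mem_units_constants_iff]
  simp_rw [ord_component_diagonal]

variable (k) in
lemma comap_baseDiagonal_unitIdeles [IsGlobal k] :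
    (unitIdeles k).comap (baseDiagonal k) = (constants k).toSubmonoid.units := by
  ext a
  rw [mem_units_constants_iff, Subgroup.mem_comap]
  change (∀ v : Place k, v.ord (baseDiagonal k a v) = 0) ↔ _
  simp_rw [ord_baseDiagonal]

variable (k) in
lemma baseDiagonal_injective [IsGlobal k] : Function.Injective (baseDiagonal k) := by
  intro a b h
  obtain ⟨v⟩ := IsGlobal.nonempty_place (K := k)
  exact Units.ext ((algebraMap k v.Completion).injective (congrArg Units.val (congrFun h v)))

variable [∀ i, Algebra.IsSeparable k (K i)] [IsGlobal k]

/-- The divisor of the norm of an idele. -/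
lemma ord_localNorm_eq (x : LocalUnitsEtale k K) (v : Place k) :
    v.ord (localNorm k K x v) = ∑ i, ∑ᶠ (w : Place (K i)) (_ : w.under k = v),
      residueDegree k w * w.ord (component k K i x w) := by
  rw [ord_localNorm]
  exact Finset.sum_congr rfl fun i _ => ord_factorNorm x v i

variable (k K) in
lemma unitIdelesEtale_le_comap : unitIdelesEtale k K ≤ (unitIdeles k).comap (localNorm k K) := by
  intro x hx v
  rw [mem_unitIdelesEtale] at hx
  rw [ord_localNorm_eq]
  exact Finset.sum_eq_zero fun i _ => finsum_eq_zero_of_forall_eq_zero fun w =>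
    by simp [hx i w]

end Ideles

section Divisors

variable {k : Type u} [Field k] {r : ℕ} {K : Fin r → Type u} [∀ i, Field (K i)]
  [∀ i, Algebra k (K i)] [∀ i, FiniteDimensional k (K i)]

lemma mem_divisorsZero [∀ i, IsGlobal (K i)] {D : Divisors K} :
    D ∈ divisorsZero K ↔ ∀ i, ∑ᶠ w : Place (K i), w.deg * D i w = 0 := by
  rw [divisorsZero, AddSubgroup.mem_iInf]
  refine forall_congr' fun i => ?_
  rw [AddMonoidHom.mem_ker]
  change (D i).sum (fun w n => n * w.deg) = 0 ↔ _
  rw [finsum_eq_sum_of_support_subset _ (s := (D i).support)]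
  · rw [Finsupp.sum, Finset.sum_congr rfl fun w _ => mul_comm _ _]
  · intro w hw
    simp only [Finset.mem_coe, Finsupp.mem_support_iff]
    intro h0
    exact hw (by simp [h0])

lemma divisorNorm_apply [∀ i, Algebra.IsSeparable k (K i)] (D : Divisors K) (v : Place k) :
    divisorNorm k K D v = ∑ i, ∑ᶠ (w : Place (K i)) (_ : w.under k = v),
      residueDegree k w * D i w := by
  classical
  rw [divisorNorm, AddMonoidHom.finsetSum_apply, Finsupp.finsetSum_apply]
  refine Finset.sum_congr rfl fun i _ => ?_
  change ((D i).sum fun w n => Finsupp.single (w.under k) (n * residueDegree k w)) v = _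
  rw [Finsupp.sum, Finsupp.finsetSum_apply]
  simp_rw [Finsupp.single_apply]
  rw [← Finset.sum_filter]
  symm
  simp_rw [mul_comm (residueDegree k _)]
  refine finsum_mem_eq_sum_of_inter_support_eq (s := {w : Place (K i) | w.under k = v}) _ ?_
  ext w
  simp only [Set.mem_inter_iff, Set.mem_ofPred_eq, Function.mem_support, Finset.coe_filter,
    Finsupp.mem_support_iff]
  constructor
  · rintro ⟨h1, h2⟩
    exact ⟨⟨fun h0 => h2 (by simp [h0]), h1⟩, h2⟩
  · rintro ⟨⟨-, h1⟩, h2⟩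
    exact ⟨h1, h2⟩

variable (k K) in
/-- The divisor of an idele of degree zero. -/
def idelesZeroDivisor : idelesZeroEtale k K →* Multiplicative (Divisors K) where
  toFun x := Multiplicative.ofAdd fun i => Finsupp.ofSupportFinite
    (fun w => w.ord (component k K i x w)) (mem_idelesZeroEtale.1 x.2 i).1
  map_one' := by
    refine congrArg Multiplicative.ofAdd (funext fun i => Finsupp.ext fun w => ?_)
    change w.ord (component k K i 1 w) = 0
    rw [map_one, Pi.one_apply, Place.ord_one]
  map_mul' x y := by
    refine congrArg Multiplicative.ofAdd (funext fun i => Finsupp.ext fun w => ?_)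
    change w.ord (component k K i (x * y : LocalUnitsEtale k K) w) = _
    rw [map_mul, Pi.mul_apply, Place.ord_mul]
    rfl

lemma idelesZeroDivisor_apply (x : idelesZeroEtale k K) (i : Fin r) (w : Place (K i)) :
    (idelesZeroDivisor k K x).toAdd i w = w.ord (component k K i x w) := rfl

variable [∀ i, Algebra.IsSeparable k (K i)] [IsGlobal k] [∀ i, IsGlobal (K i)]

variable (k K) in
/-- The index of the principal divisors of norm one, in terms of ideles. -/
theorem relIndex_principalDivisorsNormOne :
    (principalDivisorsNormOne k K).relIndex (divisorsNormOne k K) =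
      (((diagonal k K).range ⊓ (unitIdeles k).comap (localNorm k K)) ⊔
        unitIdelesEtale k K).relIndex
        (idelesZeroEtale k K ⊓ (unitIdeles k).comap (localNorm k K)) := by
  set A := idelesZeroEtale k K with hA
  set J := A ⊓ (unitIdeles k).comap (localNorm k K) with hJ
  have hI : AddSubgroup.toSubgroup (divisorsNormOne k K) =
      (J.subgroupOf A).map (idelesZeroDivisor k K) := by
    ext D
    constructor
    · rintro ⟨hD0, hDN⟩
      obtain ⟨x, hx⟩ := exists_ord_component_eq k K (fun i => D.toAdd i)
      have hxA : x ∈ A := by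
        refine mem_idelesZeroEtale.2 fun i => ⟨?_, ?_⟩
        · change {w : Place (K i) | w.ord (component k K i x w) ≠ 0}.Finite
          simp_rw [hx]
          exact (D.toAdd i).hasFiniteSupport
        · rw [degree]
          simp_rw [hx]
          exact mem_divisorsZero.1 hD0 i
      refine ⟨⟨x, hxA⟩, ⟨hxA, fun v => ?_⟩, ?_⟩
      · change v.ord (localNorm k K x v) = 0
        rw [ord_localNorm_eq]
        simp_rw [hx]
        rw [← divisorNorm_apply]
        exact DFunLike.congr_fun (AddMonoidHom.mem_ker.1 hDN) v
      · exact congrArg Multiplicative.ofAdd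
          (funext fun i => Finsupp.ext fun w => hx i w)
    · rintro ⟨x, ⟨hxA, hxB⟩, rfl⟩
      refine ⟨mem_divisorsZero.2 fun i => (mem_idelesZeroEtale.1 x.2 i).2, ?_⟩
      refine AddMonoidHom.mem_ker.2 (Finsupp.ext fun v => ?_)
      have h1 : v.ord (localNorm k K x v) = 0 := hxB v
      rw [ord_localNorm_eq] at h1
      exact (divisorNorm_apply _ v).trans h1
  have hP : (AddSubgroup.toSubgroup (principalDivisors K)).comap (idelesZeroDivisor k K) =
      ((diagonal k K).range ⊔ unitIdelesEtale k K).subgroupOf A := by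
    ext x
    rw [Subgroup.mem_subgroupOf]
    constructor
    · intro hx
      choose f hf using hx
      let g : (∀ i, K i)ˣ := MulEquiv.piUnits.symm f
      refine Subgroup.mem_sup.2 ⟨diagonal k K g, ⟨g, rfl⟩, (diagonal k K g)⁻¹ * x, ?_,
        mul_inv_cancel_left _ _⟩
      refine mem_unitIdelesEtale.2 fun i w => ?_
      rw [map_mul, map_inv, Pi.mul_apply, Pi.inv_apply, Place.ord_mul, Place.ord_inv,
        ord_component_diagonal, ← idelesZeroDivisor_apply, hf]
      exact neg_add_cancel _
    · intro hx i
      obtain ⟨_, ⟨g, rfl⟩, y, hy, h⟩ := Subgroup.mem_sup.1 hx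
      refine ⟨Units.map (Pi.evalMonoidHom (fun i => K i) i) g, fun w => ?_⟩
      change w.ord (component k K i x w) = _
      rw [← h, map_mul, Pi.mul_apply, Place.ord_mul, ord_component_diagonal,
        mem_unitIdelesEtale.1 hy, add_zero]
  calc (principalDivisorsNormOne k K).relIndex (divisorsNormOne k K)
      = (principalDivisors K).relIndex (divisorsNormOne k K) := AddSubgroup.inf_relIndex_right _ _
    _ = (AddSubgroup.toSubgroup (principalDivisors K)).relIndex
          (AddSubgroup.toSubgroup (divisorsNormOne k K)) := rfl
    _ = ((diagonal k K).range ⊔ unitIdelesEtale k K).relIndex J := by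
        rw [hI, ← Subgroup.relIndex_comap, hP, Subgroup.relIndex_subgroupOf inf_le_left]
    _ = _ := by
        rw [← Subgroup.inf_relIndex_right]
        congr 1
        rw [sup_comm, sup_inf_assoc_of_le _ (le_inf (unitIdelesEtale_le k K)
          (unitIdelesEtale_le_comap k K)), sup_comm, ← inf_assoc,
          inf_eq_left.2 (diagonal_range_le k K)]

/-- Finiteness of the group of divisor classes of degree zero. -/
theorem relIndex_principalDivisors_ne_zero
    (h : ∀ i, ∃ S : Set (Place (K i) →₀ ℤ), S.Finite ∧ ∀ D : Place (K i) →₀ ℤ,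
      weightedDegree (K i) D = 0 → ∃ E ∈ S, ∃ f : (K i)ˣ, D = E + divisor f) :
    (principalDivisors K).relIndex (divisorsZero K) ≠ 0 := by
  choose S hS hSD using h
  have hrep : ∀ D : divisorsZero K, ∃ E ∈ Set.univ.pi S, (D : Divisors K) - E ∈
      principalDivisors K := by
    intro D
    have h0 : ∀ i, weightedDegree (K i) ((D : Divisors K) i) = 0 := fun i => by
      rw [weightedDegree_eq]
      exact (finsum_deg_eq_zero_iff (n := fun w => (D : Divisors K) i w)
        ((D : Divisors K) i).hasFiniteSupport).1 (mem_divisorsZero.1 D.2 i)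
    choose E hE f hf using fun i => hSD i _ (h0 i)
    refine ⟨E, fun i _ => hE i, fun i => ⟨f i, fun w => ?_⟩⟩
    rw [Pi.sub_apply, hf i, add_sub_cancel_left]
    rfl
  choose E hE hED using hrep
  have hfin : Finite (Set.univ.pi S) := Set.Finite.pi hS
  have : Finite (divisorsZero K ⧸ (principalDivisors K).addSubgroupOf (divisorsZero K)) := by
    refine Finite.of_injective (β := Set.univ.pi S) (fun c => ⟨E c.out, hE _⟩) fun c d hcd => ?_
    have h1 : E c.out = E d.out := congrArg Subtype.val hcd
    rw [← c.out_eq', ← d.out_eq', QuotientAddGroup.eq, AddSubgroup.mem_addSubgroupOf]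
    have h2 := sub_mem (hED d.out) (hED c.out)
    rw [h1] at h2
    convert h2 using 1
    push_cast
    abel
  exact Nat.card_pos.ne'

end Divisors

/-! ### The class group of the torus -/

section Torus

variable {k : Type u} [Field k]

lemma mem_idelesZero_of_pow {x : LocalUnits k} {m : ℕ} (hm : 0 < m) (hx : x ^ m ∈ idelesZero k) :
    x ∈ idelesZero k := by
  have hord : ∀ v : Place k, v.ord ((x ^ m) v) = m * v.ord (x v) := fun v => v.ord_pow (x v) m
  obtain ⟨h1, h2⟩ := hx
  have hm' : (m : ℤ) ≠ 0 := by exact_mod_cast hm.ne'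
  have h3 : x ∈ ideles k := by
    change {v : Place k | v.ord ((x ^ m) v) ≠ 0}.Finite at h1
    refine h1.subset fun v hv => ?_
    change v.ord ((x ^ m) v) ≠ 0
    rw [hord]
    exact mul_ne_zero hm' hv
  refine ⟨h3, ?_⟩
  have h4 : degree (x ^ m) = m * degree x := by
    simp_rw [degree, hord]
    rw [mul_finsum]
    exact finsum_congr fun v => mul_left_comm _ _ _
  rw [h4] at h2
  exact (mul_eq_zero.1 h2).resolve_left hm'

variable {r : ℕ} {K : Fin r → Type u} [∀ i, Field (K i)]
  [∀ i, Algebra k (K i)]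

variable (k K) in
lemma localTorusInclusion_injective : Function.Injective (localTorusInclusion k K) :=
  fun _ _ h => funext fun v => Subtype.ext (congrFun h v)

variable (k K) in
lemma localTorusInclusion_range : (localTorusInclusion k K).range = (localNorm k K).ker := by
  ext x
  constructor
  · rintro ⟨y, rfl⟩
    exact MonoidHom.mem_ker.2 (funext fun v => MonoidHom.mem_ker.1 (y v).2)
  · intro hx
    exact ⟨fun v => ⟨x v, MonoidHom.mem_ker.2 (congrFun (MonoidHom.mem_ker.1 hx) v)⟩, rfl⟩

lemma localNorm_localTorusInclusion (x : LocalTorus k K) :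
    localNorm k K (localTorusInclusion k K x) = 1 :=
  funext fun v => MonoidHom.mem_ker.1 (x v).2

lemma map_ofId_eq {R L : Type u} [CommRing R] [Algebra k R] [CommRing L] [Algebra k L]
    (z : k ⊗[k] L) : Algebra.TensorProduct.map (Algebra.ofId k R) (AlgHom.id k L) z =
      1 ⊗ₜ Algebra.TensorProduct.lid k L z := by
  induction z using TensorProduct.induction_on with
  | zero => simp
  | tmul a l =>
    rw [Algebra.TensorProduct.map_tmul, Algebra.TensorProduct.lid_tmul, TensorProduct.tmul_smul,
      TensorProduct.smul_tmul', AlgHom.id_apply, Algebra.ofId_apply, Algebra.algebraMap_eq_smul_one]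
  | add y z hy hz => rw [map_add, map_add, hy, hz, TensorProduct.tmul_add]

variable [∀ i, FiniteDimensional k (K i)]

variable (k K) in
/-- The rational points of the torus are the local points that come from `L^×`. -/
lemma torusRational_eq [IsGlobal k] :
    torusRational k K = (diagonal k K).range.comap (localTorusInclusion k K) := by
  ext x
  constructor
  · rintro ⟨y, rfl⟩
    refine ⟨Units.map (Algebra.TensorProduct.lid k (∀ i, K i) : k ⊗[k] (∀ i, K i) →* ∀ i, K i)
      (y : (k ⊗[k] (∀ i, K i))ˣ), funext fun v => Units.ext ?_⟩
    exact (map_ofId_eq _).symm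
  · rintro ⟨f, hf⟩
    have hN : fieldNorm k K f = 1 := by
      refine baseDiagonal_injective k ?_
      rw [← localNorm_diagonal, hf, localNorm_localTorusInclusion, map_one]
    have hN' : Algebra.norm k (f : ∀ i, K i) = 1 := congrArg Units.val hN
    refine ⟨⟨Units.map (Algebra.TensorProduct.includeRight : (∀ i, K i) →ₐ[k] k ⊗[k] (∀ i, K i))
      f, MonoidHom.mem_ker.2 (Units.ext ?_)⟩, funext fun v => Subtype.ext (Units.ext ?_)⟩
    · exact (norm_one_tmul k _).trans (by rw [hN', map_one]; rfl)
    · refine Eq.trans ?_ (congrArg Units.val (congrFun hf v))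
      exact (Algebra.TensorProduct.map_tmul _ _ _ _).trans (by rw [map_one]; rfl)

variable (k K) in
/-- The index of `T(k) U_T` in the norm-one ideles of degree zero, computed in the group
`∏_v L_v^×`. -/
lemma relIndex_torus_eq [IsGlobal k] : (torusRational k K ⊔ torusUnits k K).relIndex
      ((idelesZeroEtale k K).comap (localTorusInclusion k K)) =
    (((diagonal k K).range ⊓ (localNorm k K).ker) ⊔
      (unitIdelesEtale k K ⊓ (localNorm k K).ker)).relIndex
      (idelesZeroEtale k K ⊓ (localNorm k K).ker) := by
  rw [← Subgroup.relIndex_map_map_of_injective _ _ (localTorusInclusion_injective k K),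
    Subgroup.map_sup, torusRational_eq, torusUnits, Subgroup.map_comap_eq, Subgroup.map_comap_eq,
    Subgroup.map_comap_eq, localTorusInclusion_range]
  simp_rw [inf_comm]

variable [∀ i, Algebra.IsSeparable k (K i)] [IsGlobal k]

/-- Characters map rational points and elements of the maximal compact subgroup to ideles of degree
zero. -/
lemma local_mem_idelesZero (χ : TorusCharacter k (∀ i, K i)) :
    torusRational k K ⊔ torusUnits k K ≤ (idelesZero k).comap χ.local := by
  refine sup_le (fun x hx => ?_) fun x hx => ?_
  · obtain ⟨a, ha⟩ := local_torusRational χ hx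
    rw [Subgroup.mem_comap, ha]
    exact mem_idelesZero_baseDiagonal a
  · have h := ord_local_of_mem_torusUnits χ hx
    refine ⟨?_, ?_⟩
    · change {v : Place k | v.ord (χ.local x v) ≠ 0}.Finite
      simp [h]
    · simp [degree, h]

variable [∀ i, IsGlobal (K i)]

variable (k K) in
/-- The degree of a component of a norm-one idele is determined by the degree of the value of a
character. -/
lemma torusAdelicZero_le :
    torusAdelicZero k K ≤ (idelesZeroEtale k K).comap (localTorusInclusion k K) := by
  rintro x ⟨hx, hχ⟩
  refine mem_idelesZeroEtale.2 fun i => ?_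
  have h1 := mem_idelesEtale.1 (Subgroup.mem_comap.1 hx) i
  refine ⟨h1, (degree_eq_zero_iff h1).2 ?_⟩
  have h2 := Subgroup.mem_comap.1 (Subgroup.mem_iInf.1 hχ (factorCharacter k K i))
  have h3 := (degree_eq_zero_iff h2.1).1 h2.2
  rw [finsum_weight_mul_eq k
    (n := fun w => w.ord (component k K i (localTorusInclusion k K x) w)) h1, ← h3]
  refine finsum_congr fun v => ?_
  rw [ord_factorCharacter, ord_factorNorm]

/-- As soon as the norm-one ideles of degree zero modulo `T(k) U_T` form a torsion group, they
are all contained in `T(𝔸_k)^0`. -/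
lemma torusAdelicZero_eq
    (h : (torusRational k K ⊔ torusUnits k K).relIndex
      ((idelesZeroEtale k K).comap (localTorusInclusion k K)) ≠ 0) :
    torusAdelicZero k K = (idelesZeroEtale k K).comap (localTorusInclusion k K) := by
  refine le_antisymm (torusAdelicZero_le k K) fun x hx => ⟨?_, ?_⟩
  · exact mem_idelesEtale.2 fun i => (mem_idelesZeroEtale.1 hx i).1
  · refine Subgroup.mem_iInf.2 fun χ => ?_
    obtain ⟨m, hm, -, hmem⟩ := Subgroup.exists_pow_mem_of_relIndex_ne_zero h hx
    refine mem_idelesZero_of_pow hm ?_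
    rw [← map_pow]
    exact local_mem_idelesZero χ hmem.1

variable (k K) in
/-- The class number formula, for fields with the properties of global function fields in which
the groups of divisor classes of degree zero are finite. -/
theorem classNumber_formula
    (h : ∀ i, ∃ S : Set (Place (K i) →₀ ℤ), S.Finite ∧ ∀ D : Place (K i) →₀ ℤ,
      weightedDegree (K i) D = 0 → ∃ E ∈ S, ∃ f : (K i)ˣ, D = E + divisor f) :
    Finite (TorusClassGroupZero k K) ∧
    (principalDivisorsNormOne k K).relIndex (divisorsNormOne k K) ≠ 0 ∧
    ((constantUnitsEtale K).map (fieldNorm k K)).relIndex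
      ((constants k).toSubmonoid.units ⊓ (fieldNorm k K).range) ≠ 0 ∧
    ((unitIdelesEtale k K).map (localNorm k K)).relIndex
      (unitIdeles k ⊓ (idelesZeroEtale k K).map (localNorm k K)) ≠ 0 ∧
    (torusClassNumberZero k K : ℚ) =
      ((principalDivisorsNormOne k K).relIndex (divisorsNormOne k K) : ℚ) *
        (((constantUnitsEtale K).map (fieldNorm k K)).relIndex
          ((constants k).toSubmonoid.units ⊓ (fieldNorm k K).range) : ℚ) /
        (((unitIdelesEtale k K).map (localNorm k K)).relIndex
          (unitIdeles k ⊓ (idelesZeroEtale k K).map (localNorm k K)) : ℚ) := by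
  have hid := relIndex_mul_relIndex_eq (G := (∀ i, K i)ˣ) (G' := kˣ) (M := LocalUnitsEtale k K)
    (M' := LocalUnits k) (diagonal k K) (baseDiagonal k) (fieldNorm k K) (localNorm k K)
    (baseDiagonal_injective k) localNorm_diagonal (unitIdelesEtale_le k K)
    (unitIdelesEtale_le_comap k K) (diagonal_range_le k K)
  rw [← relIndex_principalDivisorsNormOne, comap_diagonal_unitIdelesEtale,
    comap_baseDiagonal_unitIdeles, ← relIndex_torus_eq] at hid
  have ha : (principalDivisorsNormOne k K).relIndex (divisorsNormOne k K) ≠ 0 := by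
    intro h0
    rw [principalDivisorsNormOne, AddSubgroup.inf_relIndex_right] at h0
    exact relIndex_principalDivisors_ne_zero h
      (AddSubgroup.relIndex_eq_zero_of_le_right inf_le_left h0)
  have hb : ((constantUnitsEtale K).map (fieldNorm k K)).relIndex
      ((constants k).toSubmonoid.units ⊓ (fieldNorm k K).range) ≠ 0 := by
    have hfin : Finite ((constants k).toSubmonoid.units ⊓ (fieldNorm k K).range : Subgroup kˣ) :=
      Finite.of_injective (β := (constants k).toSubmonoid.units) (fun a => ⟨a, a.2.1⟩)
        fun a b hab => Subtype.ext (Subtype.mk.inj hab)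
    exact Nat.card_pos.ne'
  have hne := mul_ne_zero ha hb
  rw [← hid] at hne
  have hT := torusAdelicZero_eq (left_ne_zero_of_mul hne)
  rw [← hT] at hid hne
  have hc := right_ne_zero_of_mul hne
  refine ⟨Nat.finite_of_card_ne_zero (left_ne_zero_of_mul hne), ha, hb, hc, ?_⟩
  rw [eq_div_iff (by exact_mod_cast hc)]
  exact_mod_cast hid

end Torus

end MultinormTorus

end

theorem proposition3p2
    (F : Type*) [Field F] [Finite F]
    (k : Type u) [Field k] [Algebra (RatFunc F) k] [FunctionField F k]
    {r : ℕ} (K : Fin r → Type u) [∀ i, Field (K i)] [∀ i, Algebra k (K i)]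
    [∀ i, FiniteDimensional k (K i)] [∀ i, Algebra.IsSeparable k (K i)] :
    Finite (TorusClassGroupZero k K) ∧
    (principalDivisorsNormOne k K).relIndex (divisorsNormOne k K) ≠ 0 ∧
    ((constantUnitsEtale K).map (fieldNorm k K)).relIndex
      ((constants k).toSubmonoid.units ⊓ (fieldNorm k K).range) ≠ 0 ∧
    ((unitIdelesEtale k K).map (localNorm k K)).relIndex
      (unitIdeles k ⊓ (idelesZeroEtale k K).map (localNorm k K)) ≠ 0 ∧
    (torusClassNumberZero k K : ℚ) =
      ((principalDivisorsNormOne k K).relIndex (divisorsNormOne k K) : ℚ) *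
        (((constantUnitsEtale K).map (fieldNorm k K)).relIndex
          ((constants k).toSubmonoid.units ⊓ (fieldNorm k K).range) : ℚ) /
        (((unitIdelesEtale k K).map (localNorm k K)).relIndex
          (unitIdeles k ⊓ (idelesZeroEtale k K).map (localNorm k K)) : ℚ) := by
  obtain ⟨E, _, _, _, _, _⟩ := exists_separable_ratFunc F k
  have hk : IsGlobal k := IsGlobal.of_extension k (RatFunc E)
  have hK : ∀ i, IsGlobal (K i) := fun i => IsGlobal.of_extension (K i) k
  refine classNumber_formula k K fun i => ?_
  let : Algebra (RatFunc E) (K i) :=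
    ((algebraMap k (K i)).comp (algebraMap (RatFunc E) k)).toAlgebra
  have : IsScalarTower (RatFunc E) k (K i) := IsScalarTower.of_algebraMap_eq fun _ => rfl
  have : FiniteDimensional (RatFunc E) (K i) := FiniteDimensional.trans (RatFunc E) k (K i)
  have : Algebra.IsSeparable (RatFunc E) (K i) := Algebra.IsSeparable.trans (RatFunc E) k (K i)
  exact exists_finite_representatives (K i) E
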